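/- Let $M$ be a smooth ($C^\infty$, Hausdorff) manifold of dimension $d$, and let $\mathcal A_d=\mathbb R[[y^1,\dots,y^d]]$, $W_d=\bigoplus_i\mathcal A_d\,\partial/\partial y^i$. Let $E_0$ be the bundle of infinite jets of smooth functions on $M$: its fibre at $x$ consists of the smooth functions defined near $x$, two of them being identified when they have the same Taylor expansion at $x$ in any local coordinates. Let $D_0$ be its canonical connection, i.e. the unique connection whose horizontal sections are precisely the jets of globally defined smooth functions. Let $M^{\mathrm{coor}}$ be the space of infinite jets at $0$ of local diffeomorphisms $\varphi$ from a neighbourhood of $0\in\mathbb R^d$ to $M$, on which $GL(d,\mathbb R)$ acts on the right by $\varphi\mapsto\varphi\circ g$; let $M^{\mathrm{aff}}=M^{\mathrm{coor}}/GL(d,\mathbb R)$, with the projection $[\varphi]\mapsto\varphi(0)$ to $M$, and let $\tilde E_0=M^{\mathrm{coor}}\times_{GL(d,\mathbb R)}\mathcal A_d$ be the bundle over $M^{\mathrm{aff}}$ of classes of pairs under $(\varphi,f)\sim(\varphi\circ g,f\circ g)$. The Lie algebra $W_d$ acts on $M^{\mathrm{coor}}$, the formal vector field $\xi$ acting at $\varphi$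 by the tangent vector $-d\varphi\cdot\xi$ (the velocity at $t=0$ of $\varphi\circ\exp(-t\xi)$). This is an isomorphism from $W_d$ onto the tangent space at every point, whose inverse is the Maurer--Cartan form $\omega_{\mathrm{MC}}$. The connection $d+\omega_{\mathrm{MC}}$ on $M^{\mathrm{coor}}\times\mathcal A_d$ induces a connection $\tilde D_0$ on $\tilde E_0$: its pull-back along a map to $M^{\mathrm{aff}}$ with smooth local lift $\varphi$ to $M^{\mathrm{coor}}$ sends the local section $[(\varphi,u)]$ to $[(\varphi,\,du+(\varphi^*\omega_{\mathrm{MC}})\,u)]$. All the spaces carry their natural smooth structures as projective limits of finite-dimensional manifolds and quotients of these by $GL(d,\mathbb R)$. Let $\varphi^{\mathrm{aff}}:x\mapsto[\varphi_x]$ be a smooth section of $M^{\mathrm{aff}}\to M$. Then: 1. The canonical connection $D_0$ exists, is unique, and is flat. 2. The pull-back $\varphi^{\mathrm{aff}*}\tilde D_0$ is a well-defined connection on $\varphi^{\mathrm{aff}*}\tilde E_0$ (it does not depend on the local lifts used to compute it), and it is flat. 3. The map sending a point $(x,f)$ of $E_0$ ($f$ being the jet at $x$ of a function) to the class of $(\varphi_x,\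 \text{Taylor expansion at }0\text{ of } f\circ\varphi_x)$ is well defined (independent of the function representing the jet and of the representative $\varphi_x$ of $\varphi^{\mathrm{aff}}(x)$). It is an isomorphism of vector bundles over $M$ from $E_0$ onto $\varphi^{\mathrm{aff}*}\tilde E_0$, i.e. it is linear and bijective on the fibres, and smooth with smooth inverse, and it intertwines $D_0$ with $\varphi^{\mathrm{aff}*}\tilde D_0$. -/

import Mathlib

open scoped Manifold ContDiff Topology
open Filter

noncomputable section

namespace FormalGeometry

/-! ### Formal power series and Taylor expansions -/

/-- The Euclidean space `ℝ^d`. -/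
abbrev Rd (d : ℕ) := EuclideanSpace ℝ (Fin d)

/-- The algebra `ℝ[[y¹, …, y^d]]` of formal power series. -/
abbrev FPS (d : ℕ) := MvPowerSeries (Fin d) ℝ

/-- The formal vector fields `W_d = ⊕ᵢ ℝ[[y]] ∂/∂yⁱ`, given by their components. -/
abbrev FormalVF (d : ℕ) := Fin d → FPS d

/-- The list of coordinate indices in which `i` occurs `α i` times. -/
def indexList {d : ℕ} (α : Fin d →₀ ℕ) : List (Fin d) := (Finsupp.toMultiset α).toList

/-- The Taylor coefficient `(∂^α g)(p) / α!`. -/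
def taylorCoeff {d : ℕ} {F : Type*} [NormedAddCommGroup F] [NormedSpace ℝ F]
    (g : Rd d → F) (p : Rd d) (α : Fin d →₀ ℕ) : F :=
  (∏ i, ((α i).factorial : ℝ))⁻¹ •
    iteratedFDeriv ℝ (indexList α).length g p
      (fun k => EuclideanSpace.single ((indexList α).get k) 1)

/-- The Taylor expansion `∑_α (∂^α g)(p) / α! y^α` of `g` at `p`. -/
def taylor {d : ℕ} (g : Rd d → ℝ) (p : Rd d) : FPS d := fun α => taylorCoeff g p α

/-- The action of `ξ = ∑ ξᵏ ∂/∂yᵏ` on formal power series. -/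
def FormalVF.apply {d : ℕ} (ξ : FormalVF d) (f : FPS d) : FPS d :=
  ∑ k, ξ k * MvPowerSeries.pderiv ℝ k f

/-- The components `∑ⱼ gⁱⱼ yʲ` of a linear map of `ℝ^d`, as power series. -/
def linSeries {d : ℕ} (g : Rd d ≃L[ℝ] Rd d) (i : Fin d) : FPS d :=
  ∑ j, g (EuclideanSpace.single j 1) i • MvPowerSeries.X j

/-- The pull-back `(g^* f)(y) = f(g y)` of power series by `g ∈ GL(d, ℝ)`. -/
def pull {d : ℕ} (g : Rd d ≃L[ℝ] Rd d) (f : FPS d) : FPS d :=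
  MvPowerSeries.subst (linSeries g) f

theorem hasSubst_linSeries {d : ℕ} (g : Rd d ≃L[ℝ] Rd d) :
    MvPowerSeries.HasSubst (linSeries g) := by
  apply MvPowerSeries.hasSubst_of_constantCoeff_zero
  intro s
  simp [linSeries, MvPowerSeries.smul_eq_C_mul]

theorem pull_add {d : ℕ} (g : Rd d ≃L[ℝ] Rd d) (f h : FPS d) :
    pull g (f + h) = pull g f + pull g h :=
  MvPowerSeries.subst_add (hasSubst_linSeries g) f h

theorem pull_smul {d : ℕ} (g : Rd d ≃L[ℝ] Rd d) (r : ℝ) (f : FPS d) :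
    pull g (r • f) = r • pull g f :=
  MvPowerSeries.subst_smul (hasSubst_linSeries g) r f

theorem pull_refl {d : ℕ} (f : FPS d) : pull (ContinuousLinearEquiv.refl ℝ (Rd d)) f = f := by
  have : linSeries (ContinuousLinearEquiv.refl ℝ (Rd d)) = MvPowerSeries.X := by
    funext i
    simp [linSeries, ite_smul]
  rw [pull, this, MvPowerSeries.subst_self]
  rfl

theorem pull_trans {d : ℕ} (g h : Rd d ≃L[ℝ] Rd d) (f : FPS d) :
    pull (g.trans h) f = pull g (pull h f) := by
  rw [pull, pull, pull,
    MvPowerSeries.subst_comp_subst_apply (hasSubst_linSeries h) (hasSubst_linSeries g)]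
  congr 1
  funext i
  rw [← MvPowerSeries.coe_substAlgHom (hasSubst_linSeries g)]
  simp only [linSeries, map_sum, map_smul]
  have key : ∀ v : Rd d, h v i = ∑ j, v j * h (EuclideanSpace.single j 1) i := by
    intro v
    have hv : v = ∑ j, v j • EuclideanSpace.single j (1 : ℝ) := by
      ext k
      simp [Finset.sum_apply, Pi.single_apply]
    conv_lhs => rw [hv]
    simp
  simp only [ContinuousLinearEquiv.trans_apply]
  rw [Finset.sum_congr rfl (fun j _ => by rw [key (g (EuclideanSpace.single j 1))])]
  simp only [Finset.sum_smul]
  rw [Finset.sum_comm]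
  refine Finset.sum_congr rfl fun j _ => ?_
  rw [MvPowerSeries.substAlgHom_X]
  simp only [linSeries, Finset.smul_sum, smul_smul]
  refine Finset.sum_congr rfl fun k _ => ?_
  rw [mul_comm]

/-! ### The jet bundle of functions -/

section Jets

variable (d : ℕ) {M : Type*} [TopologicalSpace M] [ChartedSpace (Rd d) M]

/-- Functions that are smooth on some open neighbourhood of `x`. -/
def smoothNear (x : M) : Submodule ℝ (M → ℝ) where
  carrier := {f | ∀ᶠ x' in 𝓝 x, ContMDiffAt 𝓘(ℝ, Rd d) 𝓘(ℝ, ℝ) ∞ f x'}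
  zero_mem' := Eventually.of_forall fun _ => contMDiffAt_const
  add_mem' hf hg := by filter_upwards [hf, hg] with x' h1 h2 using h1.add h2
  smul_mem' c f hf := by
    filter_upwards [hf] with x' h1
    exact (contMDiffAt_const (c := c)).mul h1

theorem contDiffAt_chart {x : M} {f : M → ℝ} (hf : f ∈ smoothNear d x)
    {e : OpenPartialHomeomorph M (Rd d)}
    (he : e ∈ IsManifold.maximalAtlas 𝓘(ℝ, Rd d) ∞ M) (hx : x ∈ e.source) (k : ℕ) :
    ContDiffAt ℝ k (f ∘ e.symm) (e x) := by
  have h1 : ContMDiffAt 𝓘(ℝ, Rd d) 𝓘(ℝ, ℝ) ∞ f (e.symm (e x)) := by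
    rw [e.left_inv hx]; exact hf.self_of_nhds
  have h2 : ContMDiffAt 𝓘(ℝ, Rd d) 𝓘(ℝ, Rd d) ∞ e.symm (e x) :=
    (contMDiffOn_symm_of_mem_maximalAtlas he).contMDiffAt
      (e.open_target.mem_nhds (e.map_source hx))
  have h3 := (h1.comp (e x) h2).contDiffAt
  exact h3.of_le (by exact_mod_cast le_top)

/-- Functions near `x` whose Taylor expansion at `x`, in any local coordinates, vanishes. -/
def flatAt (x : M) : Submodule ℝ (smoothNear d x) where
  carrier := {f | ∀ e ∈ IsManifold.maximalAtlas 𝓘(ℝ, Rd d) ∞ M, x ∈ e.source →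
    ∀ k : ℕ, iteratedFDeriv ℝ k ((f : M → ℝ) ∘ e.symm) (e x) = 0}
  zero_mem' e he hx k := by
    change iteratedFDeriv ℝ k (fun _ => (0 : ℝ)) (e x) = 0
    simp
  add_mem' {f g} hf hg e he hx k := by
    have := iteratedFDeriv_add_apply (contDiffAt_chart d f.2 he hx k)
      (contDiffAt_chart d g.2 he hx k)
    change iteratedFDeriv ℝ k ((f : M → ℝ) ∘ e.symm + (g : M → ℝ) ∘ e.symm) (e x) = 0
    rw [this, hf e he hx k, hg e he hx k, add_zero]
  smul_mem' c f hf e he hx k := by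
    have := iteratedFDeriv_const_smul_apply (a := c) (contDiffAt_chart d f.2 he hx k)
    change iteratedFDeriv ℝ k (c • ((f : M → ℝ) ∘ e.symm)) (e x) = 0
    rw [this, hf e he hx k, smul_zero]

/-- The fibre at `x` of the jet bundle `E₀`: smooth functions near `x`, two of them being
identified if they have the same Taylor expansion at `x`. -/
abbrev Jet (x : M) := smoothNear d x ⧸ flatAt d x

/-- The jet at `x` of a function. -/
def jet (x : M) (f : smoothNear d x) : Jet d x := Submodule.Quotient.mk f

/-- The section of the jet bundle given by a smooth function. -/
def jetSection (f : M → ℝ) (hf : ContMDiff 𝓘(ℝ, Rd d) 𝓘(ℝ, ℝ) ∞ f) (x : M) : Jet d x :=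
  jet d x ⟨f, Eventually.of_forall fun x' => hf x'⟩

variable {d}

/-- The trivialization of the jet bundle over a chart `e`: the jet of `f` at `x` is sent to the
Taylor expansion of `f ∘ e⁻¹` at `e x` (computed from a function representing the jet). -/
def jetCoord (e : OpenPartialHomeomorph M (Rd d)) {x : M} (q : Jet d x) : FPS d :=
  taylor (((Submodule.Quotient.mk_surjective (flatAt d x) q).choose : M → ℝ) ∘ e.symm) (e x)

/-- The trivialization does not depend on the representing function. -/
theorem jetCoord_jet {e : OpenPartialHomeomorph M (Rd d)}
    (he : e ∈ IsManifold.maximalAtlas 𝓘(ℝ, Rd d) ∞ M) {x : M} (hx : x ∈ e.source)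
    (f : smoothNear d x) : jetCoord e (jet d x f) = taylor ((f : M → ℝ) ∘ e.symm) (e x) := by
  obtain ⟨g, hg, hgf⟩ : ∃ g : smoothNear d x, jet d x g = jet d x f ∧
      jetCoord e (jet d x f) = taylor ((g : M → ℝ) ∘ e.symm) (e x) :=
    ⟨_, (Submodule.Quotient.mk_surjective (flatAt d x) (jet d x f)).choose_spec, rfl⟩
  rw [hgf]
  have h : g - f ∈ flatAt d x := (Submodule.Quotient.eq _).1 hg
  funext α
  have key : iteratedFDeriv ℝ (indexList α).length ((g : M → ℝ) ∘ e.symm) (e x) =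
      iteratedFDeriv ℝ (indexList α).length ((f : M → ℝ) ∘ e.symm) (e x) := by
    have h1 := iteratedFDeriv_add_apply (contDiffAt_chart d (g - f).2 he hx (indexList α).length)
      (contDiffAt_chart d f.2 he hx (indexList α).length)
    rw [h e he hx, zero_add] at h1
    rw [← h1]
    congr 1
    funext y
    simp
  simp only [taylor, taylorCoeff, key]

end Jets

/-! ### Jets of coordinate systems -/

section Coor

variable (d : ℕ) (M : Type*) [TopologicalSpace M] [ChartedSpace (Rd d) M]

/-- Local diffeomorphisms from a neighbourhood of `0 ∈ ℝ^d` to `M` (the values away from `0`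
do not matter). -/
structure LocalParam where
  /-- the underlying map -/
  toFun : Rd d → M
  /-- it is a diffeomorphism from a neighbourhood of `0` onto an open set -/
  isLocalDiffeo : IsLocalDiffeomorphAt 𝓘(ℝ, Rd d) 𝓘(ℝ, Rd d) ∞ toFun 0

variable {d M}

/-- The composition of a local parametrization with a linear diffeomorphism. -/
def LocalParam.compLin (φ : LocalParam d M) (g : Rd d ≃L[ℝ] Rd d) : LocalParam d M where
  toFun := φ.toFun ∘ g
  isLocalDiffeo := by
    have h1 : IsLocalDiffeomorphAt 𝓘(ℝ, Rd d) 𝓘(ℝ, Rd d) ∞ g 0 :=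
      g.toDiffeomorph.isLocalDiffeomorph 0
    have h2 : IsLocalDiffeomorphAt 𝓘(ℝ, Rd d) 𝓘(ℝ, Rd d) ∞ φ.toFun (g 0) := by
      rw [map_zero]
      exact φ.isLocalDiffeo
    exact h1.comp (K := 𝓘(ℝ, Rd d)) (P := M) h2

variable (d M)

/-- Two local parametrizations have the same infinite jet at `0`: they have the same value at `0`,
and the same Taylor expansion at `0` in any local coordinates of `M`. -/
def LocalParam.setoid : Setoid (LocalParam d M) where
  r φ ψ := φ.toFun 0 = ψ.toFun 0 ∧
    ∀ e ∈ IsManifold.maximalAtlas 𝓘(ℝ, Rd d) ∞ M, φ.toFun 0 ∈ e.source →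
      ∀ k : ℕ, iteratedFDeriv ℝ k (e ∘ φ.toFun) 0 = iteratedFDeriv ℝ k (e ∘ ψ.toFun) 0
  iseqv :=
    { refl := fun _ => ⟨rfl, fun _ _ _ _ => rfl⟩
      symm := fun h => ⟨h.1.symm, fun e he hx k => (h.2 e he (h.1 ▸ hx) k).symm⟩
      trans := fun h h' => ⟨h.1.trans h'.1, fun e he hx k =>
        (h.2 e he hx k).trans (h'.2 e he (h.1 ▸ hx) k)⟩ }

/-- `M^coor`: the infinite jets at `0` of local diffeomorphisms `ℝ^d → M`. -/
def Mcoor := Quotient (LocalParam.setoid d M)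

variable {d M}

/-- The jet of a local parametrization. -/
def Mcoor.mk (φ : LocalParam d M) : Mcoor d M := Quotient.mk (LocalParam.setoid d M) φ

/-- The projection `M^coor → M`, `φ ↦ φ(0)`. -/
def Mcoor.base : Mcoor d M → M := Quotient.lift (fun φ => φ.toFun 0) fun _ _ h => h.1

/-- The right action of `GL(d, ℝ)` on `M^coor`, `φ ↦ φ ∘ g`. -/
def Mcoor.compLin (g : Rd d ≃L[ℝ] Rd d) : Mcoor d M → Mcoor d M :=
  Quotient.map (fun φ => φ.compLin g) (by
    rintro φ ψ ⟨h0, h⟩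
    refine ⟨?_, ?_⟩
    · simpa [LocalParam.compLin] using h0
    · intro e he hx k
      have hx' : φ.toFun 0 ∈ e.source := by simpa [LocalParam.compLin] using hx
      have key : ∀ χ : LocalParam d M, iteratedFDeriv ℝ k (e ∘ (χ.compLin g).toFun) 0 =
          (iteratedFDeriv ℝ k (e ∘ χ.toFun) 0).compContinuousLinearMap fun _ => g := by
        intro χ
        have := g.iteratedFDerivWithin_comp_right (𝕜 := ℝ) (e ∘ χ.toFun)
          (s := Set.univ) uniqueDiffOn_univ (x := 0) (by simp) k
        simp only [iteratedFDerivWithin_univ, Set.preimage_univ, map_zero] at this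
        exact this
      rw [key, key, h e he hx' k])

theorem Mcoor.compLin_refl (φ : Mcoor d M) :
    φ.compLin (ContinuousLinearEquiv.refl ℝ (Rd d)) = φ := by
  induction φ using Quotient.ind
  rfl

theorem Mcoor.compLin_trans (g h : Rd d ≃L[ℝ] Rd d) (φ : Mcoor d M) :
    φ.compLin (g.trans h) = (φ.compLin h).compLin g := by
  induction φ using Quotient.ind
  rfl

theorem Mcoor.base_compLin (g : Rd d ≃L[ℝ] Rd d) (φ : Mcoor d M) :
    (φ.compLin g).base = φ.base := by
  induction φ using Quotient.ind with
  | _ φ => exact congrArg φ.toFun (map_zero g)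

/-- The coordinates on `M^coor` induced by a chart `e` of `M`: the Taylor expansions at `0` of the
components of `e ∘ φ` (computed from a representative of the jet). -/
def Mcoor.coord (e : OpenPartialHomeomorph M (Rd d)) (φ : Mcoor d M) : Fin d → FPS d :=
  fun j α => taylorCoeff (e ∘ (Quotient.out φ : LocalParam d M).toFun) 0 α j

/-- The coordinates do not depend on the representative. -/
theorem Mcoor.coord_mk {e : OpenPartialHomeomorph M (Rd d)}
    (he : e ∈ IsManifold.maximalAtlas 𝓘(ℝ, Rd d) ∞ M) (φ : LocalParam d M)
    (hx : φ.toFun 0 ∈ e.source) (j : Fin d) (α : Fin d →₀ ℕ) :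
    MvPowerSeries.coeff α ((Mcoor.mk φ).coord e j) = taylorCoeff (e ∘ φ.toFun) 0 α j := by
  have h : (LocalParam.setoid d M).r (Quotient.out (Mcoor.mk φ)) φ := Quotient.mk_out φ
  change taylorCoeff (e ∘ (Quotient.out (Mcoor.mk φ) : LocalParam d M).toFun) 0 α j = _
  simp only [taylorCoeff, h.2 e he (h.1 ▸ hx)]

variable [IsManifold 𝓘(ℝ, Rd d) ∞ M]

theorem isLocalDiffeomorphAt_chart_comp (φ : LocalParam d M) :
    IsLocalDiffeomorphAt 𝓘(ℝ, Rd d) 𝓘(ℝ, Rd d) ∞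
      (chartAt (Rd d) (φ.toFun 0) ∘ φ.toFun) 0 := by
  refine φ.isLocalDiffeo.comp (K := 𝓘(ℝ, Rd d)) (P := Rd d) ?_
  set e := chartAt (Rd d) (φ.toFun 0) with he
  have hm : e ∈ IsManifold.maximalAtlas 𝓘(ℝ, Rd d) ∞ M := IsManifold.chart_mem_maximalAtlas _
  exact ⟨{ toPartialEquiv := e.toPartialEquiv
           open_source := e.open_source
           open_target := e.open_target
           contMDiffOn_toFun := contMDiffOn_of_mem_maximalAtlas hm
           contMDiffOn_invFun := contMDiffOn_symm_of_mem_maximalAtlas hm },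
    mem_chart_source _ _, fun _ _ => rfl⟩

theorem fderiv_chart_comp_bijective (φ : LocalParam d M) :
    Function.Bijective (fderiv ℝ (chartAt (Rd d) (φ.toFun 0) ∘ φ.toFun) 0) := by
  have h := isLocalDiffeomorphAt_chart_comp φ
  have h2 := (h.mfderivToContinuousLinearEquiv (by simp)).bijective
  rw [← mfderiv_eq_fderiv]
  exact h2

/-- `GL(d, ℝ)` acts freely on `M^coor`. -/
theorem Mcoor.compLin_free (g : Rd d ≃L[ℝ] Rd d) (φ : Mcoor d M) (h : φ.compLin g = φ) :
    g = ContinuousLinearEquiv.refl ℝ (Rd d) := by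
  induction φ using Quotient.ind with
  | _ φ =>
    obtain ⟨-, h⟩ : (LocalParam.setoid d M).r (φ.compLin g) φ := Quotient.exact h
    have hb : (φ.compLin g).toFun 0 = φ.toFun 0 := congrArg φ.toFun (map_zero g)
    have h1 := h (chartAt (Rd d) (φ.toFun 0)) (IsManifold.chart_mem_maximalAtlas _)
      (by rw [hb]; exact mem_chart_source _ _) 1
    ext1
    funext v
    have h2 := congrArg (fun m => m (fun _ => v)) h1
    simp only [iteratedFDeriv_one_apply] at h2
    apply (fderiv_chart_comp_bijective φ).1
    change _ = fderiv ℝ (chartAt (Rd d) (φ.toFun 0) ∘ φ.toFun) 0 v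
    rw [← h2]
    change _ = fderiv ℝ ((chartAt (Rd d) (φ.toFun 0) ∘ φ.toFun) ∘ g) 0 v
    rw [g.comp_right_fderiv]
    simp

/-- The first Taylor coefficients are the partial derivatives. -/
theorem taylorCoeff_single {F : Type*} [NormedAddCommGroup F] [NormedSpace ℝ F]
    (g : Rd d → F) (p : Rd d) (k : Fin d) :
    taylorCoeff g p (Finsupp.single k 1) = fderiv ℝ g p (EuclideanSpace.single k 1) := by
  have hl : indexList (Finsupp.single k 1) = [k] := by simp [indexList]
  have hp : (∏ i, (((Finsupp.single k 1 : Fin d →₀ ℕ) i).factorial : ℝ)) = 1 := by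
    refine Finset.prod_eq_one fun i _ => ?_
    by_cases hi : k = i
    · subst hi; simp
    · simp [hi]
  rw [taylorCoeff, hp, inv_one, one_smul]
  rw [hl]
  exact iteratedFDeriv_one_apply _

/-! ### The action of formal vector fields and the Maurer–Cartan form

The tangent space of `M^coor` at a point `φ` is identified, through the coordinates induced by
the preferred chart of `M` at the base point of `φ`, with the space `(ℝ[[y]])^d`. -/

/-- The Jacobian matrix `∂φʲ/∂yᵏ` in the preferred chart at the base point of `φ`. -/
def Mcoor.jacobian (φ : Mcoor d M) : Matrix (Fin d) (Fin d) (FPS d) :=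
  Matrix.of fun j k => MvPowerSeries.pderiv ℝ k (φ.coord (chartAt (Rd d) φ.base) j)

/-- The infinitesimal action of formal vector fields on `M^coor` at the point `φ`: the formal vector
field `ξ` acts by the velocity at `t = 0` of `φ ∘ exp(-tξ)`, which in coordinates
is `-∑ₖ ξᵏ ∂φʲ/∂yᵏ`. (The sign is the one for which this is a morphism of Lie algebras
from `W_d` to the vector fields on `M^coor`.) -/
def Mcoor.infAction (φ : Mcoor d M) : FormalVF d →ₗ[ℝ] (Fin d → FPS d) where
  toFun ξ j := -FormalVF.apply ξ (φ.coord (chartAt (Rd d) φ.base) j)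
  map_add' ξ η := by
    funext j
    simp only [FormalVF.apply, Pi.add_apply, add_mul, Finset.sum_add_distrib, neg_add]
  map_smul' c ξ := by
    funext j
    simp only [FormalVF.apply, Pi.smul_apply, smul_mul_assoc, ← Finset.smul_sum, smul_neg,
      RingHom.id_apply]

theorem Mcoor.isUnit_det_jacobian (φ : Mcoor d M) : IsUnit φ.jacobian.det := by
  rw [MvPowerSeries.isUnit_iff_constantCoeff, RingHom.map_det, ← Matrix.isUnit_iff_isUnit_det,
    ← Matrix.mulVec_injective_iff_isUnit]
  set ψ : LocalParam d M := Quotient.out φ with hψ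
  have hb : φ.base = ψ.toFun 0 := by
    conv_lhs => rw [← Quotient.out_eq φ]
    rfl
  set L := fderiv ℝ (chartAt (Rd d) (ψ.toFun 0) ∘ ψ.toFun) 0 with hL
  have hent : ∀ j k, (MvPowerSeries.constantCoeff (R := ℝ)).mapMatrix φ.jacobian j k =
      L (EuclideanSpace.single k 1) j := by
    intro j k
    rw [RingHom.mapMatrix_apply, Matrix.map_apply, Mcoor.jacobian, Matrix.of_apply,
      ← MvPowerSeries.coeff_zero_eq_constantCoeff_apply, MvPowerSeries.coeff_pderiv, hL,
      ← taylorCoeff_single, hb]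
    simp only [zero_add, Finsupp.coe_zero, Pi.zero_apply, Nat.cast_zero, mul_one]
    rfl
  have hmv : ∀ v : Fin d → ℝ,
      Matrix.mulVec ((MvPowerSeries.constantCoeff (R := ℝ)).mapMatrix φ.jacobian) v =
        (L (WithLp.toLp 2 v)).ofLp := by
    intro v
    funext j
    have hv : (WithLp.toLp 2 v : Rd d) = ∑ k, v k • EuclideanSpace.single k (1 : ℝ) := by
      ext k
      simp [Finset.sum_apply, Pi.single_apply]
    rw [hv]
    simp only [Matrix.mulVec, dotProduct, hent]
    simp [mul_comm]
  intro v w hvw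
  rw [hmv, hmv] at hvw
  have := (fderiv_chart_comp_bijective ψ).1 (WithLp.ofLp_injective 2 hvw)
  exact WithLp.toLp_injective 2 this

/-- The infinitesimal action is an isomorphism onto the tangent space at every point. -/
theorem Mcoor.infAction_bijective (φ : Mcoor d M) : Function.Bijective φ.infAction := by
  have h : ∀ ξ, φ.infAction ξ = -φ.jacobian.mulVec ξ := by
    intro ξ
    funext j
    simp [Mcoor.infAction, FormalVF.apply, Mcoor.jacobian, Matrix.mulVec, dotProduct, mul_comm]
  constructor
  · intro ξ η hξ
    rw [h, h, neg_inj] at hξ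
    exact Matrix.mulVec_injective_of_isUnit
      ((Matrix.isUnit_iff_isUnit_det _).2 φ.isUnit_det_jacobian) hξ
  · intro τ
    refine ⟨φ.jacobian⁻¹.mulVec (-τ), ?_⟩
    rw [h, Matrix.mulVec_mulVec, Matrix.mul_nonsing_inv _ φ.isUnit_det_jacobian,
      Matrix.one_mulVec, neg_neg]

/-- The Maurer–Cartan form `ω_MC` at `φ ∈ M^coor`: the inverse of the infinitesimal action. -/
def Mcoor.omegaMC (φ : Mcoor d M) : (Fin d → FPS d) →ₗ[ℝ] FormalVF d :=
  (LinearEquiv.ofBijective φ.infAction φ.infAction_bijective).symm.toLinearMap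

end Coor

/-! ### The quotient `M^aff` and the associated bundle -/

section Aff

variable (d : ℕ) (M : Type*) [TopologicalSpace M] [ChartedSpace (Rd d) M]

/-- Two jets of coordinate systems are equivalent if they differ by a linear diffeomorphism. -/
def Mcoor.affSetoid : Setoid (Mcoor d M) where
  r φ ψ := ∃ g : Rd d ≃L[ℝ] Rd d, ψ = φ.compLin g
  iseqv :=
    { refl := fun φ => ⟨ContinuousLinearEquiv.refl ℝ (Rd d), φ.compLin_refl.symm⟩
      symm := by
        rintro φ ψ ⟨g, rfl⟩
        refine ⟨g.symm, ?_⟩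
        rw [← Mcoor.compLin_trans, ContinuousLinearEquiv.symm_trans_self, Mcoor.compLin_refl]
      trans := by
        rintro φ ψ χ ⟨g, rfl⟩ ⟨h, rfl⟩
        exact ⟨h.trans g, (Mcoor.compLin_trans h g φ).symm⟩ }

/-- `M^aff = M^coor / GL(d, ℝ)`. -/
def Maff := Quotient (Mcoor.affSetoid d M)

/-- `(φ, f)` and `(φ ∘ g, g^* f)` are equivalent for `g ∈ GL(d, ℝ)`. -/
def tildeSetoid : Setoid (Mcoor d M × FPS d) where
  r p q := ∃ g : Rd d ≃L[ℝ] Rd d, q = (p.1.compLin g, pull g p.2)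
  iseqv :=
    { refl := fun p => ⟨ContinuousLinearEquiv.refl ℝ (Rd d), by
        rw [Mcoor.compLin_refl, pull_refl]⟩
      symm := by
        rintro p q ⟨g, rfl⟩
        refine ⟨g.symm, ?_⟩
        rw [← Mcoor.compLin_trans, ← pull_trans, ContinuousLinearEquiv.symm_trans_self,
          Mcoor.compLin_refl, pull_refl]
      trans := by
        rintro p q r ⟨g, rfl⟩ ⟨h, rfl⟩
        exact ⟨h.trans g, by rw [Mcoor.compLin_trans, pull_trans]⟩ }

/-- The total space of `Ẽ₀ = M^coor ×_{GL(d, ℝ)} ℝ[[y]]`. -/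
def Tilde := Quotient (tildeSetoid d M)

variable {d M}

/-- The projection `M^coor → M^aff`. -/
def Maff.mk (φ : Mcoor d M) : Maff d M := Quotient.mk (Mcoor.affSetoid d M) φ

/-- The projection `M^aff → M`. -/
def Maff.base : Maff d M → M :=
  Quotient.lift Mcoor.base (by rintro φ ψ ⟨g, rfl⟩; exact (φ.base_compLin g).symm)

/-- The class of `(φ, f)` in `Ẽ₀`. -/
def Tilde.mk (φ : Mcoor d M) (f : FPS d) : Tilde d M := Quotient.mk (tildeSetoid d M) (φ, f)

/-- The projection `Ẽ₀ → M^aff`. -/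
def Tilde.proj : Tilde d M → Maff d M :=
  Quotient.lift (fun p => Maff.mk p.1) (by
    rintro p q ⟨g, rfl⟩
    exact Quotient.sound ⟨g, rfl⟩)

/-- The fibre of `Ẽ₀` at a point of `M^aff`. -/
def TildeFiber (a : Maff d M) := {q : Tilde d M // q.proj = a}

variable [IsManifold 𝓘(ℝ, Rd d) ∞ M]

theorem tildeFiber_bijective {a : Maff d M} (φ : Mcoor d M) (h : Maff.mk φ = a) :
    Function.Bijective (fun f : FPS d => (⟨Tilde.mk φ f, h⟩ : TildeFiber a)) := by
  constructor
  · intro f f' hf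
    obtain ⟨g, hg⟩ : (tildeSetoid d M).r (φ, f) (φ, f') :=
      Quotient.exact (congrArg Subtype.val hf)
    have h1 := congrArg Prod.fst hg
    have h2 := congrArg Prod.snd hg
    simp only at h1 h2
    rw [Mcoor.compLin_free g φ h1.symm, pull_refl] at h2
    exact h2.symm
  · rintro ⟨q, hq⟩
    induction q using Quotient.ind with
    | _ p =>
      obtain ⟨g, hg⟩ : (Mcoor.affSetoid d M).r p.1 φ :=
        Quotient.exact (hq.trans h.symm)
      refine ⟨pull g p.2, Subtype.ext ?_⟩
      refine (Quotient.sound (s := tildeSetoid d M) ⟨g, ?_⟩).symm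
      rw [hg]

/-- A point `φ` of `M^coor` over `a` identifies `ℝ[[y]]` with the fibre of `Ẽ₀` at `a`,
by `f ↦ [(φ, f)]`. -/
def tildeFiberEquiv {a : Maff d M} (φ : Mcoor d M) (h : Maff.mk φ = a) : FPS d ≃ TildeFiber a :=
  Equiv.ofBijective _ (tildeFiber_bijective φ h)

/-- The identification of the fibre with `ℝ[[y]]` by some point of `M^coor`. -/
def tildeFiberChoice (a : Maff d M) : TildeFiber a ≃ FPS d :=
  (tildeFiberEquiv (Quotient.out a) (Quotient.out_eq a)).symm

/-- The vector space structure of the fibres, see `tildeFiber_mk_add`, `tildeFiber_mk_smul`. -/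
instance (a : Maff d M) : AddCommGroup (TildeFiber a) := (tildeFiberChoice a).addCommGroup

instance (a : Maff d M) : Module ℝ (TildeFiber a) := (tildeFiberChoice a).module ℝ

theorem tildeFiber_mk_eq {a : Maff d M} (φ : Mcoor d M) (h : Maff.mk φ = a) :
    ∃ g : Rd d ≃L[ℝ] Rd d, ∀ f, tildeFiberEquiv φ h f = (tildeFiberChoice a).symm (pull g f) := by
  obtain ⟨g, hg⟩ : (Mcoor.affSetoid d M).r φ (Quotient.out a) :=
    Quotient.exact (h.trans (Quotient.out_eq a).symm)
  refine ⟨g, fun f => Subtype.ext (Quotient.sound ⟨g, ?_⟩)⟩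
  rw [hg]

/-- The vector space structure of the fibres is `[(φ, f)] + [(φ, f')] = [(φ, f + f')]` and
`r [(φ, f)] = [(φ, r f)]`, for every representative `φ`. -/
theorem tildeFiber_mk_add {a : Maff d M} (φ : Mcoor d M) (h : Maff.mk φ = a) (f f' : FPS d) :
    tildeFiberEquiv φ h f + tildeFiberEquiv φ h f' = tildeFiberEquiv φ h (f + f') := by
  obtain ⟨g, hg⟩ := tildeFiber_mk_eq φ h
  rw [hg, hg, hg, pull_add, Equiv.add_def, Equiv.apply_symm_apply, Equiv.apply_symm_apply]

theorem tildeFiber_mk_smul {a : Maff d M} (φ : Mcoor d M) (h : Maff.mk φ = a) (r : ℝ)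
    (f : FPS d) : r • tildeFiberEquiv φ h f = tildeFiberEquiv φ h (r • f) := by
  obtain ⟨g, hg⟩ := tildeFiber_mk_eq φ h
  rw [hg, hg, pull_smul, Equiv.smul_def, Equiv.apply_symm_apply]

end Aff

/-! ### Smooth maps

The spaces above are infinite dimensional (projective limits of manifolds, and quotients of
these by a free action of `GL(d, ℝ)`). Their smooth structure is described by the
smooth maps from finite-dimensional manifolds to them. -/

section Smooth

variable {d : ℕ} {M : Type*} [TopologicalSpace M] [ChartedSpace (Rd d) M]
  {F : Type*} [NormedAddCommGroup F] [NormedSpace ℝ F]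
  {N : Type*} [TopologicalSpace N] [ChartedSpace F N]

variable (F)

/-- Smoothness of a map to `ℝ[[y]]`: all the coefficients are smooth. -/
def SeriesSmoothAt (u : N → FPS d) (n : N) : Prop :=
  ∀ α, ContMDiffAt 𝓘(ℝ, F) 𝓘(ℝ, ℝ) ∞ (fun n' => MvPowerSeries.coeff α (u n')) n

/-- The differential of a map to `ℝ[[y]]`, taken coefficientwise. -/
def dSeries (u : N → FPS d) (n : N) (v : TangentSpace 𝓘(ℝ, F) n) : FPS d :=
  fun α => mfderiv 𝓘(ℝ, F) 𝓘(ℝ, ℝ) (fun n' => MvPowerSeries.coeff α (u n')) n v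

/-- Smoothness of a map to the total space of the jet bundle `E₀`, in the trivializations
given by the charts of `M`. -/
def JetSmoothAt (p : N → Σ x : M, Jet d x) (n : N) : Prop :=
  ContMDiffAt 𝓘(ℝ, F) 𝓘(ℝ, Rd d) ∞ (fun n' => (p n').1) n ∧
  ∀ e ∈ IsManifold.maximalAtlas 𝓘(ℝ, Rd d) ∞ M, (p n).1 ∈ e.source →
    SeriesSmoothAt F (fun n' => jetCoord e (p n').2) n

/-- Smoothness of a map to `M^coor`, in the coordinates given by the charts of `M`. -/
def CoorSmoothAt (c : N → Mcoor d M) (n : N) : Prop :=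
  ContMDiffAt 𝓘(ℝ, F) 𝓘(ℝ, Rd d) ∞ (fun n' => (c n').base) n ∧
  ∀ e ∈ IsManifold.maximalAtlas 𝓘(ℝ, Rd d) ∞ M, (c n).base ∈ e.source →
    ∀ j, SeriesSmoothAt F (fun n' => (c n').coord e j) n

/-- Smoothness of a map to `M^aff = M^coor / GL(d, ℝ)`: there are smooth local lifts. -/
def AffSmoothAt (a : N → Maff d M) (n : N) : Prop :=
  ∃ c : N → Mcoor d M, ∀ᶠ n' in 𝓝 n, CoorSmoothAt F c n' ∧ a n' = Maff.mk (c n')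

/-- `(c, u)` is, near `n`, a smooth lift to `M^coor × ℝ[[y]]` of the map `q` to `Ẽ₀`. -/
def IsLiftAt (q : N → Tilde d M) (c : N → Mcoor d M) (u : N → FPS d) (n : N) : Prop :=
  ∀ᶠ n' in 𝓝 n, CoorSmoothAt F c n' ∧ SeriesSmoothAt F u n' ∧ q n' = Tilde.mk (c n') (u n')

/-- Smoothness of a map to the total space of `Ẽ₀`: there are smooth local lifts. -/
def TildeSmoothAt (q : N → Tilde d M) (n : N) : Prop :=
  ∃ (c : N → Mcoor d M) (u : N → FPS d), IsLiftAt F q c u n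

/-- Smoothness of a map to the total space of the pull-back of `Ẽ₀` by `σ : M → M^aff`. -/
def PullSmoothAt (σ : M → Maff d M) (p : N → Σ x : M, TildeFiber (σ x)) (n : N) : Prop :=
  ContMDiffAt 𝓘(ℝ, F) 𝓘(ℝ, Rd d) ∞ (fun n' => (p n').1) n ∧
  TildeSmoothAt F (fun n' => (p n').2.1) n

/-- The velocity of a smooth map to `M^coor` along `v`, as a tangent vector of `M^coor`
in the preferred coordinates. -/
def velocity (c : N → Mcoor d M) (n : N) (v : TangentSpace 𝓘(ℝ, F) n) : Fin d → FPS d :=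
  fun j => dSeries F (fun n' => (c n').coord (chartAt (Rd d) (c n).base) j) n v

theorem IsLiftAt.proj_eq {a : N → Maff d M} {s : ∀ n, TildeFiber (a n)} {c : N → Mcoor d M}
    {u : N → FPS d} {n : N} (h : IsLiftAt F (fun n' => (s n').1) c u n) :
    Maff.mk (c n) = a n := by
  have h1 := (s n).2
  have h2 : (s n).1 = Tilde.mk (c n) (u n) := h.self_of_nhds.2.2
  rw [h2] at h1
  exact h1

variable [IsManifold 𝓘(ℝ, Rd d) ∞ M]

/-- The connection `D̃₀ = d + ω_MC` on the trivial bundle `M^coor × ℝ[[y]]`, pulled back by a smooth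
map `c` to `M^coor`. -/
def trivialConn (c : N → Mcoor d M) (u : N → FPS d) (n : N) (v : TangentSpace 𝓘(ℝ, F) n) :
    FPS d :=
  dSeries F u n v + FormalVF.apply ((c n).omegaMC (velocity F c n v)) (u n)

open Classical in
/-- The connection on the pull-back of `Ẽ₀` by a map `a` to `M^aff` that is induced by
`D̃₀ = d + ω_MC`: if the section `s` is `[(c, u)]` near `n` with `c`, `u` smooth, then its
covariant derivative at `n` is `[(c, du + ω_MC(dc) u)]`. -/
def tildeConn (a : N → Maff d M) (s : ∀ n, TildeFiber (a n)) (n : N)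
    (v : TangentSpace 𝓘(ℝ, F) n) : TildeFiber (a n) :=
  if h : ∃ (c : N → Mcoor d M) (u : N → FPS d), IsLiftAt F (fun n' => (s n').1) c u n then
    tildeFiberEquiv (h.choose n) (IsLiftAt.proj_eq F h.choose_spec.choose_spec)
      (trivialConn F h.choose h.choose_spec.choose n v)
  else 0

end Smooth

/-! ### Connections on bundles over `M` -/

section Connections

variable {d : ℕ} {M : Type*} [TopologicalSpace M] [ChartedSpace (Rd d) M]

/-- Smooth sections of the jet bundle. -/
def JetSection (s : ∀ x : M, Jet d x) : Prop := ∀ x, JetSmoothAt (Rd d) (fun x => ⟨x, s x⟩) x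

/-- Smooth sections of the pull-back of `Ẽ₀` by `σ : M → M^aff`. -/
def PullSection (σ : M → Maff d M) (s : ∀ x : M, TildeFiber (σ x)) : Prop :=
  ∀ x, PullSmoothAt (Rd d) σ (fun x => ⟨x, s x⟩) x

/-- Smooth sections of `M^aff → M`. -/
structure IsAffSection (σ : M → Maff d M) : Prop where
  smooth : ∀ x, AffSmoothAt (Rd d) σ x
  base_eq : ∀ x, (σ x).base = x

variable [IsManifold 𝓘(ℝ, Rd d) ∞ M]

/-- Smooth vector fields on `M`. -/
def SmoothVF (X : ∀ x : M, TangentSpace 𝓘(ℝ, Rd d) x) : Prop :=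
  ContMDiff 𝓘(ℝ, Rd d) 𝓘(ℝ, Rd d).tangent ∞
    (fun x => (⟨x, X x⟩ : TangentBundle 𝓘(ℝ, Rd d) M))

variable {V : M → Type*} [∀ x, AddCommGroup (V x)] [∀ x, Module ℝ (V x)]

/-- `D` is a connection on the vector bundle with fibres `V x` and the given smooth sections:
it sends smooth sections to smooth one-forms with values in the bundle, and it is additive and
satisfies the Leibniz rule. -/
structure IsConnection (Smooth : (∀ x, V x) → Prop)
    (D : (∀ x, V x) → ∀ x : M, TangentSpace 𝓘(ℝ, Rd d) x → V x) : Prop where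
  linear : ∀ s, Smooth s → ∀ x, IsLinearMap ℝ (D s x)
  smooth : ∀ s, Smooth s → ∀ X : ∀ x : M, TangentSpace 𝓘(ℝ, Rd d) x, SmoothVF X →
    Smooth fun x => D s x (X x)
  add : ∀ s t, Smooth s → Smooth t → ∀ x v, D (fun x => s x + t x) x v = D s x v + D t x v
  leibniz : ∀ (g : M → ℝ) s, ContMDiff 𝓘(ℝ, Rd d) 𝓘(ℝ, ℝ) ∞ g → Smooth s → ∀ x v,
    D (fun x => g x • s x) x v =
      (show ℝ from mfderiv 𝓘(ℝ, Rd d) 𝓘(ℝ, ℝ) g x v) • s x + g x • D s x v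

/-- The curvature of the connection vanishes. -/
def IsFlat (Smooth : (∀ x, V x) → Prop)
    (D : (∀ x, V x) → ∀ x : M, TangentSpace 𝓘(ℝ, Rd d) x → V x) : Prop :=
  ∀ X Y : ∀ x : M, TangentSpace 𝓘(ℝ, Rd d) x, SmoothVF X → SmoothVF Y → ∀ s, Smooth s → ∀ x,
    D (fun x => D s x (Y x)) x (X x) - D (fun x => D s x (X x)) x (Y x)
      - D s x (VectorField.mlieBracket 𝓘(ℝ, Rd d) X Y x) = 0

/-- The canonical connection `D₀` of the jet bundle: the connection whose horizontal sections are
precisely the jets of globally defined smooth functions. -/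
structure IsCanonicalConnection
    (D : (∀ x : M, Jet d x) → ∀ x : M, TangentSpace 𝓘(ℝ, Rd d) x → Jet d x) : Prop where
  isConnection : IsConnection JetSection D
  horizontal_iff : ∀ s, JetSection s →
    ((∀ x v, D s x v = 0) ↔ ∃ (f : M → ℝ) (hf : ContMDiff 𝓘(ℝ, Rd d) 𝓘(ℝ, ℝ) ∞ f),
      s = jetSection d f hf)

end Connections

end FormalGeometry

end

open FormalGeometry

/-! In a chart `e`, a jet at `x` is a formal power series, the Taylor expansion of `f ∘ e⁻¹` at `e
x`. The series determines the jet, and by Borel's theorem every series occurs (`jetEquiv`). For a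
family of jets with coordinates u whose base point moves with velocity a, the covariant derivative
is du - ∑ aⱼ ∂ⱼu (`jetDeriv`). It measures the failure of u to consist of the Taylor expansions of
one single function.

A point φ of M^coor over x, with expansion C in the chart, sends u to u(C - C(0)), written u∘C below
(`comp`): this is the expansion of f ∘ φ. Differentiating a family of such compositions gives (du)∘C
+ ∑ (∂ⱼu∘C) (dCⱼ - dCⱼ(0)). The Maurer-Cartan form supplies the ξ with ξCⱼ = -dCⱼ, so ξ(u∘C) = -∑
(∂ⱼu∘C) dCⱼ. In the sum only the constants dCⱼ(0) survive, and they are the velocity a of the base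
point. Hence (d + ω_MC)(u∘C) = (du - ∑ aⱼ ∂ⱼu)∘C (`dSeries_comp_add_apply`, `trivialConn_comp`),
which is the intertwining property. The canonical derivative on the right does not involve the lift,
so independence of the lift is a by-product. The connection axioms and flatness are then transported
from the jet bundle, without using the Maurer-Cartan equation. The same identity for a ξ with
constant coefficients shows that the covariant derivative does not depend on the chart
(`jetDeriv_comp`).

On the jet bundle, horizontality says recursively that all coefficients are derivatives of the
constant term, so horizontal sections are jets of functions. The difference of two canonical
connections, and the curvature of one, are linear over smooth functions and kill jets of global
functions. Such an operator vanishes (`eq_zero_of_tensorial`): bump functions realize every jet at x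
by a global function, and Hadamard's lemma, applied to each coefficient, writes a section vanishing
at x as a combination with coefficients vanishing at x.

On the fibres, a local inverse of φ together with Borel's theorem gives surjectivity. The invertible
Jacobian gives injectivity and, by division by its determinant degree by degree, smoothness of the
inverse. Identities of series and smoothness of families are proved throughout by induction on the
degree, through constant terms and partial derivatives (`eqUpTo_succ`, `smoothUpTo_succ`), so no
formula for higher derivatives of compositions is needed. -/

namespace FormalGeometry

noncomputable section

/-! ### Composition of formal power series -/

section Series

variable {d : ℕ}

/-- Two power series have the same coefficients up to degree `n`. -/
def EqUpTo (n : ℕ) (F G : FPS d) : Prop :=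
  ∀ α : Fin d →₀ ℕ, α.degree ≤ n → MvPowerSeries.coeff α F = MvPowerSeries.coeff α G

theorem exists_eq_add_single {α : Fin d →₀ ℕ} (h : α ≠ 0) :
    ∃ (β : Fin d →₀ ℕ) (k : Fin d), α = β + Finsupp.single k 1 ∧ α.degree = β.degree + 1 := by
  obtain ⟨k, hk⟩ := Finsupp.ne_iff.1 h
  have hle : Finsupp.single k 1 ≤ α := by
    rw [Finsupp.single_le_iff]
    exact Nat.one_le_iff_ne_zero.2 hk
  have e : α = (α - Finsupp.single k 1) + Finsupp.single k 1 := (tsub_add_cancel_of_le hle).symm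
  refine ⟨_, k, e, ?_⟩
  conv_lhs => rw [e]
  simp

theorem pderiv_comm (F : FPS d) (i j : Fin d) :
    MvPowerSeries.pderiv ℝ j (MvPowerSeries.pderiv ℝ i F) =
      MvPowerSeries.pderiv ℝ i (MvPowerSeries.pderiv ℝ j F) := by
  ext α
  simp only [MvPowerSeries.coeff_pderiv, add_right_comm α, Finsupp.coe_add, Pi.add_apply]
  by_cases hij : i = j
  · subst hij; rfl
  · simp only [Finsupp.single_eq_of_ne hij, Finsupp.single_eq_of_ne (Ne.symm hij)]
    push_cast; ring

theorem EqUpTo.refl (n : ℕ) (F : FPS d) : EqUpTo n F F := fun _ _ => rfl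

theorem EqUpTo.trans {n : ℕ} {F G H : FPS d} (h : EqUpTo n F G) (h' : EqUpTo n G H) :
    EqUpTo n F H := fun α hα => (h α hα).trans (h' α hα)

theorem EqUpTo.symm {n : ℕ} {F G : FPS d} (h : EqUpTo n F G) : EqUpTo n G F :=
  fun α hα => (h α hα).symm

theorem EqUpTo.add {n : ℕ} {F G F' G' : FPS d} (h : EqUpTo n F G) (h' : EqUpTo n F' G') :
    EqUpTo n (F + F') (G + G') := fun α hα => by
  rw [map_add, map_add, h α hα, h' α hα]

theorem EqUpTo.sum {ι : Type*} {s : Finset ι} {n : ℕ} {F G : ι → FPS d}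
    (h : ∀ i ∈ s, EqUpTo n (F i) (G i)) : EqUpTo n (∑ i ∈ s, F i) (∑ i ∈ s, G i) := fun α hα => by
  rw [map_sum, map_sum]
  exact Finset.sum_congr rfl fun i hi => h i hi α hα

theorem EqUpTo.mul {n : ℕ} {F G F' G' : FPS d} (h : EqUpTo n F G) (h' : EqUpTo n F' G') :
    EqUpTo n (F * F') (G * G') := fun α hα => by
  classical
  rw [MvPowerSeries.coeff_mul, MvPowerSeries.coeff_mul]
  refine Finset.sum_congr rfl fun p hp => ?_
  have hd : p.1.degree + p.2.degree = α.degree := by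
    rw [← map_add, Finset.HasAntidiagonal.mem_antidiagonal.1 hp]
  rw [h _ (by omega), h' _ (by omega)]

theorem eqUpTo_zero {F G : FPS d} :
    EqUpTo 0 F G ↔ MvPowerSeries.constantCoeff F = MvPowerSeries.constantCoeff G := by
  constructor
  · intro h
    simpa using h 0 (by simp)
  · intro h α hα
    have : α = 0 := by
      rw [← Finsupp.degree_eq_zero_iff]; omega
    subst this
    simpa using h

theorem EqUpTo.pderiv {n : ℕ} {F G : FPS d} (h : EqUpTo (n + 1) F G) (k : Fin d) :
    EqUpTo n (MvPowerSeries.pderiv ℝ k F) (MvPowerSeries.pderiv ℝ k G) := fun α hα => by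
  rw [MvPowerSeries.coeff_pderiv, MvPowerSeries.coeff_pderiv, h _ (by simpa using hα)]

/-- In characteristic zero a coefficient of positive degree can be read off from a partial
derivative, after division by the nonzero exponent. This is the induction step behind the product
rule, the chain rule and the differentiation of compositions below. -/
theorem eqUpTo_succ {n : ℕ} {F G : FPS d}
    (h0 : MvPowerSeries.constantCoeff F = MvPowerSeries.constantCoeff G)
    (h : ∀ k, EqUpTo n (MvPowerSeries.pderiv ℝ k F) (MvPowerSeries.pderiv ℝ k G)) :
    EqUpTo (n + 1) F G := fun α hα => by
  by_cases hz : α = 0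
  · subst hz; simpa using h0
  obtain ⟨β, k, rfl, hd⟩ := exists_eq_add_single hz
  have := h k β (by omega)
  rw [MvPowerSeries.coeff_pderiv, MvPowerSeries.coeff_pderiv] at this
  exact mul_right_cancel₀ (by positivity) this

theorem eq_of_eqUpTo {F G : FPS d} (h : ∀ n, EqUpTo n F G) : F = G := by
  ext α
  exact h _ α le_rfl

/-- The series with their constant terms removed. -/
def recenter (C : Fin d → FPS d) (j : Fin d) : FPS d :=
  C j - MvPowerSeries.C (MvPowerSeries.constantCoeff (C j))

theorem constantCoeff_recenter (C : Fin d → FPS d) (j : Fin d) :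
    MvPowerSeries.constantCoeff (recenter C j) = 0 := by
  simp [recenter]

theorem hasSubst_recenter (C : Fin d → FPS d) : MvPowerSeries.HasSubst (recenter C) :=
  MvPowerSeries.hasSubst_of_constantCoeff_zero (constantCoeff_recenter C)

/-- The substitution `F(C - C(0))`: the Taylor expansion of a composition, if `F` is the expansion
of the outer function (at its base point) and `C` the expansion of the inner one. -/
def comp (C : Fin d → FPS d) : FPS d →ₐ[ℝ] FPS d :=
  MvPowerSeries.substAlgHom (hasSubst_recenter C)

theorem comp_apply (C : Fin d → FPS d) (F : FPS d) :
    comp C F = MvPowerSeries.subst (recenter C) F := by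
  rw [comp, MvPowerSeries.coe_substAlgHom]

/-- The substituted series have no constant term, hence order at least 1, so substitution cannot
lower the order. This is the continuity that allows series to be replaced by truncations. -/
theorem eqUpTo_comp_zero (C : Fin d → FPS d) {n : ℕ} {F : FPS d} (h : EqUpTo n F 0) :
    EqUpTo n (comp C F) 0 := by
  have h1 : ((n + 1 : ℕ) : ℕ∞) ≤ F.order := by
    refine MvPowerSeries.le_order fun α hα => ?_
    have : α.degree < n + 1 := by exact_mod_cast hα
    simpa using h α (by omega)
  have h2 : (1 : ℕ∞) ≤ ⨅ i, (recenter C i).order := by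
    refine le_iInf fun i => ?_
    rw [MvPowerSeries.one_le_order_iff_constCoeff_eq_zero]
    exact constantCoeff_recenter C i
  have h3 := MvPowerSeries.le_order_subst (hasSubst_recenter C) F
  intro α hα
  rw [comp_apply, map_zero]
  refine MvPowerSeries.coeff_of_lt_order (lt_of_lt_of_le ?_
    (((h1.trans (le_mul_of_one_le_left (zero_le) h2))).trans h3))
  exact_mod_cast Nat.lt_succ_of_le hα

theorem EqUpTo.comp (C : Fin d → FPS d) {n : ℕ} {F G : FPS d} (h : EqUpTo n F G) :
    EqUpTo n (comp C F) (comp C G) := by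
  have h1 : EqUpTo n (F - G) 0 := fun α hα => by rw [map_sub, h α hα, sub_self, map_zero]
  intro α hα
  have := eqUpTo_comp_zero C h1 α hα
  rwa [map_sub, map_sub, map_zero, sub_eq_zero] at this

theorem comp_C (C : Fin d → FPS d) (r : ℝ) :
    comp C (MvPowerSeries.C r) = MvPowerSeries.C r := by
  have := (comp C).commutes r
  simpa [MvPowerSeries.algebraMap_apply] using this

@[simp]
theorem constantCoeff_comp (C : Fin d → FPS d) (F : FPS d) :
    MvPowerSeries.constantCoeff (comp C F) = MvPowerSeries.constantCoeff F := by
  have h : EqUpTo 0 F (MvPowerSeries.C (MvPowerSeries.constantCoeff F)) := by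
    rw [eqUpTo_zero]; simp
  have := eqUpTo_zero.1 (h.comp C)
  rw [this, comp_C, MvPowerSeries.constantCoeff_C]

theorem comp_X (C : Fin d → FPS d) (j : Fin d) : comp C (MvPowerSeries.X j) = recenter C j := by
  rw [comp_apply, MvPowerSeries.subst_X (hasSubst_recenter C)]

theorem pderiv_recenter (C : Fin d → FPS d) (j k : Fin d) :
    MvPowerSeries.pderiv ℝ k (recenter C j) = MvPowerSeries.pderiv ℝ k (C j) := by
  simp [recenter]

theorem pderiv_comp_coe (C : Fin d → FPS d) (P : MvPolynomial (Fin d) ℝ) (k : Fin d) :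
    MvPowerSeries.pderiv ℝ k (comp C P) =
      ∑ j, comp C (MvPowerSeries.pderiv ℝ j (P : FPS d)) * MvPowerSeries.pderiv ℝ k (C j) := by
  classical
  induction P using MvPolynomial.induction_on with
  | C a =>
    rw [MvPolynomial.coe_C, comp_C]
    simp
  | add p q hp hq =>
    simp only [MvPolynomial.coe_add, map_add, hp, hq, add_mul, Finset.sum_add_distrib]
  | mul_X p i hp =>
    simp only [MvPolynomial.coe_mul, MvPolynomial.coe_X, map_mul, Derivation.leibniz, hp, comp_X,
      pderiv_recenter, smul_eq_mul, map_add, add_mul, Finset.sum_add_distrib, Finset.mul_sum]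
    congr 1
    · rw [Finset.sum_eq_single i]
      · simp
      · intro j _ hj
        rw [MvPowerSeries.pderiv_X_of_ne hj.symm]; simp
      · simp
    · exact Finset.sum_congr rfl fun j _ => by ring

/-- The chain rule holds for polynomials by induction and passes to series because both sides, up to
a given degree, depend only on a truncation of `F`. -/
theorem pderiv_comp (C : Fin d → FPS d) (F : FPS d) (k : Fin d) :
    MvPowerSeries.pderiv ℝ k (comp C F) =
      ∑ j, comp C (MvPowerSeries.pderiv ℝ j F) * MvPowerSeries.pderiv ℝ k (C j) := by
  refine eq_of_eqUpTo fun n => ?_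
  -- Differentiation costs one degree, so agreement up to `n + 1` is required; `truncTotal (n + 2)`
  -- keeps exactly the degrees below `n + 2`.
  have h : EqUpTo (n + 1) F (MvPowerSeries.truncTotal (n + 2) F : MvPolynomial (Fin d) ℝ) := by
    intro α hα
    rw [MvPolynomial.coeff_coe, MvPowerSeries.coeff_truncTotal _ (by omega)]
  have h1 := (h.comp C).pderiv k
  rw [pderiv_comp_coe] at h1
  exact h1.trans (EqUpTo.sum fun j _ => ((h.symm.pderiv j).comp C).mul (EqUpTo.refl _ _))

theorem pull_eq_comp (g : Rd d ≃L[ℝ] Rd d) (F : FPS d) : pull g F = comp (linSeries g) F := by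
  rw [pull, comp_apply]
  congr 1
  funext i
  have : MvPowerSeries.constantCoeff (linSeries g i) = 0 := by
    simp [linSeries, MvPowerSeries.smul_eq_C_mul]
  rw [recenter, this]; simp

end Series

/-! ### Taylor expansions -/

section Taylor

variable {d : ℕ} {F : Type*} [NormedAddCommGroup F] [NormedSpace ℝ F]

/-- Smoothness in a neighbourhood of a point. -/
def SmoothNear {E : Type*} [NormedAddCommGroup E] [NormedSpace ℝ E] (g : E → F) (p : E) : Prop :=
  ∀ᶠ x in 𝓝 p, ContDiffAt ℝ ∞ g x

theorem SmoothNear.eventually {E : Type*} [NormedAddCommGroup E] [NormedSpace ℝ E] {g : E → F}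
    {p : E} (h : SmoothNear g p) : ∀ᶠ x in 𝓝 p, SmoothNear g x :=
  eventually_eventually_nhds.2 h

theorem SmoothNear.differentiableAt {E : Type*} [NormedAddCommGroup E] [NormedSpace ℝ E] {g : E → F}
    {p : E} (h : SmoothNear g p) : DifferentiableAt ℝ g p :=
  (h.self_of_nhds).differentiableAt (by simp)

/-- The partial derivative in the direction of the `k`-th basis vector. -/
def partialDeriv (k : Fin d) (g : Rd d → F) (x : Rd d) : F :=
  fderiv ℝ g x (EuclideanSpace.single k 1)

/-- Iterated partial derivatives. -/
def listDeriv : List (Fin d) → (Rd d → F) → Rd d → F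
  | [], g => g
  | k :: l, g => partialDeriv k (listDeriv l g)

theorem SmoothNear.partialDeriv {g : Rd d → F} {p : Rd d} (h : SmoothNear g p) (k : Fin d) :
    SmoothNear (partialDeriv k g) p := by
  filter_upwards [h] with x hx
  exact (hx.fderiv_right (m := ∞) (by simp)).clm_apply contDiffAt_const

theorem SmoothNear.listDeriv {g : Rd d → F} {p : Rd d} (h : SmoothNear g p) (l : List (Fin d)) :
    SmoothNear (listDeriv l g) p := by
  induction l with
  | nil => exact h
  | cons k l ih => exact ih.partialDeriv k

/-- The induction differentiates an equality of functions, so the equality must hold on a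
neighbourhood. This is why smoothness is assumed near `p`: `ContDiffAt ℝ ∞` at a single point only
gives, for each finite order, a neighbourhood depending on that order. -/
theorem SmoothNear.iteratedFDeriv_single {g : Rd d → F} {p : Rd d} (h : SmoothNear g p)
    (l : List (Fin d)) :
    iteratedFDeriv ℝ l.length g p (fun i => EuclideanSpace.single (l.get i) 1) =
      FormalGeometry.listDeriv l g p := by
  induction l generalizing p with
  | nil => simp [FormalGeometry.listDeriv]
  | cons k l ih =>
    have hev : (fun x => iteratedFDeriv ℝ l.length g x
        (fun i => EuclideanSpace.single (l.get i) 1)) =ᶠ[𝓝 p] FormalGeometry.listDeriv l g := by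
      filter_upwards [h.eventually] with x hx using ih hx
    have hd : DifferentiableAt ℝ (iteratedFDeriv ℝ l.length g) p :=
      h.self_of_nhds.differentiableAt_iteratedFDeriv (by
        exact_mod_cast ENat.natCast_lt_top _)
    have h2 := (((ContinuousMultilinearMap.apply ℝ (fun _ : Fin l.length => Rd d) F
      (fun i => EuclideanSpace.single (l.get i) 1)).hasFDerivAt).comp p hd.hasFDerivAt).fderiv
    change iteratedFDeriv ℝ (l.length + 1) g p _ = FormalGeometry.partialDeriv k _ p
    rw [iteratedFDeriv_succ_apply_left, FormalGeometry.partialDeriv, ← hev.fderiv_eq]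
    change _ = fderiv ℝ ((ContinuousMultilinearMap.apply ℝ (fun _ : Fin l.length => Rd d) F
      (fun i => EuclideanSpace.single (l.get i) 1)) ∘ iteratedFDeriv ℝ l.length g) p _
    rw [h2]
    rfl

theorem SmoothNear.partialDeriv_comm {g : Rd d → F} {p : Rd d} (h : SmoothNear g p)
    (j k : Fin d) :
    FormalGeometry.partialDeriv j (FormalGeometry.partialDeriv k g) p =
      FormalGeometry.partialDeriv k (FormalGeometry.partialDeriv j g) p := by
  have hs : IsSymmSndFDerivAt ℝ g p :=
    h.self_of_nhds.isSymmSndFDerivAt (by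
      simp only [minSmoothness_of_isRCLikeNormedField]
      exact WithTop.coe_le_coe.2 (le_top : (2 : ℕ∞) ≤ ⊤))
  have hd : DifferentiableAt ℝ (fderiv ℝ g) p :=
    (h.self_of_nhds.fderiv_right (m := ∞) (by simp)).differentiableAt (by simp)
  have key : ∀ v w : Rd d, fderiv ℝ (fun x => fderiv ℝ g x w) p v =
      fderiv ℝ (fderiv ℝ g) p v w := by
    intro v w
    rw [fderiv_clm_apply hd (differentiableAt_const _)]
    simp
  change fderiv ℝ (fun x => fderiv ℝ g x _) p _ = fderiv ℝ (fun x => fderiv ℝ g x _) p _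
  rw [key, key]
  exact hs _ _

/-- Adjacent transpositions generate all permutations, and each is the symmetry of second
derivatives. The order of the indices in `indexList` is an arbitrary choice, so this invariance is
needed to relate different multi-indices. -/
theorem SmoothNear.listDeriv_perm {g : Rd d → F} {l l' : List (Fin d)} (hl : l.Perm l') :
    ∀ {p : Rd d}, SmoothNear g p →
      FormalGeometry.listDeriv l g p = FormalGeometry.listDeriv l' g p := by
  induction hl with
  | nil => intros; rfl
  | @cons k l₁ l₂ _ ih =>
    intro p h
    have hev : FormalGeometry.listDeriv l₁ g =ᶠ[𝓝 p] FormalGeometry.listDeriv l₂ g := by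
      filter_upwards [h.eventually] with x hx using ih hx
    simp only [FormalGeometry.listDeriv, FormalGeometry.partialDeriv, hev.fderiv_eq]
  | swap j k l =>
    intro p h
    exact (h.listDeriv l).partialDeriv_comm k j
  | trans _ _ ih ih' => exact fun h => (ih h).trans (ih' h)

theorem listDeriv_append_singleton (l : List (Fin d)) (k : Fin d) (g : Rd d → F) :
    listDeriv (l ++ [k]) g = listDeriv l (partialDeriv k g) := by
  induction l with
  | nil => rfl
  | cons j l ih => simp only [List.cons_append, listDeriv, ih]

theorem SmoothNear.taylorCoeff_eq {g : Rd d → F} {p : Rd d} (h : SmoothNear g p)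
    (α : Fin d →₀ ℕ) : taylorCoeff g p α =
      (∏ i, ((α i).factorial : ℝ))⁻¹ • FormalGeometry.listDeriv (indexList α) g p := by
  rw [taylorCoeff, h.iteratedFDeriv_single]

theorem indexList_add_single_perm (α : Fin d →₀ ℕ) (k : Fin d) :
    (indexList (α + Finsupp.single k 1)).Perm (indexList α ++ [k]) := by
  rw [← Multiset.coe_eq_coe, ← Multiset.coe_add]
  simp [indexList]

theorem taylorCoeff_zero (g : Rd d → F) (p : Rd d) : taylorCoeff g p 0 = g p := by
  have hl : indexList (0 : Fin d →₀ ℕ) = [] := by simp [indexList]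
  rw [taylorCoeff, hl]
  simp

theorem SmoothNear.taylorCoeff_partialDeriv {g : Rd d → F} {p : Rd d} (h : SmoothNear g p)
    (α : Fin d →₀ ℕ) (k : Fin d) :
    taylorCoeff (FormalGeometry.partialDeriv k g) p α =
      ((α k : ℝ) + 1) • taylorCoeff g p (α + Finsupp.single k 1) := by
  rw [h.taylorCoeff_eq, (h.partialDeriv k).taylorCoeff_eq,
    SmoothNear.listDeriv_perm (indexList_add_single_perm α k) h, listDeriv_append_singleton,
    smul_smul]
  congr 1
  have : ∏ i, (((α + Finsupp.single k 1 : Fin d →₀ ℕ) i).factorial : ℝ) =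
      ((α k : ℝ) + 1) * ∏ i, ((α i).factorial : ℝ) := by
    classical
    rw [← Finset.mul_prod_erase _ _ (Finset.mem_univ k),
      ← Finset.mul_prod_erase _ (fun i => ((α i).factorial : ℝ)) (Finset.mem_univ k), ← mul_assoc]
    congr 1
    · simp [Nat.factorial_succ]
    · refine Finset.prod_congr rfl fun i hi => ?_
      have : k ≠ i := fun e => (Finset.ne_of_mem_erase hi) e.symm
      simp [this]
  rw [this, mul_inv, ← mul_assoc, mul_inv_cancel₀ (by positivity), one_mul]

theorem coeff_taylor (g : Rd d → ℝ) (p : Rd d) (α : Fin d →₀ ℕ) :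
    MvPowerSeries.coeff α (taylor g p) = taylorCoeff g p α := rfl

@[simp]
theorem constantCoeff_taylor (g : Rd d → ℝ) (p : Rd d) :
    MvPowerSeries.constantCoeff (taylor g p) = g p := taylorCoeff_zero g p

theorem SmoothNear.pderiv_taylor {g : Rd d → ℝ} {p : Rd d} (h : SmoothNear g p) (k : Fin d) :
    MvPowerSeries.pderiv ℝ k (taylor g p) = taylor (FormalGeometry.partialDeriv k g) p := by
  ext α
  rw [MvPowerSeries.coeff_pderiv, coeff_taylor, coeff_taylor, h.taylorCoeff_partialDeriv,
    smul_eq_mul, mul_comm]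

theorem taylorCoeff_congr {g h : Rd d → F} {p : Rd d} (e : g =ᶠ[𝓝 p] h) (α : Fin d →₀ ℕ) :
    taylorCoeff g p α = taylorCoeff h p α := by
  rw [taylorCoeff, taylorCoeff, (e.iteratedFDeriv ℝ _).self_of_nhds]

theorem taylor_congr {g h : Rd d → ℝ} {p : Rd d} (e : g =ᶠ[𝓝 p] h) : taylor g p = taylor h p :=
  funext fun α => taylorCoeff_congr e α

theorem SmoothNear.taylorCoeff_clm {G : Type*} [NormedAddCommGroup G] [NormedSpace ℝ G]
    {g : Rd d → F} {p : Rd d} (h : SmoothNear g p) (L : F →L[ℝ] G) (α : Fin d →₀ ℕ) :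
    taylorCoeff (fun x => L (g x)) p α = L (taylorCoeff g p α) := by
  have := L.iteratedFDeriv_comp_left (i := (indexList α).length) (n := ∞) h.self_of_nhds
    (by exact_mod_cast le_top)
  rw [taylorCoeff, taylorCoeff]
  change _ • iteratedFDeriv ℝ _ (L ∘ g) p _ = _
  rw [this, map_smul]
  rfl

theorem SmoothNear.coord {g : Rd d → Rd d} {p : Rd d} (h : SmoothNear g p) (j : Fin d) :
    SmoothNear (fun x => g x j) p := by
  filter_upwards [h] with x hx
  exact (EuclideanSpace.proj (𝕜 := ℝ) j).contDiff.contDiffAt.comp x hx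

/-- The Taylor expansions of the components of a map. -/
def taylorMap (g : Rd d → Rd d) (p : Rd d) (j : Fin d) : FPS d := taylor (fun x => g x j) p

theorem SmoothNear.coeff_taylorMap {g : Rd d → Rd d} {p : Rd d} (h : SmoothNear g p) (j : Fin d)
    (α : Fin d →₀ ℕ) : MvPowerSeries.coeff α (taylorMap g p j) = taylorCoeff g p α j :=
  h.taylorCoeff_clm (EuclideanSpace.proj (𝕜 := ℝ) j) α

theorem SmoothNear.mul {g h : Rd d → ℝ} {p : Rd d} (hg : SmoothNear g p) (hh : SmoothNear h p) :
    SmoothNear (fun x => g x * h x) p := by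
  filter_upwards [hg, hh] with x h1 h2 using h1.mul h2

theorem SmoothNear.sum {ι : Type*} {s : Finset ι} {g : ι → Rd d → F} {p : Rd d}
    (hg : ∀ i ∈ s, SmoothNear (g i) p) : SmoothNear (fun x => ∑ i ∈ s, g i x) p := by
  have : ∀ᶠ x in 𝓝 p, ∀ i ∈ s, ContDiffAt ℝ ∞ (g i) x := (eventually_all_finset s).2 hg
  filter_upwards [this] with x hx using ContDiffAt.sum hx

theorem SmoothNear.comp {f : Rd d → F} {g : Rd d → Rd d} {p : Rd d} (hf : SmoothNear f (g p))
    (hg : SmoothNear g p) : SmoothNear (fun x => f (g x)) p := by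
  have := hg.differentiableAt.continuousAt.tendsto.eventually hf
  filter_upwards [hg, this] with x h1 h2 using h2.comp x h1

theorem SmoothNear.taylor_add {g h : Rd d → ℝ} {p : Rd d} (hg : SmoothNear g p)
    (hh : SmoothNear h p) : taylor (fun x => g x + h x) p = taylor g p + taylor h p := by
  ext α
  rw [map_add, coeff_taylor, coeff_taylor, coeff_taylor, taylorCoeff, taylorCoeff, taylorCoeff]
  have := iteratedFDeriv_add_apply (i := (indexList α).length)
    (hg.self_of_nhds.of_le (by exact_mod_cast le_top))
    (hh.self_of_nhds.of_le (by exact_mod_cast le_top))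
  change _ • iteratedFDeriv ℝ _ (g + h) p _ = _
  rw [this, ← smul_add]
  rfl

theorem SmoothNear.taylor_smul {g : Rd d → ℝ} {p : Rd d} (hg : SmoothNear g p) (r : ℝ) :
    taylor (fun x => r * g x) p = r • taylor g p := by
  ext α
  exact hg.taylorCoeff_clm (r • ContinuousLinearMap.id ℝ ℝ) α

theorem taylor_zero (p : Rd d) : taylor (fun _ => (0 : ℝ)) p = 0 := by
  ext α
  rw [coeff_taylor, taylorCoeff]
  have : iteratedFDeriv ℝ (indexList α).length (fun _ : Rd d => (0 : ℝ)) p = 0 := by simp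
  rw [this]; simp

theorem SmoothNear.taylor_sum {ι : Type*} {s : Finset ι} {g : ι → Rd d → ℝ} {p : Rd d}
    (hg : ∀ i ∈ s, SmoothNear (g i) p) :
    taylor (fun x => ∑ i ∈ s, g i x) p = ∑ i ∈ s, taylor (g i) p := by
  classical
  induction s using Finset.induction_on with
  | empty => simpa using taylor_zero p
  | insert i s hi ih =>
    simp only [Finset.sum_insert hi]
    rw [SmoothNear.taylor_add (hg i (by simp))
      (SmoothNear.sum fun j hj => hg j (by simp [hj])), ih fun j hj => hg j (by simp [hj])]

theorem SmoothNear.eventuallyEq_partialDeriv_mul {g h : Rd d → ℝ} {p : Rd d} (hg : SmoothNear g p)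
    (hh : SmoothNear h p) (k : Fin d) :
    FormalGeometry.partialDeriv k (fun x => g x * h x) =ᶠ[𝓝 p]
      fun x => g x * FormalGeometry.partialDeriv k h x + h x * FormalGeometry.partialDeriv k g x := by
  filter_upwards [hg.eventually, hh.eventually] with x h1 h2
  rw [FormalGeometry.partialDeriv, fderiv_fun_mul h1.differentiableAt h2.differentiableAt]
  rfl

/-- Both sides have the same constant term and obey the same Leibniz rule, so agreement propagates
from one degree to the next; the induction must run over all pairs of functions at once. -/
theorem SmoothNear.taylor_mul {g h : Rd d → ℝ} {p : Rd d} (hg : SmoothNear g p)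
    (hh : SmoothNear h p) : taylor (fun x => g x * h x) p = taylor g p * taylor h p := by
  refine eq_of_eqUpTo fun n => ?_
  induction n generalizing g h with
  | zero => rw [eqUpTo_zero]; simp
  | succ n ih =>
    refine eqUpTo_succ (by simp) fun k => ?_
    rw [(hg.mul hh).pderiv_taylor, taylor_congr (hg.eventuallyEq_partialDeriv_mul hh k),
      (hg.mul (hh.partialDeriv k)).taylor_add (hh.mul (hg.partialDeriv k)), Derivation.leibniz,
      hg.pderiv_taylor, hh.pderiv_taylor]
    exact (ih hg (hh.partialDeriv k)).add (ih hh (hg.partialDeriv k))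

theorem euclideanSpace_eq_sum (v : Rd d) : v = ∑ j, v j • EuclideanSpace.single j (1 : ℝ) := by
  ext k
  simp [Pi.single_apply]

theorem fderiv_eq_sum_partialDeriv (g : Rd d → F) (p v : Rd d) :
    fderiv ℝ g p v = ∑ j, v j • partialDeriv j g p := by
  conv_lhs => rw [euclideanSpace_eq_sum v]
  simp [partialDeriv]

theorem SmoothNear.eventuallyEq_partialDeriv_comp {f : Rd d → ℝ} {g : Rd d → Rd d} {p : Rd d}
    (hf : SmoothNear f (g p)) (hg : SmoothNear g p) (k : Fin d) :
    FormalGeometry.partialDeriv k (fun x => f (g x)) =ᶠ[𝓝 p]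
      fun x => ∑ j, FormalGeometry.partialDeriv j f (g x) *
        FormalGeometry.partialDeriv k (fun y => g y j) x := by
  have := hg.differentiableAt.continuousAt.tendsto.eventually hf
  filter_upwards [hg, this] with x h1 h2
  have d1 := h1.differentiableAt (by simp)
  have d2 := h2.differentiableAt (by simp)
  rw [FormalGeometry.partialDeriv]
  have := (d2.hasFDerivAt.comp x d1.hasFDerivAt).fderiv
  change fderiv ℝ (f ∘ g) x _ = _
  rw [this, ContinuousLinearMap.comp_apply, fderiv_eq_sum_partialDeriv]
  refine Finset.sum_congr rfl fun j _ => ?_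
  have hj : fderiv ℝ (fun y => g y j) x = (EuclideanSpace.proj (𝕜 := ℝ) j).comp (fderiv ℝ g x) :=
    ((EuclideanSpace.proj (𝕜 := ℝ) j).hasFDerivAt.comp x d1.hasFDerivAt).fderiv
  rw [smul_eq_mul, mul_comm, FormalGeometry.partialDeriv, FormalGeometry.partialDeriv, hj]
  rfl

/-- The Taylor expansion of a composition. -/
theorem SmoothNear.taylor_comp {f : Rd d → ℝ} {g : Rd d → Rd d} {p : Rd d}
    (hf : SmoothNear f (g p)) (hg : SmoothNear g p) :
    taylor (fun x => f (g x)) p = FormalGeometry.comp (taylorMap g p) (taylor f (g p)) := by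
  -- The analytic and the formal chain rule have the same shape: partial derivatives of `f`,
  -- composed with `g`, times first derivatives of `g`. Induction on the degree, for all `f`, then
  -- compares the composed factors.
  refine eq_of_eqUpTo fun n => ?_
  induction n generalizing f with
  | zero => rw [eqUpTo_zero]; simp
  | succ n ih =>
    refine eqUpTo_succ (by simp) fun k => ?_
    have hs : ∀ j, SmoothNear (fun x => FormalGeometry.partialDeriv j f (g x)) p :=
      fun j => (hf.partialDeriv j).comp hg
    have hs' : ∀ j, SmoothNear (FormalGeometry.partialDeriv k fun y => g y j) p :=
      fun j => (hg.coord j).partialDeriv k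
    rw [(hf.comp hg).pderiv_taylor, taylor_congr (hf.eventuallyEq_partialDeriv_comp hg k),
      SmoothNear.taylor_sum fun j _ => (hs j).mul (hs' j), pderiv_comp]
    refine EqUpTo.sum fun j _ => ?_
    rw [(hs j).taylor_mul (hs' j), hf.pderiv_taylor, taylorMap, (hg.coord j).pderiv_taylor]
    exact (ih (hf.partialDeriv j)).mul (EqUpTo.refl _ _)

/-- The derivatives are determined by the Taylor coefficients. -/
theorem SmoothNear.iteratedFDeriv_eq_zero {g : Rd d → F} {p : Rd d} (h : SmoothNear g p)
    (h0 : ∀ α, taylorCoeff g p α = 0) (k : ℕ) : iteratedFDeriv ℝ k g p = 0 := by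
  apply ContinuousMultilinearMap.toMultilinearMap_injective
  refine Module.Basis.ext_multilinear
    (fun _ => (EuclideanSpace.basisFun (Fin d) ℝ).toBasis) fun v => ?_
  have hl : (List.ofFn v).length = k := List.length_ofFn
  -- On basis vectors the multilinear form is an iterated partial derivative, which up to order is
  -- the one of the multi-index counting the entries of `v`.
  have hz : FormalGeometry.listDeriv (List.ofFn v) g p = 0 := by
    have hp : (indexList (Multiset.toFinsupp (List.ofFn v : Multiset (Fin d)))).Perm
        (List.ofFn v) := by
      rw [← Multiset.coe_eq_coe]
      simp [indexList]
    rw [← SmoothNear.listDeriv_perm hp h]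
    have := h0 (Multiset.toFinsupp (List.ofFn v : Multiset (Fin d)))
    rw [h.taylorCoeff_eq] at this
    refine (smul_eq_zero.1 this).resolve_left (inv_ne_zero ?_)
    exact Finset.prod_ne_zero_iff.2 fun i _ => by positivity
  rw [← h.iteratedFDeriv_single] at hz
  have key : ∀ (m : ℕ) (hm : m = k) (w : Fin m → Fin d), (∀ i : Fin m, w i = v (Fin.cast hm i)) →
      iteratedFDeriv ℝ m g p (fun i => EuclideanSpace.single (w i) 1) =
      iteratedFDeriv ℝ k g p (fun i => EuclideanSpace.single (v i) 1) := by
    rintro m rfl w hw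
    congr 1
    funext i
    rw [hw i]; rfl
  rw [key _ hl _ (fun i => by simp; rfl)] at hz
  simpa using hz

theorem taylor_const (r : ℝ) (p : Rd d) : taylor (fun _ => r) p = MvPowerSeries.C r := by
  refine MvPowerSeries.pderiv.ext (fun i => ?_) (by simp)
  rw [SmoothNear.pderiv_taylor (Eventually.of_forall fun x => contDiffAt_const),
    MvPowerSeries.pderiv_C]
  convert taylor_zero p using 2
  funext x
  simp [partialDeriv]

/-- A series is determined by its constant term and its partial derivatives, and the partial
derivatives of a linear map are the constants given by its matrix entries. -/
theorem taylorMap_clm (g : Rd d ≃L[ℝ] Rd d) : taylorMap g 0 = linSeries g := by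
  have hsm : ∀ p, SmoothNear g p := fun p => Eventually.of_forall fun x => g.contDiff.contDiffAt
  funext j
  have hX : ∀ (k : Fin d), FormalGeometry.partialDeriv k (fun x => g x j) =
      fun _ => g (EuclideanSpace.single k 1) j := by
    intro k
    funext x
    exact congrArg (fun L : Rd d →L[ℝ] ℝ => L (EuclideanSpace.single k 1))
      ((EuclideanSpace.proj (𝕜 := ℝ) j).comp (g : Rd d →L[ℝ] Rd d)).fderiv
  refine MvPowerSeries.pderiv.ext (fun k => ?_) ?_
  · rw [taylorMap, ((hsm 0).coord j).pderiv_taylor, hX, taylor_const]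
    simp only [linSeries, map_sum, Derivation.map_smul]
    rw [Finset.sum_eq_single k]
    · simp [MvPowerSeries.smul_eq_C_mul]
    · intro i _ hi
      rw [MvPowerSeries.pderiv_X_of_ne hi, smul_zero]
    · simp
  · simp [taylorMap, linSeries, MvPowerSeries.smul_eq_C_mul]

theorem SmoothNear.taylor_comp_clm {f : Rd d → ℝ} (g : Rd d ≃L[ℝ] Rd d) (hf : SmoothNear f 0) :
    taylor (fun x => f (g x)) 0 = pull g (taylor f 0) := by
  rw [SmoothNear.taylor_comp (by rwa [map_zero])
    (Eventually.of_forall fun x => g.contDiff.contDiffAt), taylorMap_clm, pull_eq_comp, map_zero]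

end Taylor

/-! ### Borel's theorem -/

section Borel

variable {d : ℕ}

theorem _root_.ContDiff.smoothNear {E F : Type*} [NormedAddCommGroup E] [NormedSpace ℝ E]
    [NormedAddCommGroup F] [NormedSpace ℝ F] {f : E → F} (hf : ContDiff ℝ ∞ f) (p : E) :
    SmoothNear f p := Eventually.of_forall fun _ => hf.contDiffAt

theorem contDiff_coord (i : Fin d) : ContDiff ℝ ∞ fun y : Rd d => y i :=
  (EuclideanSpace.proj (𝕜 := ℝ) i).contDiff

theorem taylor_coord (i : Fin d) : taylor (fun y : Rd d => y i) 0 = MvPowerSeries.X i := by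
  have := congrFun (taylorMap_clm (ContinuousLinearEquiv.refl ℝ (Rd d))) i
  have h2 : linSeries (ContinuousLinearEquiv.refl ℝ (Rd d)) i = MvPowerSeries.X i := by
    simp [linSeries, ite_smul]
  rw [← h2, ← this]
  rfl

theorem taylor_pow {g : Rd d → ℝ} {p : Rd d} (hg : ContDiff ℝ ∞ g) (n : ℕ) :
    taylor (fun x => g x ^ n) p = taylor g p ^ n := by
  induction n with
  | zero => simpa using taylor_const (1 : ℝ) p
  | succ n ih =>
    simp only [pow_succ]
    rw [((hg.pow n).smoothNear p).taylor_mul (hg.smoothNear p), ih]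

theorem taylor_prod {ι : Type*} (s : Finset ι) {g : ι → Rd d → ℝ} {p : Rd d}
    (hg : ∀ i, ContDiff ℝ ∞ (g i)) :
    taylor (fun x => ∏ i ∈ s, g i x) p = ∏ i ∈ s, taylor (g i) p := by
  classical
  induction s using Finset.induction_on with
  | empty => simpa using taylor_const (1 : ℝ) p
  | insert i s hi ih =>
    simp only [Finset.prod_insert hi]
    rw [((hg i).smoothNear p).taylor_mul
      ((contDiff_prod fun j _ => hg j).smoothNear p), ih]

theorem taylor_monomial (α : Fin d →₀ ℕ) :
    taylor (fun y : Rd d => ∏ i, y i ^ α i) 0 = MvPowerSeries.monomial α 1 := by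
  rw [taylor_prod _ fun i => (contDiff_coord i).pow _, MvPowerSeries.monomial_one_eq,
    Finsupp.prod_fintype _ _ (by simp)]
  exact Finset.prod_congr rfl fun i _ => by rw [taylor_pow (contDiff_coord i), taylor_coord]

/-- The homogeneous part of degree `n` of a power series, as a function. -/
def homPart (F : FPS d) (n : ℕ) (y : Rd d) : ℝ :=
  ∑ α ∈ Finset.finsuppAntidiag Finset.univ n, MvPowerSeries.coeff α F * ∏ i, y i ^ α i

theorem contDiff_homPart (F : FPS d) (n : ℕ) : ContDiff ℝ ∞ (homPart F n) :=
  ContDiff.sum fun _ _ => contDiff_const.mul (contDiff_prod fun i _ => (contDiff_coord i).pow _)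

theorem mem_finsuppAntidiag_univ {n : ℕ} {α : Fin d →₀ ℕ} :
    α ∈ Finset.finsuppAntidiag Finset.univ n ↔ α.degree = n := by
  simp [Finset.mem_finsuppAntidiag, Finsupp.degree_eq_sum]

theorem homPart_smul (F : FPS d) (n : ℕ) (r : ℝ) (y : Rd d) :
    homPart F n (r • y) = r ^ n * homPart F n y := by
  simp only [homPart, Finset.mul_sum]
  refine Finset.sum_congr rfl fun α hα => ?_
  rw [mem_finsuppAntidiag_univ, Finsupp.degree_eq_sum] at hα
  have : ∏ i, (r • y) i ^ α i = r ^ n * ∏ i, y i ^ α i := by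
    rw [← hα, ← Finset.prod_pow_eq_pow_sum, ← Finset.prod_mul_distrib]
    exact Finset.prod_congr rfl fun i _ => by simp [mul_pow]
  rw [this]; ring

theorem coeff_taylor_homPart (F : FPS d) (n : ℕ) (α : Fin d →₀ ℕ) :
    MvPowerSeries.coeff α (taylor (homPart F n) 0) =
      if α.degree = n then MvPowerSeries.coeff α F else 0 := by
  classical
  have hs : ∀ β : Fin d →₀ ℕ, ContDiff ℝ ∞ fun y : Rd d => ∏ i, y i ^ β i :=
    fun β => contDiff_prod fun i _ => (contDiff_coord i).pow _
  change MvPowerSeries.coeff α (taylor (fun y => ∑ β ∈ Finset.finsuppAntidiag Finset.univ n,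
    MvPowerSeries.coeff β F * ∏ i, y i ^ β i) 0) = _
  rw [SmoothNear.taylor_sum fun β _ => (contDiff_const.mul (hs β)).smoothNear _, map_sum]
  simp only [((hs _).smoothNear 0).taylor_smul, taylor_monomial, map_smul,
    MvPowerSeries.coeff_monomial, smul_eq_mul, mul_ite, mul_one, mul_zero]
  rw [Finset.sum_ite_eq]
  simp only [mem_finsuppAntidiag_univ]

/-- Scaling the variable by 2 multiplies the k-th derivative at 0 by 2^k, while homogeneity
multiplies it by 2^n; since k ≠ n it is zero. -/
theorem iteratedFDeriv_homPart (F : FPS d) {k n : ℕ} (h : k < n) :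
    iteratedFDeriv ℝ k (homPart F n) 0 = 0 := by
  have h1 := congrFun (iteratedFDeriv_comp_const_smul (i := k) (2 : ℝ)
    ((contDiff_homPart F n).of_le (by exact_mod_cast le_top))) 0
  have h2 : (fun z => homPart F n ((2 : ℝ) • z)) = (2 : ℝ) ^ n • homPart F n := by
    funext z; rw [homPart_smul]; rfl
  rw [h2, iteratedFDeriv_const_smul_apply
    (((contDiff_homPart F n).of_le (by exact_mod_cast le_top)).contDiffAt), smul_zero,
    ← sub_eq_zero, ← sub_smul] at h1
  refine (smul_eq_zero.1 h1).resolve_left (sub_ne_zero.2 ?_)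
  exact (pow_lt_pow_right₀ one_lt_two h).ne'

/-- **Borel's theorem**: every formal power series is the Taylor expansion of a smooth function. -/
theorem exists_contDiff_taylor_eq (F : FPS d) :
    ∃ f : Rd d → ℝ, ContDiff ℝ ∞ f ∧ taylor f 0 = F := by
  let χ : ContDiffBump (0 : Rd d) := default
  let h : ℕ → Rd d → ℝ := fun n y => χ y * homPart F n y
  have hh : ∀ n, ContDiff ℝ ∞ (h n) := fun n => χ.contDiff.mul (contDiff_homPart F n)
  have hc : ∀ n, HasCompactSupport (h n) := fun n => χ.hasCompactSupport.mul_right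
  have hb : ∀ n k : ℕ, ∃ B, ∀ x, ‖iteratedFDeriv ℝ k (h n) x‖ ≤ B := fun n k =>
    ((hh n).continuous_iteratedFDeriv (by exact_mod_cast le_top)).bounded_above_of_compact_support
      ((hc n).iteratedFDeriv k)
  choose B hB using hb
  -- The factor 2^n yields a geometric bound, the sum dominates all derivatives of `h n` of order
  -- below n, and the summand 1 ensures `1 ≤ R n`.
  let R : ℕ → ℝ := fun n => 2 ^ n * (1 + ∑ k ∈ Finset.range n, |B n k|)
  have hsum : ∀ n, 0 ≤ ∑ k ∈ Finset.range n, |B n k| :=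
    fun n => Finset.sum_nonneg fun _ _ => abs_nonneg _
  have hR : ∀ n, 1 ≤ R n := fun n =>
    one_le_mul_of_one_le_of_one_le (one_le_pow₀ one_le_two) (by linarith [hsum n])
  have hR0 : ∀ n, 0 < R n := fun n => lt_of_lt_of_le one_pos (hR n)
  -- By homogeneity this is `χ (R n • y) * homPart F n y`: the homogeneous part, cut off at scale `1
  -- / R n`. A derivative of order k < n acquires the factor R^k / R^n ≤ 1 / R, which absorbs the
  -- bounds `B n k`.
  let f : ℕ → Rd d → ℝ := fun n y => (R n ^ n)⁻¹ * h n (R n • y)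
  have hf : ∀ n, ContDiff ℝ ∞ (f n) := fun n =>
    contDiff_const.mul ((hh n).comp (contDiff_const_smul (R n)))
  have hbound : ∀ n k, k < n → ∀ x, ‖iteratedFDeriv ℝ k (f n) x‖ ≤ (1 / 2) ^ n := by
    intro n k hk x
    have h1 := congrFun (iteratedFDeriv_comp_const_smul (i := k) (R n)
      ((hh n).of_le (by exact_mod_cast le_top))) x
    have h2 : iteratedFDeriv ℝ k (f n) x =
        (R n ^ n)⁻¹ • iteratedFDeriv ℝ k (fun y => h n (R n • y)) x :=
      iteratedFDeriv_const_smul_apply (a := (R n ^ n)⁻¹)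
        ((((hh n).comp (contDiff_const_smul (R n))).of_le
          (by exact_mod_cast le_top)).contDiffAt)
    rw [h2, h1, norm_smul, norm_smul, norm_inv, norm_pow, norm_pow, Real.norm_of_nonneg (hR0 n).le]
    have h3 : B n k ≤ ∑ k ∈ Finset.range n, |B n k| :=
      (le_abs_self _).trans (Finset.single_le_sum (f := fun k => |B n k|)
        (fun _ _ => abs_nonneg _) (Finset.mem_range.2 hk))
    have h4 : R n ^ k * R n ≤ R n ^ n := by
      rw [← pow_succ]; exact pow_le_pow_right₀ (hR n) hk
    have h5 : ‖iteratedFDeriv ℝ k (h n) (R n • x)‖ ≤ (1 / 2) ^ n * R n := by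
      have : (1 / 2 : ℝ) ^ n * R n = 1 + ∑ k ∈ Finset.range n, |B n k| := by
        change (1 / 2 : ℝ) ^ n * (2 ^ n * _) = _
        rw [← mul_assoc, ← mul_pow]; norm_num
      rw [this]
      linarith [hB n k (R n • x)]
    rw [inv_mul_le_iff₀ (pow_pos (hR0 n) n)]
    calc R n ^ k * ‖iteratedFDeriv ℝ k (h n) (R n • x)‖ ≤ R n ^ k * ((1 / 2) ^ n * R n) :=
          mul_le_mul_of_nonneg_left h5 (pow_nonneg (hR0 n).le _)
      _ = (R n ^ k * R n) * (1 / 2) ^ n := by ring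
      _ ≤ R n ^ n * (1 / 2) ^ n := mul_le_mul_of_nonneg_right h4 (by positivity)
  have hgeo : Summable fun n : ℕ => (1 / 2 : ℝ) ^ n := summable_geometric_two
  have hev : ∀ n, f n =ᶠ[𝓝 0] homPart F n := by
    intro n
    have h1 : Tendsto (fun y : Rd d => R n • y) (𝓝 0) (𝓝 0) := by
      have : Continuous fun y : Rd d => R n • y := continuous_const_smul _
      simpa using this.tendsto 0
    filter_upwards [h1.eventually χ.eventuallyEq_one] with y hy
    change (R n ^ n)⁻¹ * (χ (R n • y) * homPart F n (R n • y)) = _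
    rw [hy, homPart_smul, Pi.one_apply, one_mul, ← mul_assoc,
      inv_mul_cancel₀ (pow_pos (hR0 n) n).ne', one_mul]
  -- For each order k the bound is only available for n > k, that is, for all but finitely many
  -- terms; this suffices for term-by-term differentiation.
  have hsmooth : ContDiff ℝ ∞ fun y => ∑' n, f n y := by
    refine contDiff_tsum_of_eventually (v := fun _ n => (1 / 2 : ℝ) ^ n) hf (fun _ _ => hgeo) ?_
    intro k _
    rw [Nat.cofinite_eq_atTop]
    filter_upwards [eventually_gt_atTop k] with n hn x using hbound n k hn x
  refine ⟨fun y => ∑' n, f n y, hsmooth, ?_⟩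
  ext α
  set K := α.degree with hK
  -- To read off the coefficient of degree K, split off the terms of index greater than K. This tail
  -- is uniformly controlled up to order K, and its K-th derivative at 0 vanishes because each term
  -- agrees near 0 with a homogeneous polynomial of degree greater than K.
  let g : Rd d → ℝ := fun y => ∑' n, f (n + (K + 1)) y
  have hg : ContDiff ℝ K g := by
    refine contDiff_tsum (N := K) (v := fun _ n => (1 / 2 : ℝ) ^ (n + (K + 1)))
      (fun n => (hf _).of_le (by exact_mod_cast le_top))
      (fun _ _ => (summable_nat_add_iff (K + 1)).2 hgeo) ?_
    intro k i x hk
    have hk : k ≤ K := by exact_mod_cast hk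
    exact hbound _ _ (by omega) x
  have hg0 : iteratedFDeriv ℝ K g 0 = 0 := by
    have := iteratedFDeriv_tsum_apply (N := K) (k := K)
      (v := fun _ n => (1 / 2 : ℝ) ^ (n + (K + 1))) (f := fun n => f (n + (K + 1)))
      (fun n => (hf _).of_le (by exact_mod_cast le_top))
      (fun _ _ => (summable_nat_add_iff (K + 1)).2 hgeo) (by
        intro k i x hk
        have hk : k ≤ K := by exact_mod_cast hk
        exact hbound _ _ (by omega) x) le_rfl 0
    change iteratedFDeriv ℝ K (fun y => ∑' n, f (n + (K + 1)) y) 0 = 0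
    rw [this]
    have : ∀ n, iteratedFDeriv ℝ K (f (n + (K + 1))) 0 = 0 := fun n => by
      rw [((hev _).iteratedFDeriv ℝ K).self_of_nhds, iteratedFDeriv_homPart F (by omega)]
    simp [this]
  have hdec : (fun y => ∑' n, f n y) = (fun y => ∑ n ∈ Finset.range (K + 1), f n y) + g := by
    funext y
    refine (Summable.sum_add_tsum_nat_add (K + 1) ?_).symm
    refine Summable.of_norm_bounded_eventually hgeo ?_
    rw [Nat.cofinite_eq_atTop]
    filter_upwards [eventually_gt_atTop 0] with n hn
    simpa using hbound n 0 hn y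
  have hl : (indexList α).length = K := by
    rw [hK, indexList, Multiset.length_toList, Finsupp.card_toMultiset]
    rfl
  have hfin : taylorCoeff (fun y => ∑' n, f n y) 0 α =
      taylorCoeff (fun y => ∑ n ∈ Finset.range (K + 1), f n y) 0 α := by
    rw [taylorCoeff, taylorCoeff, hdec, iteratedFDeriv_add_apply]
    · have : iteratedFDeriv ℝ (indexList α).length g 0 = 0 := by rw [hl]; exact hg0
      rw [this, add_zero]
    · exact ((ContDiff.sum fun n _ => hf n).of_le (by exact_mod_cast le_top)).contDiffAt
    · rw [hl]; exact hg.contDiffAt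
  rw [coeff_taylor, hfin, ← coeff_taylor,
    SmoothNear.taylor_sum fun n _ => (hf n).smoothNear 0, map_sum]
  have : ∀ n, MvPowerSeries.coeff α (taylor (f n) 0) =
      if K = n then MvPowerSeries.coeff α F else 0 := fun n => by
    rw [taylor_congr (hev n), coeff_taylor_homPart]
  simp only [this]
  rw [Finset.sum_ite_eq]
  simp

end Borel

/-! ### Smooth families of power series -/

section Families

variable {d : ℕ} {F : Type*} [NormedAddCommGroup F] [NormedSpace ℝ F]
  {N : Type*} [TopologicalSpace N] [ChartedSpace F N]

variable (F) in
/-- The differential of a real function. -/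
def dFun (f : N → ℝ) (n : N) (v : TangentSpace 𝓘(ℝ, F) n) : ℝ :=
  mfderiv 𝓘(ℝ, F) 𝓘(ℝ, ℝ) f n v

theorem dFun_add {f g : N → ℝ} {n : N} (hf : MDifferentiableAt 𝓘(ℝ, F) 𝓘(ℝ, ℝ) f n)
    (hg : MDifferentiableAt 𝓘(ℝ, F) 𝓘(ℝ, ℝ) g n) (v : TangentSpace 𝓘(ℝ, F) n) :
    dFun F (fun n' => f n' + g n') n v = dFun F f n v + dFun F g n v := by
  have := (hf.hasMFDerivAt.add hg.hasMFDerivAt).mfderiv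
  change mfderiv 𝓘(ℝ, F) 𝓘(ℝ, ℝ) (f + g) n v = _
  rw [this]
  rfl

theorem dFun_mul {f g : N → ℝ} {n : N} (hf : MDifferentiableAt 𝓘(ℝ, F) 𝓘(ℝ, ℝ) f n)
    (hg : MDifferentiableAt 𝓘(ℝ, F) 𝓘(ℝ, ℝ) g n) (v : TangentSpace 𝓘(ℝ, F) n) :
    dFun F (fun n' => f n' * g n') n v = f n * dFun F g n v + g n * dFun F f n v := by
  have := (hf.hasMFDerivAt.mul hg.hasMFDerivAt).mfderiv
  change mfderiv 𝓘(ℝ, F) 𝓘(ℝ, ℝ) (f * g) n v = _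
  rw [this]
  rfl

theorem dFun_const (r : ℝ) (n : N) (v : TangentSpace 𝓘(ℝ, F) n) :
    dFun F (fun _ => r) n v = 0 := by
  rw [dFun, mfderiv_const]; rfl

theorem dFun_congr {f g : N → ℝ} {n : N} (h : f =ᶠ[𝓝 n] g) (v : TangentSpace 𝓘(ℝ, F) n) :
    dFun F f n v = dFun F g n v := by
  rw [dFun, h.mfderiv_eq]; rfl


theorem dFun_sum {ι : Type*} (s : Finset ι) {f : ι → N → ℝ} {n : N}
    (hf : ∀ i ∈ s, ContMDiffAt 𝓘(ℝ, F) 𝓘(ℝ, ℝ) ∞ (f i) n) (v : TangentSpace 𝓘(ℝ, F) n) :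
    dFun F (fun n' => ∑ i ∈ s, f i n') n v = ∑ i ∈ s, dFun F (f i) n v := by
  classical
  induction s using Finset.induction_on with
  | empty => simpa using dFun_const (0 : ℝ) n v
  | insert i s hi ih =>
    simp only [Finset.sum_insert hi]
    rw [dFun_add ((hf i (by simp)).mdifferentiableAt (by simp)), ih fun j hj => hf j (by simp [hj])]
    exact (contMDiffAt_finsetSum fun j hj => hf j (by simp [hj])).mdifferentiableAt (by simp)

/-- The coefficients up to degree `m` of a family of power series are smooth. -/
def SmoothUpTo (m : ℕ) (u : N → FPS d) (n : N) : Prop :=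
  ∀ α : Fin d →₀ ℕ, α.degree ≤ m →
    ContMDiffAt 𝓘(ℝ, F) 𝓘(ℝ, ℝ) ∞ (fun n' => MvPowerSeries.coeff α (u n')) n

variable {n : N} {u w : N → FPS d} {m : ℕ}

theorem SmoothUpTo.mono (h : SmoothUpTo (F := F) (m + 1) u n) : SmoothUpTo (F := F) m u n :=
  fun α hα => h α (hα.trans (Nat.le_succ m))

theorem SmoothUpTo.add (hu : SmoothUpTo (F := F) m u n) (hw : SmoothUpTo (F := F) m w n) :
    SmoothUpTo (F := F) m (fun n' => u n' + w n') n := fun α hα => by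
  simp only [map_add]
  exact (hu α hα).add (hw α hα)

theorem SmoothUpTo.sub (hu : SmoothUpTo (F := F) m u n) (hw : SmoothUpTo (F := F) m w n) :
    SmoothUpTo (F := F) m (fun n' => u n' - w n') n := fun α hα => by
  simpa only [map_sub] using (hu α hα).sub (hw α hα)

theorem SmoothUpTo.sum {ι : Type*} {s : Finset ι} {u : ι → N → FPS d}
    (hu : ∀ i ∈ s, SmoothUpTo (F := F) m (u i) n) :
    SmoothUpTo (F := F) m (fun n' => ∑ i ∈ s, u i n') n := fun α hα => by
  simpa only [map_sum] using contMDiffAt_finsetSum fun i hi => hu i hi α hα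

theorem SmoothUpTo.mul (hu : SmoothUpTo (F := F) m u n) (hw : SmoothUpTo (F := F) m w n) :
    SmoothUpTo (F := F) m (fun n' => u n' * w n') n := fun α hα => by
  classical
  simp only [MvPowerSeries.coeff_mul]
  refine contMDiffAt_finsetSum fun p hp => ?_
  have hd : p.1.degree + p.2.degree = α.degree := by
    rw [← map_add, Finset.HasAntidiagonal.mem_antidiagonal.1 hp]
  exact (hu _ (by omega)).mul (hw _ (by omega))

theorem SmoothUpTo.pderiv (hu : SmoothUpTo (F := F) (m + 1) u n) (k : Fin d) :
    SmoothUpTo (F := F) m (fun n' => MvPowerSeries.pderiv ℝ k (u n')) n := fun α hα => by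
  simp only [MvPowerSeries.coeff_pderiv]
  exact (hu _ (by simpa using hα)).mul contMDiffAt_const

theorem smoothUpTo_zero : SmoothUpTo (F := F) 0 u n ↔
    ContMDiffAt 𝓘(ℝ, F) 𝓘(ℝ, ℝ) ∞ (fun n' => MvPowerSeries.constantCoeff (u n')) n := by
  constructor
  · intro h
    simpa using h 0 (by simp)
  · intro h α hα
    have : α = 0 := by
      rw [← Finsupp.degree_eq_zero_iff]; omega
    subst this
    simpa using h

/-- The counterpart of `eqUpTo_succ` for parameter dependence: coefficients of positive degree are
constant multiples of coefficients of partial derivatives. -/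
theorem smoothUpTo_succ
    (h0 : ContMDiffAt 𝓘(ℝ, F) 𝓘(ℝ, ℝ) ∞ (fun n' => MvPowerSeries.constantCoeff (u n')) n)
    (h : ∀ k, SmoothUpTo (F := F) m (fun n' => MvPowerSeries.pderiv ℝ k (u n')) n) :
    SmoothUpTo (F := F) (m + 1) u n := fun α hα => by
  by_cases hz : α = 0
  · subst hz; simpa using h0
  obtain ⟨β, k, rfl, hd⟩ := exists_eq_add_single hz
  have := (h k β (by omega)).mul (contMDiffAt_const (c := ((β k : ℝ) + 1)⁻¹))
  refine this.congr_of_eventuallyEq (Eventually.of_forall fun n' => ?_)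
  change _ = MvPowerSeries.coeff β (MvPowerSeries.pderiv ℝ k (u n')) * ((β k : ℝ) + 1)⁻¹
  rw [MvPowerSeries.coeff_pderiv, mul_assoc, mul_inv_cancel₀ (by positivity), mul_one]

theorem seriesSmoothAt_iff :
    SeriesSmoothAt F u n ↔ ∀ m, SmoothUpTo (F := F) m u n :=
  ⟨fun h _ α _ => h α, fun h α => h _ α le_rfl⟩

theorem SeriesSmoothAt.upTo (h : SeriesSmoothAt F u n) (m : ℕ) : SmoothUpTo (F := F) m u n :=
  fun α _ => h α

theorem SeriesSmoothAt.congr (h : SeriesSmoothAt F u n) (e : w =ᶠ[𝓝 n] u) :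
    SeriesSmoothAt F w n := fun α =>
  (h α).congr_of_eventuallyEq (e.fun_comp (MvPowerSeries.coeff α))

theorem SeriesSmoothAt.constantCoeff (h : SeriesSmoothAt F u n) :
    ContMDiffAt 𝓘(ℝ, F) 𝓘(ℝ, ℝ) ∞ (fun n' => MvPowerSeries.constantCoeff (u n')) n := by
  simpa using h 0

theorem SeriesSmoothAt.add (hu : SeriesSmoothAt F u n) (hw : SeriesSmoothAt F w n) :
    SeriesSmoothAt F (fun n' => u n' + w n') n :=
  seriesSmoothAt_iff.2 fun m => (hu.upTo m).add (hw.upTo m)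

theorem SeriesSmoothAt.sub (hu : SeriesSmoothAt F u n) (hw : SeriesSmoothAt F w n) :
    SeriesSmoothAt F (fun n' => u n' - w n') n :=
  seriesSmoothAt_iff.2 fun m => (hu.upTo m).sub (hw.upTo m)

theorem SeriesSmoothAt.mul (hu : SeriesSmoothAt F u n) (hw : SeriesSmoothAt F w n) :
    SeriesSmoothAt F (fun n' => u n' * w n') n :=
  seriesSmoothAt_iff.2 fun m => (hu.upTo m).mul (hw.upTo m)

theorem SeriesSmoothAt.sum {ι : Type*} {s : Finset ι} {u : ι → N → FPS d}
    (hu : ∀ i ∈ s, SeriesSmoothAt F (u i) n) : SeriesSmoothAt F (fun n' => ∑ i ∈ s, u i n') n :=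
  seriesSmoothAt_iff.2 fun m => SmoothUpTo.sum fun i hi => (hu i hi).upTo m

theorem SeriesSmoothAt.smul {f : N → ℝ} (hf : ContMDiffAt 𝓘(ℝ, F) 𝓘(ℝ, ℝ) ∞ f n)
    (hu : SeriesSmoothAt F u n) : SeriesSmoothAt F (fun n' => f n' • u n') n := fun α => by
  simp only [map_smul, smul_eq_mul]
  exact hf.mul (hu α)

theorem SeriesSmoothAt.pderiv (hu : SeriesSmoothAt F u n) (k : Fin d) :
    SeriesSmoothAt F (fun n' => MvPowerSeries.pderiv ℝ k (u n')) n :=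
  seriesSmoothAt_iff.2 fun m => (hu.upTo (m + 1)).pderiv k

theorem seriesSmoothAt_const (f : FPS d) : SeriesSmoothAt F (fun _ : N => f) n :=
  fun _ => contMDiffAt_const

theorem SeriesSmoothAt.prod {ι : Type*} (s : Finset ι) {u : ι → N → FPS d}
    (hu : ∀ i, SeriesSmoothAt F (u i) n) : SeriesSmoothAt F (fun n' => ∏ i ∈ s, u i n') n := by
  classical
  induction s using Finset.induction_on with
  | empty => simpa using seriesSmoothAt_const 1
  | insert i s hi ih => simpa only [Finset.prod_insert hi] using (hu i).mul ih

theorem SeriesSmoothAt.comp {C : N → Fin d → FPS d}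
    (hC : ∀ j, SeriesSmoothAt F (fun n' => C n' j) n) (hu : SeriesSmoothAt F u n) :
    SeriesSmoothAt F (fun n' => FormalGeometry.comp (C n') (u n')) n := by
  refine seriesSmoothAt_iff.2 fun m => ?_
  induction m generalizing u with
  | zero => rw [smoothUpTo_zero]; simpa using hu.constantCoeff
  | succ m ih =>
    refine smoothUpTo_succ (by simpa using hu.constantCoeff) fun k => ?_
    simp only [pderiv_comp]
    exact SmoothUpTo.sum fun j _ => (ih (hu.pderiv j)).mul (((hC j).pderiv k).upTo m)

/-- Division by a family invertible at the point, done degree by degree, so that the coefficients of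
the inverse series need never be written down. -/
theorem SmoothUpTo.of_mul (hw : SeriesSmoothAt F w n)
    (h0 : MvPowerSeries.constantCoeff (w n) ≠ 0)
    (h : SmoothUpTo (F := F) m (fun n' => u n' * w n') n) : SmoothUpTo (F := F) m u n := by
  have hz {u : N → FPS d} (h : SmoothUpTo (F := F) 0 (fun n' => u n' * w n') n) :
      ContMDiffAt 𝓘(ℝ, F) 𝓘(ℝ, ℝ) ∞ (fun n' => MvPowerSeries.constantCoeff (u n')) n := by
    have h1 := (smoothUpTo_zero.1 h).div₀ hw.constantCoeff h0
    refine h1.congr_of_eventuallyEq ?_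
    filter_upwards [hw.constantCoeff.continuousAt.eventually_ne h0] with n' hn'
    simp [hn']
  induction m generalizing u with
  | zero => exact smoothUpTo_zero.2 (hz h)
  | succ m ih =>
    have h1 := ih h.mono
    refine smoothUpTo_succ (hz fun α hα => h α (by omega)) fun k => ih ?_
    -- By the Leibniz rule (∂ₖu) w = ∂ₖ(u w) - u ∂ₖw, where u is already smooth up to degree m; the
    -- induction hypothesis then divides by w once more.
    have h2 := (h.pderiv k).sub (h1.mul ((hw.pderiv k).upTo m))
    convert h2 using 2 with n'
    rw [Derivation.leibniz, smul_eq_mul, smul_eq_mul]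
    ring

theorem SeriesSmoothAt.det {ι : Type*} [Fintype ι] [DecidableEq ι]
    {A : N → Matrix ι ι (FPS d)} (hA : ∀ i j, SeriesSmoothAt F (fun n' => A n' i j) n) :
    SeriesSmoothAt F (fun n' => (A n').det) n := by
  simp only [Matrix.det_apply']
  exact SeriesSmoothAt.sum fun σ _ =>
    (seriesSmoothAt_const _).mul (SeriesSmoothAt.prod _ fun i => hA _ _)

theorem SeriesSmoothAt.adjugate {ι : Type*} [Fintype ι] [DecidableEq ι]
    {A : N → Matrix ι ι (FPS d)} (hA : ∀ i j, SeriesSmoothAt F (fun n' => A n' i j) n) (i j : ι) :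
    SeriesSmoothAt F (fun n' => (A n').adjugate i j) n := by
  simp only [Matrix.adjugate_apply]
  refine SeriesSmoothAt.det fun k l => ?_
  by_cases hk : k = j
  · subst hk
    simpa only [Matrix.updateRow_self] using seriesSmoothAt_const _
  · simpa only [Matrix.updateRow_ne hk] using hA k l

/-- Solutions of smooth families of linear equations are smooth. -/
theorem SeriesSmoothAt.of_mulVec {ι : Type*} [Fintype ι] [DecidableEq ι]
    {A : N → Matrix ι ι (FPS d)} (hA : ∀ i j, SeriesSmoothAt F (fun n' => A n' i j) n)
    (hdet : MvPowerSeries.constantCoeff (A n).det ≠ 0) {V : N → ι → FPS d}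
    (hV : ∀ i, SeriesSmoothAt F (fun n' => (A n').mulVec (V n') i) n) (i : ι) :
    SeriesSmoothAt F (fun n' => V n' i) n := by
  have h : SeriesSmoothAt F (fun n' => V n' i * (A n').det) n := by
    -- Cramer's rule: the adjugate applied to `A V` is `det A • V`, which leaves only a division by
    -- the determinant.
    have h1 : SeriesSmoothAt F (fun n' => ∑ j, (A n').adjugate i j * (A n').mulVec (V n') j) n :=
      SeriesSmoothAt.sum fun j _ => (SeriesSmoothAt.adjugate hA i j).mul (hV j)
    convert h1 using 2 with n'
    change _ = (A n').adjugate.mulVec ((A n').mulVec (V n')) i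
    rw [Matrix.mulVec_mulVec, Matrix.adjugate_mul, Matrix.smul_mulVec, Matrix.one_mulVec,
      Pi.smul_apply, smul_eq_mul, mul_comm]
  exact seriesSmoothAt_iff.2 fun m => SmoothUpTo.of_mul (SeriesSmoothAt.det hA) hdet (h.upTo m)

/-- The Jacobian matrix `∂Cʲ/∂yᵏ`. -/
def jacobianMatrix (C : Fin d → FPS d) : Matrix (Fin d) (Fin d) (FPS d) :=
  Matrix.of fun j k => MvPowerSeries.pderiv ℝ k (C j)

/-- The chain rule read as a linear system: it can be solved for the composed derivatives of `f`
when the Jacobian is invertible, which drives the next two inductions. -/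
theorem transpose_jacobianMatrix_mulVec (C : Fin d → FPS d) (f : FPS d) (i : Fin d) :
    (jacobianMatrix C).transpose.mulVec
      (fun j => FormalGeometry.comp C (MvPowerSeries.pderiv ℝ j f)) i =
      MvPowerSeries.pderiv ℝ i (FormalGeometry.comp C f) := by
  simp [pderiv_comp, jacobianMatrix, Matrix.mulVec, dotProduct, mul_comm]

/-- The partial derivatives of the composition are smooth, hence so are the composed partial
derivatives of `u`, by solving the linear system of the chain rule; induction on the degree removes
the composition. This yields smoothness of the inverse of the bundle isomorphism. -/
theorem SeriesSmoothAt.of_comp {C : N → Fin d → FPS d}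
    (hC : ∀ j, SeriesSmoothAt F (fun n' => C n' j) n)
    (hdet : MvPowerSeries.constantCoeff (jacobianMatrix (C n)).det ≠ 0)
    (hu : SeriesSmoothAt F (fun n' => FormalGeometry.comp (C n') (u n')) n) :
    SeriesSmoothAt F u n := by
  refine seriesSmoothAt_iff.2 fun m => ?_
  induction m generalizing u with
  | zero => rw [smoothUpTo_zero]; simpa using hu.constantCoeff
  | succ m ih =>
    refine smoothUpTo_succ (by simpa using hu.constantCoeff) fun k => ih ?_
    refine SeriesSmoothAt.of_mulVec (A := fun n' => (jacobianMatrix (C n')).transpose)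
      (V := fun n' j => FormalGeometry.comp (C n') (MvPowerSeries.pderiv ℝ j (u n')))
      (fun i j => (hC j).pderiv i) (by rwa [Matrix.det_transpose]) (fun i => ?_) k
    simpa only [transpose_jacobianMatrix_mulVec] using hu.pderiv i

/-- If the composition is zero, so are its derivatives, and the invertible transposed Jacobian
forces every composed derivative of `u` to vanish; induction on the degree then gives `u = 0`. -/
theorem comp_injective {C : Fin d → FPS d}
    (hdet : MvPowerSeries.constantCoeff (jacobianMatrix C).det ≠ 0) :
    Function.Injective (FormalGeometry.comp C) := by
  rw [injective_iff_map_eq_zero]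
  intro u hu
  refine eq_of_eqUpTo fun m => ?_
  have hunit : IsUnit (jacobianMatrix C).transpose := by
    rw [Matrix.isUnit_iff_isUnit_det, Matrix.det_transpose,
      MvPowerSeries.isUnit_iff_constantCoeff]
    exact isUnit_iff_ne_zero.2 hdet
  have hz {u : FPS d} (hu : FormalGeometry.comp C u = 0) :
      MvPowerSeries.constantCoeff u = MvPowerSeries.constantCoeff (0 : FPS d) := by
    rw [← constantCoeff_comp C u, hu]
  induction m generalizing u with
  | zero => exact eqUpTo_zero.2 (hz hu)
  | succ m ih =>
    refine eqUpTo_succ (hz hu) fun k => ?_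
    rw [map_zero]
    apply ih
    have h := Matrix.mulVec_injective_of_isUnit hunit
      (a₁ := fun j => FormalGeometry.comp C (MvPowerSeries.pderiv ℝ j u)) (a₂ := 0) (by
        rw [Matrix.mulVec_zero]
        funext i
        rw [transpose_jacobianMatrix_mulVec, hu, map_zero, Pi.zero_apply])
    exact congrFun h k

/-! ### Differentials of families of power series -/

variable (v : TangentSpace 𝓘(ℝ, F) n)

theorem coeff_dSeries (u : N → FPS d) (α : Fin d →₀ ℕ) :
    MvPowerSeries.coeff α (dSeries F u n v) =
      dFun F (fun n' => MvPowerSeries.coeff α (u n')) n v := rfl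

theorem constantCoeff_dSeries (u : N → FPS d) :
    MvPowerSeries.constantCoeff (dSeries F u n v) =
      dFun F (fun n' => MvPowerSeries.constantCoeff (u n')) n v := by
  simpa using coeff_dSeries v u 0

theorem dSeries_congr (h : u =ᶠ[𝓝 n] w) : dSeries F u n v = dSeries F w n v := by
  ext α
  exact dFun_congr (h.fun_comp (MvPowerSeries.coeff α)) v

theorem dSeries_add (hu : SeriesSmoothAt F u n) (hw : SeriesSmoothAt F w n) :
    dSeries F (fun n' => u n' + w n') n v = dSeries F u n v + dSeries F w n v := by
  ext α
  simp only [coeff_dSeries, map_add]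
  exact dFun_add ((hu α).mdifferentiableAt (by simp)) ((hw α).mdifferentiableAt (by simp)) v

theorem dSeries_sum {ι : Type*} (s : Finset ι) {u : ι → N → FPS d}
    (hu : ∀ i ∈ s, SeriesSmoothAt F (u i) n) :
    dSeries F (fun n' => ∑ i ∈ s, u i n') n v = ∑ i ∈ s, dSeries F (u i) n v := by
  ext α
  simp only [coeff_dSeries, map_sum]
  exact dFun_sum s (fun i hi => hu i hi α) v

theorem dSeries_mul (hu : SeriesSmoothAt F u n) (hw : SeriesSmoothAt F w n) :
    dSeries F (fun n' => u n' * w n') n v =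
      u n * dSeries F w n v + w n * dSeries F u n v := by
  classical
  ext α
  rw [mul_comm (w n)]
  simp only [coeff_dSeries, map_add, MvPowerSeries.coeff_mul]
  rw [dFun_sum (f := fun (p : (Fin d →₀ ℕ) × (Fin d →₀ ℕ)) n' =>
    MvPowerSeries.coeff p.1 (u n') * MvPowerSeries.coeff p.2 (w n'))
    _ fun p _ => (hu _).mul (hw _), ← Finset.sum_add_distrib]
  refine Finset.sum_congr rfl fun p _ => ?_
  rw [dFun_mul ((hu _).mdifferentiableAt (by simp)) ((hw _).mdifferentiableAt (by simp)),
    mul_comm (MvPowerSeries.coeff p.2 (w n))]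

theorem dSeries_smul {f : N → ℝ} (hf : ContMDiffAt 𝓘(ℝ, F) 𝓘(ℝ, ℝ) ∞ f n)
    (hu : SeriesSmoothAt F u n) :
    dSeries F (fun n' => f n' • u n') n v = f n • dSeries F u n v + dFun F f n v • u n := by
  ext α
  simp only [coeff_dSeries, map_add, map_smul, smul_eq_mul]
  rw [dFun_mul (hf.mdifferentiableAt (by simp)) ((hu _).mdifferentiableAt (by simp)),
    mul_comm (dFun F f n v)]

theorem dSeries_pderiv (hu : SeriesSmoothAt F u n) (k : Fin d) :
    dSeries F (fun n' => MvPowerSeries.pderiv ℝ k (u n')) n v =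
      MvPowerSeries.pderiv ℝ k (dSeries F u n v) := by
  ext α
  simp only [coeff_dSeries, MvPowerSeries.coeff_pderiv]
  rw [dFun_mul ((hu _).mdifferentiableAt (by simp)) mdifferentiableAt_const, dFun_const, mul_zero,
    zero_add, mul_comm]

/-- The differential of a composition of families of power series. -/
theorem dSeries_comp {C : N → Fin d → FPS d}
    (hC : ∀ j, SeriesSmoothAt F (fun n' => C n' j) n) (hu : SeriesSmoothAt F u n) :
    dSeries F (fun n' => FormalGeometry.comp (C n') (u n')) n v =
      FormalGeometry.comp (C n) (dSeries F u n v) +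
        ∑ j, FormalGeometry.comp (C n) (MvPowerSeries.pderiv ℝ j (u n)) *
          recenter (fun j => dSeries F (fun n' => C n' j) n v) j := by
  -- Composition preserves constant terms and the recentred factors have none, so only the constant
  -- term of du remains on either side.
  have hz {u : N → FPS d} : MvPowerSeries.constantCoeff
      (dSeries F (fun n' => FormalGeometry.comp (C n') (u n')) n v) =
      MvPowerSeries.constantCoeff (FormalGeometry.comp (C n) (dSeries F u n v) +
        ∑ j, FormalGeometry.comp (C n) (MvPowerSeries.pderiv ℝ j (u n)) *
          recenter (fun j => dSeries F (fun n' => C n' j) n v) j) := by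
    simp [constantCoeff_dSeries, constantCoeff_recenter]
  refine eq_of_eqUpTo fun m => ?_
  induction m generalizing u with
  | zero => exact eqUpTo_zero.2 hz
  | succ m ih =>
    refine eqUpTo_succ hz fun k => ?_
    have hcomp := fun j => SeriesSmoothAt.comp hC (hu.pderiv j)
    rw [← dSeries_pderiv v (SeriesSmoothAt.comp hC hu)]
    simp only [pderiv_comp]
    rw [dSeries_sum v _ fun j _ => (hcomp j).mul ((hC j).pderiv k)]
    simp only [dSeries_mul v (hcomp _) ((hC _).pderiv k), dSeries_pderiv v (hC _)]
    -- Differentiating the claimed formula and regrouping exhibits, for each index i, the same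
    -- formula for ∂ᵢu, to which the induction hypothesis applies.
    have key : MvPowerSeries.pderiv ℝ k (FormalGeometry.comp (C n) (dSeries F u n v) +
        ∑ j, FormalGeometry.comp (C n) (MvPowerSeries.pderiv ℝ j (u n)) *
          recenter (fun j => dSeries F (fun n' => C n' j) n v) j) =
        ∑ i, (FormalGeometry.comp (C n) (MvPowerSeries.pderiv ℝ i (u n)) *
            MvPowerSeries.pderiv ℝ k (dSeries F (fun n' => C n' i) n v) +
          MvPowerSeries.pderiv ℝ k (C n i) *
            (FormalGeometry.comp (C n) (dSeries F (fun n' => MvPowerSeries.pderiv ℝ i (u n')) n v) +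
              ∑ j, FormalGeometry.comp (C n)
                  (MvPowerSeries.pderiv ℝ j (MvPowerSeries.pderiv ℝ i (u n))) *
                recenter (fun j => dSeries F (fun n' => C n' j) n v) j)) := by
      simp only [map_add, map_sum, Derivation.leibniz, pderiv_comp, dSeries_pderiv v hu,
        pderiv_recenter, smul_eq_mul, Finset.sum_add_distrib, mul_add, Finset.mul_sum]
      rw [Finset.sum_comm (f := fun x i => MvPowerSeries.pderiv ℝ k (C n x) * _)]
      simp only [pderiv_comm (u n)]
      rw [add_left_comm]
      congr 1
      congr 1
      · exact Finset.sum_congr rfl fun j _ => mul_comm _ _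
      · exact Finset.sum_congr rfl fun j _ => Finset.sum_congr rfl fun i _ => by ring
    rw [key]
    exact EqUpTo.sum fun i _ => (EqUpTo.refl _ _).add ((EqUpTo.refl _ _).mul (ih (hu.pderiv i)))

/-- The covariant derivative of a family of Taylor expansions at points which move with
velocity `a`. -/
def jetDeriv (a : Fin d → ℝ) (f f' : FPS d) : FPS d :=
  f' - ∑ j, a j • MvPowerSeries.pderiv ℝ j f

theorem FormalVF.apply_comp (ξ : FormalVF d) (C : Fin d → FPS d) (f : FPS d) :
    ξ.apply (FormalGeometry.comp C f) =
      ∑ j, FormalGeometry.comp C (MvPowerSeries.pderiv ℝ j f) * ξ.apply (C j) := by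
  simp only [FormalVF.apply, pderiv_comp, Finset.mul_sum]
  rw [Finset.sum_comm]
  exact Finset.sum_congr rfl fun j _ => Finset.sum_congr rfl fun i _ => by ring

/-- The central cancellation. The action of ξ on the composition is minus the sum of the composed
∂ⱼu times dCⱼ, whereas `dSeries_comp` contains dCⱼ with its constant term removed. What is left over
is the sum of these constant terms times the composed ∂ⱼu. -/
theorem dSeries_comp_add_apply {C : N → Fin d → FPS d}
    (hC : ∀ j, SeriesSmoothAt F (fun n' => C n' j) n) (hu : SeriesSmoothAt F u n)
    (ξ : FormalVF d) (hξ : ∀ j, -ξ.apply (C n j) = dSeries F (fun n' => C n' j) n v) :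
    dSeries F (fun n' => FormalGeometry.comp (C n') (u n')) n v +
      ξ.apply (FormalGeometry.comp (C n) (u n)) =
    FormalGeometry.comp (C n) (jetDeriv
      (fun j => dFun F (fun n' => MvPowerSeries.constantCoeff (C n' j)) n v)
      (u n) (dSeries F u n v)) := by
  rw [dSeries_comp v hC hu, FormalVF.apply_comp, add_assoc, ← Finset.sum_add_distrib, jetDeriv,
    map_sub, map_sum, sub_eq_add_neg, ← Finset.sum_neg_distrib]
  congr 1
  refine Finset.sum_congr rfl fun j _ => ?_
  have h0 : MvPowerSeries.constantCoeff (ξ.apply (C n j)) =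
      -dFun F (fun n' => MvPowerSeries.constantCoeff (C n' j)) n v := by
    rw [← constantCoeff_dSeries, ← hξ, map_neg, neg_neg]
  rw [recenter, ← hξ, map_neg, map_neg, h0, map_smul, map_neg, MvPowerSeries.smul_eq_C_mul]
  ring

/-- The Maurer-Cartan form inverts the infinitesimal action, which is exactly the hypothesis on ξ in
`dSeries_comp_add_apply`. -/
theorem trivialConn_comp {M : Type*} [TopologicalSpace M] [ChartedSpace (Rd d) M]
    [IsManifold 𝓘(ℝ, Rd d) ∞ M] {c : N → Mcoor d M} (hc : CoorSmoothAt F c n)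
    (hu : SeriesSmoothAt F u n) :
    trivialConn F c
        (fun n' => FormalGeometry.comp ((c n').coord (chartAt (Rd d) (c n).base)) (u n')) n v =
      FormalGeometry.comp ((c n).coord (chartAt (Rd d) (c n).base)) (jetDeriv
        (fun j => dFun F (fun n' => MvPowerSeries.constantCoeff
          ((c n').coord (chartAt (Rd d) (c n).base) j)) n v) (u n) (dSeries F u n v)) := by
  have hC := hc.2 _ (IsManifold.chart_mem_maximalAtlas (c n).base) (mem_chart_source _ _)
  refine dSeries_comp_add_apply v hC hu _ fun j => ?_
  have h : (c n).infAction ((c n).omegaMC (velocity F c n v)) = velocity F c n v :=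
    (LinearEquiv.ofBijective _ (c n).infAction_bijective).apply_symm_apply _
  exact congrFun h j

end Families

/-! ### Local coordinates of jets -/

section TaylorFamilies

variable {d : ℕ} {F : Type*} [NormedAddCommGroup F] [NormedSpace ℝ F]
  {N : Type*} [TopologicalSpace N] [ChartedSpace F N] {n : N}

theorem SmoothNear.contDiffAt_taylorCoeff {g : Rd d → ℝ} {p : Rd d} (hg : SmoothNear g p)
    (α : Fin d →₀ ℕ) : ContDiffAt ℝ ∞ (fun x => taylorCoeff g x α) p := by
  have h : (fun x => taylorCoeff g x α) =ᶠ[𝓝 p] fun x =>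
      (∏ i, ((α i).factorial : ℝ))⁻¹ • FormalGeometry.listDeriv (indexList α) g x := by
    filter_upwards [hg.eventually] with x hx using hx.taylorCoeff_eq α
  refine ContDiffAt.congr_of_eventuallyEq ?_ h
  exact contDiffAt_const.mul (hg.listDeriv _).self_of_nhds

/-- Partial derivatives commute, so moving the base point acts on Taylor coefficients as
differentiating the function does. -/
theorem SmoothNear.partialDeriv_taylorCoeff {g : Rd d → ℝ} {p : Rd d} (hg : SmoothNear g p)
    (α : Fin d →₀ ℕ) (k : Fin d) :
    FormalGeometry.partialDeriv k (fun x => taylorCoeff g x α) p =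
      taylorCoeff (FormalGeometry.partialDeriv k g) p α := by
  have h : (fun x => taylorCoeff g x α) =ᶠ[𝓝 p] fun x =>
      (∏ i, ((α i).factorial : ℝ))⁻¹ • FormalGeometry.listDeriv (indexList α) g x := by
    filter_upwards [hg.eventually] with x hx using hx.taylorCoeff_eq α
  rw [(hg.partialDeriv k).taylorCoeff_eq, FormalGeometry.partialDeriv, h.fderiv_eq,
    fderiv_fun_const_smul (hg.listDeriv _).differentiableAt, ← listDeriv_append_singleton,
    hg.listDeriv_perm (List.perm_append_singleton k _)]
  rfl

theorem contMDiffAt_coord {a : N → Rd d} (ha : ContMDiffAt 𝓘(ℝ, F) 𝓘(ℝ, Rd d) ∞ a n)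
    (j : Fin d) : ContMDiffAt 𝓘(ℝ, F) 𝓘(ℝ, ℝ) ∞ (fun n' => a n' j) n :=
  ContMDiffAt.comp n (contDiff_coord j).contDiffAt.contMDiffAt ha

theorem seriesSmoothAt_taylor {a : N → Rd d} (ha : ContMDiffAt 𝓘(ℝ, F) 𝓘(ℝ, Rd d) ∞ a n)
    {g : Rd d → ℝ} (hg : SmoothNear g (a n)) :
    SeriesSmoothAt F (fun n' => taylor g (a n')) n := fun α =>
  ContMDiffAt.comp (g := fun x => taylorCoeff g x α) n
    (hg.contDiffAt_taylorCoeff α).contMDiffAt ha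

theorem dFun_comp {a : N → Rd d} (ha : ContMDiffAt 𝓘(ℝ, F) 𝓘(ℝ, Rd d) ∞ a n)
    {h : Rd d → ℝ} (hh : DifferentiableAt ℝ h (a n)) (v : TangentSpace 𝓘(ℝ, F) n) :
    dFun F (fun n' => h (a n')) n v =
      ∑ j, dFun F (fun n' => a n' j) n v * partialDeriv j h (a n) := by
  have ha' : MDifferentiableAt 𝓘(ℝ, F) 𝓘(ℝ, Rd d) a n := ha.mdifferentiableAt (by simp)
  have key : ∀ h : Rd d → ℝ, DifferentiableAt ℝ h (a n) → dFun F (fun n' => h (a n')) n v =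
      fderiv ℝ h (a n) (show Rd d from mfderiv 𝓘(ℝ, F) 𝓘(ℝ, Rd d) a n v) := by
    intro h hh
    have := mfderiv_comp n hh.mdifferentiableAt ha'
    rw [mfderiv_eq_fderiv] at this
    exact congrArg (fun L : F →L[ℝ] ℝ => L v) this
  rw [key h hh, fderiv_eq_sum_partialDeriv]
  refine Finset.sum_congr rfl fun j _ => ?_
  rw [key (fun y => y j) ((contDiff_coord j).differentiable (by simp) _), smul_eq_mul]
  congr 1
  exact (congrArg (fun L : Rd d →L[ℝ] ℝ => L _)
    (EuclideanSpace.proj (𝕜 := ℝ) j : Rd d →L[ℝ] ℝ).fderiv).symm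

/-- This says that `jetDeriv` vanishes on the Taylor expansions of a fixed function along a moving
point. It makes jets of functions horizontal and also supplies the hypothesis on transition maps in
`jetDeriv_comp`. -/
theorem dSeries_taylor {a : N → Rd d} (ha : ContMDiffAt 𝓘(ℝ, F) 𝓘(ℝ, Rd d) ∞ a n)
    {g : Rd d → ℝ} (hg : SmoothNear g (a n)) (v : TangentSpace 𝓘(ℝ, F) n) :
    dSeries F (fun n' => taylor g (a n')) n v =
      ∑ j, dFun F (fun n' => a n' j) n v • MvPowerSeries.pderiv ℝ j (taylor g (a n)) := by
  ext α
  simp only [coeff_dSeries, map_sum, map_smul, hg.pderiv_taylor, coeff_taylor, smul_eq_mul]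
  rw [dFun_comp ha ((hg.contDiffAt_taylorCoeff α).differentiableAt (by simp))]
  exact Finset.sum_congr rfl fun j _ => by rw [hg.partialDeriv_taylorCoeff]

/-- The covariant derivative of jets is independent of the coordinates. -/
theorem jetDeriv_comp {C : N → Fin d → FPS d} (v : TangentSpace 𝓘(ℝ, F) n)
    (hC : ∀ j, SeriesSmoothAt F (fun n' => C n' j) n) {u : N → FPS d}
    (hu : SeriesSmoothAt F u n) (a : Fin d → ℝ)
    (ha : ∀ j, dSeries F (fun n' => C n' j) n v = ∑ k, a k • MvPowerSeries.pderiv ℝ k (C n j)) :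
    jetDeriv a (comp (C n) (u n)) (dSeries F (fun n' => comp (C n') (u n')) n v) =
      comp (C n) (jetDeriv (fun j => dFun F (fun n' => MvPowerSeries.constantCoeff (C n' j)) n v)
        (u n) (dSeries F u n v)) := by
  -- The vector field with constant components -a plays the role of the Maurer-Cartan form: adding
  -- its action to the differential is precisely `jetDeriv a`, and `ha` is the compatibility with C.
  have hξ : ∀ f : FPS d, FormalVF.apply (fun k => -MvPowerSeries.C (a k)) f =
      -∑ k, a k • MvPowerSeries.pderiv ℝ k f := by
    intro f
    simp [FormalVF.apply, MvPowerSeries.smul_eq_C_mul]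
  rw [← dSeries_comp_add_apply v hC hu (fun k => -MvPowerSeries.C (a k))
    (fun j => by rw [hξ, ha, neg_neg]), hξ, jetDeriv, sub_eq_add_neg]

end TaylorFamilies

/-! ### Coordinates of jets in a chart and their change under transition maps. -/

section JetCoordinates

variable {d : ℕ} {M : Type*} [TopologicalSpace M] [ChartedSpace (Rd d) M] {x : M}
  {e e' : OpenPartialHomeomorph M (Rd d)}

theorem smoothNear_comp_symm (he : e ∈ IsManifold.maximalAtlas 𝓘(ℝ, Rd d) ∞ M)
    (hx : x ∈ e.source) {f : M → ℝ} (hf : f ∈ smoothNear d x) : SmoothNear (f ∘ e.symm) (e x) := by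
  have h1 : ∀ᶠ y in 𝓝 (e x), ContMDiffAt 𝓘(ℝ, Rd d) 𝓘(ℝ, ℝ) ∞ f (e.symm y) :=
    (e.symm.continuousAt (e.map_source hx)).eventually (by rw [e.left_inv hx]; exact hf)
  filter_upwards [h1, e.open_target.mem_nhds (e.map_source hx)] with y h2 hy
  have h3 : ContMDiffAt 𝓘(ℝ, Rd d) 𝓘(ℝ, Rd d) ∞ e.symm y :=
    (contMDiffOn_symm_of_mem_maximalAtlas he).contMDiffAt (e.open_target.mem_nhds hy)
  exact (h2.comp y h3).contDiffAt

theorem contMDiffAt_chart (he : e ∈ IsManifold.maximalAtlas 𝓘(ℝ, Rd d) ∞ M) (hx : x ∈ e.source) :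
    ContMDiffAt 𝓘(ℝ, Rd d) 𝓘(ℝ, Rd d) ∞ e x :=
  (contMDiffOn_of_mem_maximalAtlas he).contMDiffAt (e.open_source.mem_nhds hx)

theorem comp_chart_mem_smoothNear (he : e ∈ IsManifold.maximalAtlas 𝓘(ℝ, Rd d) ∞ M)
    (hx : x ∈ e.source) {g : Rd d → ℝ} (hg : SmoothNear g (e x)) : g ∘ e ∈ smoothNear d x := by
  have h1 := (e.continuousAt hx).eventually hg
  filter_upwards [h1, e.open_source.mem_nhds hx] with y h2 hy
  exact ContMDiffAt.comp y h2.contMDiffAt (contMDiffAt_chart he hy)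

/-- Transition maps are smooth. -/
theorem smoothNear_transition (he : e ∈ IsManifold.maximalAtlas 𝓘(ℝ, Rd d) ∞ M)
    (he' : e' ∈ IsManifold.maximalAtlas 𝓘(ℝ, Rd d) ∞ M) (hx : x ∈ e.source)
    (hx' : x ∈ e'.source) : SmoothNear (fun y => e (e'.symm y)) (e' x) := by
  have h1 : ∀ᶠ y in 𝓝 (e' x), e'.symm y ∈ e.source :=
    (e'.symm.continuousAt (e'.map_source hx')).eventually
      (by rw [e'.left_inv hx']; exact e.open_source.mem_nhds hx)
  filter_upwards [h1, e'.open_target.mem_nhds (e'.map_source hx')] with y h2 hy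
  have h3 : ContMDiffAt 𝓘(ℝ, Rd d) 𝓘(ℝ, Rd d) ∞ e'.symm y :=
    (contMDiffOn_symm_of_mem_maximalAtlas he').contMDiffAt (e'.open_target.mem_nhds hy)
  exact (ContMDiffAt.comp y (contMDiffAt_chart he h2) h3).contDiffAt

/-- The Taylor expansion at `x` of the transition map from `e'` to `e`. -/
def transition (e e' : OpenPartialHomeomorph M (Rd d)) (x : M) : Fin d → FPS d :=
  taylorMap (fun y => e (e'.symm y)) (e' x)

/-- Near `e' x` the function in the chart `e'` is the function in the chart `e` composed with the
transition map, so the Taylor expansion of a composition applies. -/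
theorem jetCoord_transition (he : e ∈ IsManifold.maximalAtlas 𝓘(ℝ, Rd d) ∞ M)
    (he' : e' ∈ IsManifold.maximalAtlas 𝓘(ℝ, Rd d) ∞ M) (hx : x ∈ e.source)
    (hx' : x ∈ e'.source) (q : Jet d x) :
    jetCoord e' q = comp (transition e e' x) (jetCoord e q) := by
  obtain ⟨f, rfl⟩ := Submodule.Quotient.mk_surjective _ q
  change jetCoord e' (jet d x f) = comp _ (jetCoord e (jet d x f))
  rw [jetCoord_jet he' hx', jetCoord_jet he hx]
  have hf := smoothNear_comp_symm he hx f.2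
  have h := SmoothNear.taylor_comp (f := (f : M → ℝ) ∘ e.symm) (g := fun y => e (e'.symm y))
    (p := e' x) (by rwa [e'.left_inv hx']) (smoothNear_transition he he' hx hx')
  rw [e'.left_inv hx'] at h
  rw [transition, ← h]
  refine taylor_congr ?_
  have h1 : ∀ᶠ y in 𝓝 (e' x), e'.symm y ∈ e.source :=
    (e'.symm.continuousAt (e'.map_source hx')).eventually
      (by rw [e'.left_inv hx']; exact e.open_source.mem_nhds hx)
  filter_upwards [h1] with y hy
  simp [e.left_inv hy]

theorem jetCoord_add (he : e ∈ IsManifold.maximalAtlas 𝓘(ℝ, Rd d) ∞ M) (hx : x ∈ e.source)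
    (q r : Jet d x) : jetCoord e (q + r) = jetCoord e q + jetCoord e r := by
  obtain ⟨f, rfl⟩ := Submodule.Quotient.mk_surjective _ q
  obtain ⟨g, rfl⟩ := Submodule.Quotient.mk_surjective _ r
  change jetCoord e (jet d x (f + g)) = jetCoord e (jet d x f) + jetCoord e (jet d x g)
  rw [jetCoord_jet he hx, jetCoord_jet he hx, jetCoord_jet he hx]
  exact (smoothNear_comp_symm he hx f.2).taylor_add (smoothNear_comp_symm he hx g.2)

theorem jetCoord_smul (he : e ∈ IsManifold.maximalAtlas 𝓘(ℝ, Rd d) ∞ M) (hx : x ∈ e.source)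
    (r : ℝ) (q : Jet d x) : jetCoord e (r • q) = r • jetCoord e q := by
  obtain ⟨f, rfl⟩ := Submodule.Quotient.mk_surjective _ q
  change jetCoord e (jet d x (r • f)) = r • jetCoord e (jet d x f)
  rw [jetCoord_jet he hx, jetCoord_jet he hx]
  exact (smoothNear_comp_symm he hx f.2).taylor_smul r

/-- Flatness of a representative is required in all charts; the transition formula spreads the
vanishing from `e` to every other chart, and Taylor coefficients determine all derivatives. -/
theorem jetCoord_injective (he : e ∈ IsManifold.maximalAtlas 𝓘(ℝ, Rd d) ∞ M)
    (hx : x ∈ e.source) {q : Jet d x} (hq : jetCoord e q = 0) : q = 0 := by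
  have hq' : ∀ e' ∈ IsManifold.maximalAtlas 𝓘(ℝ, Rd d) ∞ M, x ∈ e'.source →
      jetCoord e' q = 0 := fun e' he' hx' => by
    rw [jetCoord_transition he he' hx hx', hq, map_zero]
  obtain ⟨f, rfl⟩ := Submodule.Quotient.mk_surjective _ q
  rw [Submodule.Quotient.mk_eq_zero]
  intro e' he' hx' k
  have h := hq' e' he' hx'
  change jetCoord e' (jet d x f) = 0 at h
  rw [jetCoord_jet he' hx'] at h
  exact (smoothNear_comp_symm he' hx' f.2).iteratedFDeriv_eq_zero (fun α => congrFun h α) k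

theorem taylor_comp_sub (g : Rd d → ℝ) (p : Rd d) :
    taylor (fun y => g (y - p)) p = taylor g 0 := by
  funext α
  simp only [taylor, taylorCoeff]
  rw [iteratedFDeriv_comp_sub, sub_self]

/-- Borel's theorem provides a function with the prescribed expansion at 0; it is translated to `e
x` and pulled back by the chart. -/
theorem jetCoord_surjective (he : e ∈ IsManifold.maximalAtlas 𝓘(ℝ, Rd d) ∞ M)
    (hx : x ∈ e.source) (f : FPS d) : ∃ q : Jet d x, jetCoord e q = f := by
  obtain ⟨b, hb, hbf⟩ := exists_contDiff_taylor_eq f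
  have hs : ContDiff ℝ ∞ fun y => b (y - e x) := hb.comp (contDiff_id.sub contDiff_const)
  refine ⟨jet d x ⟨_, comp_chart_mem_smoothNear he hx (hs.smoothNear _)⟩, ?_⟩
  rw [jetCoord_jet he hx, ← hbf, ← taylor_comp_sub b (e x)]
  refine taylor_congr ?_
  filter_upwards [e.open_target.mem_nhds (e.map_source hx)] with y hy
  simp [e.right_inv hy]

/-- The coordinates of jets at a point, as a linear equivalence. -/
def jetEquiv (he : e ∈ IsManifold.maximalAtlas 𝓘(ℝ, Rd d) ∞ M) (hx : x ∈ e.source) :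
    Jet d x ≃ₗ[ℝ] FPS d :=
  LinearEquiv.ofBijective
    { toFun := jetCoord e
      map_add' := jetCoord_add he hx
      map_smul' := jetCoord_smul he hx }
    ⟨(injective_iff_map_eq_zero _).2 fun _ => jetCoord_injective he hx,
      jetCoord_surjective he hx⟩

theorem jetEquiv_apply (he : e ∈ IsManifold.maximalAtlas 𝓘(ℝ, Rd d) ∞ M) (hx : x ∈ e.source)
    (q : Jet d x) : jetEquiv he hx q = jetCoord e q := rfl

theorem jetCoord_jetEquiv_symm (he : e ∈ IsManifold.maximalAtlas 𝓘(ℝ, Rd d) ∞ M)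
    (hx : x ∈ e.source) (f : FPS d) : jetCoord e ((jetEquiv he hx).symm f) = f :=
  (jetEquiv he hx).apply_symm_apply f

theorem jetCoord_inj (he : e ∈ IsManifold.maximalAtlas 𝓘(ℝ, Rd d) ∞ M) (hx : x ∈ e.source)
    {q r : Jet d x} (h : jetCoord e q = jetCoord e r) : q = r :=
  (jetEquiv he hx).injective h

theorem jet_congr {f g : smoothNear d x} (h : (f : M → ℝ) =ᶠ[𝓝 x] g) : jet d x f = jet d x g := by
  refine (Submodule.Quotient.eq _).2 fun e he hx k => ?_
  have h1 : ((f - g : smoothNear d x) : M → ℝ) ∘ e.symm =ᶠ[𝓝 (e x)] fun _ => (0 : ℝ) := by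
    have : ∀ᶠ y in 𝓝 (e x), (f : M → ℝ) (e.symm y) = (g : M → ℝ) (e.symm y) :=
      (e.symm.continuousAt (e.map_source hx)).eventually (by rw [e.left_inv hx]; exact h)
    filter_upwards [this] with y hy
    simp [hy]
  rw [(h1.iteratedFDeriv ℝ k).self_of_nhds]
  simp

/-! ### Families of jets over a parameter manifold. -/

section Families

variable {F : Type*} [NormedAddCommGroup F] [NormedSpace ℝ F]
  {N : Type*} [TopologicalSpace N] [ChartedSpace F N] {n : N}

theorem contMDiffAt_chart_comp (he : e ∈ IsManifold.maximalAtlas 𝓘(ℝ, Rd d) ∞ M) {b : N → M}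
    (hb : ContMDiffAt 𝓘(ℝ, F) 𝓘(ℝ, Rd d) ∞ b n) (hn : b n ∈ e.source) :
    ContMDiffAt 𝓘(ℝ, F) 𝓘(ℝ, Rd d) ∞ (fun n' => e (b n')) n :=
  ContMDiffAt.comp n (contMDiffAt_chart he hn) hb

theorem seriesSmoothAt_transition (he : e ∈ IsManifold.maximalAtlas 𝓘(ℝ, Rd d) ∞ M)
    (he' : e' ∈ IsManifold.maximalAtlas 𝓘(ℝ, Rd d) ∞ M) {b : N → M}
    (hb : ContMDiffAt 𝓘(ℝ, F) 𝓘(ℝ, Rd d) ∞ b n) (hn : b n ∈ e.source) (hn' : b n ∈ e'.source)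
    (j : Fin d) : SeriesSmoothAt F (fun n' => transition e e' (b n') j) n :=
  seriesSmoothAt_taylor (contMDiffAt_chart_comp he' hb hn')
    ((smoothNear_transition he he' hn hn').coord j)

theorem eventually_jetCoord_transition (he : e ∈ IsManifold.maximalAtlas 𝓘(ℝ, Rd d) ∞ M)
    (he' : e' ∈ IsManifold.maximalAtlas 𝓘(ℝ, Rd d) ∞ M) {p : N → Σ x : M, Jet d x}
    (hb : ContMDiffAt 𝓘(ℝ, F) 𝓘(ℝ, Rd d) ∞ (fun n' => (p n').1) n) (hn : (p n).1 ∈ e.source)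
    (hn' : (p n).1 ∈ e'.source) : (fun n' => jetCoord e' (p n').2) =ᶠ[𝓝 n]
      fun n' => comp (transition e e' (p n').1) (jetCoord e (p n').2) := by
  filter_upwards [hb.continuousAt.eventually (e.open_source.mem_nhds hn),
    hb.continuousAt.eventually (e'.open_source.mem_nhds hn')] with n' h1 h2
  exact jetCoord_transition he he' h1 h2 _

/-- Smoothness of maps to the jet bundle can be checked in one chart. -/
theorem jetSmoothAt_of_chart (he : e ∈ IsManifold.maximalAtlas 𝓘(ℝ, Rd d) ∞ M)
    {p : N → Σ x : M, Jet d x}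
    (hb : ContMDiffAt 𝓘(ℝ, F) 𝓘(ℝ, Rd d) ∞ (fun n' => (p n').1) n) (hn : (p n).1 ∈ e.source)
    (h : SeriesSmoothAt F (fun n' => jetCoord e (p n').2) n) : JetSmoothAt F p n :=
  ⟨hb, fun _ he' hn' => (SeriesSmoothAt.comp (seriesSmoothAt_transition he he' hb hn hn') h).congr
    (eventually_jetCoord_transition he he' hb hn hn')⟩

end Families

end JetCoordinates

/-! ### The canonical connection of the jet bundle -/

section Horizontal

variable {d : ℕ}

/-- A horizontal family of power series consists of the Taylor expansions of a function. -/
theorem taylor_eq_of_horizontal {G : Rd d → FPS d} {U : Set (Rd d)} (hU : IsOpen U) {p : Rd d}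
    (hp : p ∈ U) (hG : ∀ y ∈ U, ∀ α, ContDiffAt ℝ ∞ (fun y => MvPowerSeries.coeff α (G y)) y)
    (hh : ∀ y ∈ U, ∀ α k, partialDeriv k (fun y => MvPowerSeries.coeff α (G y)) y =
      MvPowerSeries.coeff α (MvPowerSeries.pderiv ℝ k (G y))) :
    taylor (fun y => MvPowerSeries.constantCoeff (G y)) p = G p := by
  refine eq_of_eqUpTo fun m => ?_
  induction m generalizing G with
  | zero => exact eqUpTo_zero.2 (by simp)
  | succ m ih =>
    -- Horizontality at the zero multi-index identifies the derivative of the constant term with the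
    -- constant term of ∂ₖG, and ∂ₖG is again a horizontal family, so the induction hypothesis
    -- applies to it.
    refine eqUpTo_succ (by simp) fun k => ?_
    have h0 : SmoothNear (fun y => MvPowerSeries.constantCoeff (G y)) p := by
      filter_upwards [hU.mem_nhds hp] with y hy
      simpa using hG y hy 0
    have h1 : partialDeriv k (fun y => MvPowerSeries.constantCoeff (G y)) =ᶠ[𝓝 p]
        fun y => MvPowerSeries.constantCoeff (MvPowerSeries.pderiv ℝ k (G y)) := by
      filter_upwards [hU.mem_nhds hp] with y hy
      simpa using hh y hy 0 k
    rw [h0.pderiv_taylor, taylor_congr h1]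
    refine ih (G := fun y => MvPowerSeries.pderiv ℝ k (G y)) (fun y hy α => ?_)
      fun y hy α j => ?_
    · simp only [MvPowerSeries.coeff_pderiv]
      exact (hG y hy _).mul contDiffAt_const
    · rw [pderiv_comm, MvPowerSeries.coeff_pderiv, ← hh y hy]
      simp only [MvPowerSeries.coeff_pderiv, partialDeriv]
      rw [fderiv_mul_const ((hG y hy _).differentiableAt (by simp))]
      simp [mul_comm]

end Horizontal

section CanonicalConnection

variable {d : ℕ} {M : Type*} [TopologicalSpace M] [ChartedSpace (Rd d) M]
  {e : OpenPartialHomeomorph M (Rd d)} {s t : ∀ x : M, Jet d x} {x : M}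

theorem JetSection.seriesSmoothAt (hs : JetSection s)
    (he : e ∈ IsManifold.maximalAtlas 𝓘(ℝ, Rd d) ∞ M) (hx : x ∈ e.source) :
    SeriesSmoothAt (Rd d) (fun x' => jetCoord e (s x')) x := (hs x).2 e he hx

theorem jetSection_of_chart
    (h : ∀ x, ∃ e ∈ IsManifold.maximalAtlas 𝓘(ℝ, Rd d) ∞ M, x ∈ e.source ∧
      SeriesSmoothAt (Rd d) (fun x' => jetCoord e (s x')) x) : JetSection s := fun x => by
  obtain ⟨e, he, hx, hs⟩ := h x
  exact jetSmoothAt_of_chart (p := fun x => ⟨x, s x⟩) he contMDiffAt_id hx hs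

/-- The covariant derivative of a section of the jet bundle in a chart. -/
def covDeriv (e : OpenPartialHomeomorph M (Rd d)) (s : ∀ x : M, Jet d x) (x : M)
    (v : TangentSpace 𝓘(ℝ, Rd d) x) : FPS d :=
  jetDeriv (fun j => dFun (Rd d) (fun x' => e x' j) x v) (jetCoord e (s x))
    (dSeries (Rd d) (fun x' => jetCoord e (s x')) x v)

/-- This is `jetDeriv_comp` for the family of Taylor expansions of the transition map. Their
constant terms are the coordinates `e x'`, so the velocity on the right is the one measured in `e`.
-/
theorem covDeriv_transition {e' : OpenPartialHomeomorph M (Rd d)}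
    (he : e ∈ IsManifold.maximalAtlas 𝓘(ℝ, Rd d) ∞ M)
    (he' : e' ∈ IsManifold.maximalAtlas 𝓘(ℝ, Rd d) ∞ M) (hx : x ∈ e.source) (hx' : x ∈ e'.source)
    (hs : SeriesSmoothAt (Rd d) (fun x' => jetCoord e (s x')) x)
    (v : TangentSpace 𝓘(ℝ, Rd d) x) :
    covDeriv e' s x v = comp (transition e e' x) (covDeriv e s x v) := by
  have hb : ContMDiffAt 𝓘(ℝ, Rd d) 𝓘(ℝ, Rd d) ∞ (fun x' : M => x') x := contMDiffAt_id
  have h1 := eventually_jetCoord_transition he he' (p := fun x => ⟨x, s x⟩) hb hx hx'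
  have h2 : ∀ j, (fun x' => MvPowerSeries.constantCoeff (transition e e' x' j)) =ᶠ[𝓝 x]
      fun x' => e x' j := by
    intro j
    filter_upwards [e'.open_source.mem_nhds hx'] with x' h'
    simp [transition, taylorMap, e'.left_inv h']
  rw [covDeriv, dSeries_congr v h1, jetCoord_transition he he' hx hx', jetDeriv_comp
    (C := fun x' => transition e e' x') v (seriesSmoothAt_transition he he' hb hx hx') hs]
  · simp only [dFun_congr (h2 _)]
    rfl
  · intro j
    exact dSeries_taylor (contMDiffAt_chart he' hx')
      ((smoothNear_transition he he' hx hx').coord j) v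

theorem dFun_add_vec (f : M → ℝ) (v w : TangentSpace 𝓘(ℝ, Rd d) x) :
    dFun (Rd d) f x (v + w) = dFun (Rd d) f x v + dFun (Rd d) f x w := map_add _ v w

theorem dFun_smul_vec (f : M → ℝ) (r : ℝ) (v : TangentSpace 𝓘(ℝ, Rd d) x) :
    dFun (Rd d) f x (r • v) = r * dFun (Rd d) f x v := map_smul _ r v

theorem covDeriv_add_vec (e : OpenPartialHomeomorph M (Rd d)) (s : ∀ x : M, Jet d x)
    (v w : TangentSpace 𝓘(ℝ, Rd d) x) :
    covDeriv e s x (v + w) = covDeriv e s x v + covDeriv e s x w := by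
  have h : dSeries (Rd d) (fun x' => jetCoord e (s x')) x (v + w) =
      dSeries (Rd d) (fun x' => jetCoord e (s x')) x v +
        dSeries (Rd d) (fun x' => jetCoord e (s x')) x w := by
    ext α
    exact dFun_add_vec _ v w
  simp only [covDeriv, jetDeriv, h, dFun_add_vec, add_smul, Finset.sum_add_distrib]
  abel

theorem covDeriv_smul_vec (e : OpenPartialHomeomorph M (Rd d)) (s : ∀ x : M, Jet d x) (r : ℝ)
    (v : TangentSpace 𝓘(ℝ, Rd d) x) : covDeriv e s x (r • v) = r • covDeriv e s x v := by
  have h : dSeries (Rd d) (fun x' => jetCoord e (s x')) x (r • v) =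
      r • dSeries (Rd d) (fun x' => jetCoord e (s x')) x v := by
    ext α
    exact dFun_smul_vec _ r v
  simp only [covDeriv, jetDeriv, h, dFun_smul_vec, mul_smul, smul_sub, Finset.smul_sum]

theorem seriesSmoothAt_jetCoord_function (he : e ∈ IsManifold.maximalAtlas 𝓘(ℝ, Rd d) ∞ M)
    (hx : x ∈ e.source) {f : M → ℝ} (hf : f ∈ smoothNear d x)
    (hs : ∀ᶠ x' in 𝓝 x, jetCoord e (s x') = taylor (f ∘ e.symm) (e x')) :
    SeriesSmoothAt (Rd d) (fun x' => jetCoord e (s x')) x :=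
  (seriesSmoothAt_taylor (contMDiffAt_chart he hx) (smoothNear_comp_symm he hx hf)).congr hs

theorem covDeriv_function (he : e ∈ IsManifold.maximalAtlas 𝓘(ℝ, Rd d) ∞ M)
    (hx : x ∈ e.source) {f : M → ℝ} (hf : f ∈ smoothNear d x)
    (hs : ∀ᶠ x' in 𝓝 x, jetCoord e (s x') = taylor (f ∘ e.symm) (e x'))
    (v : TangentSpace 𝓘(ℝ, Rd d) x) : covDeriv e s x v = 0 := by
  rw [covDeriv, dSeries_congr v hs, hs.self_of_nhds,
    dSeries_taylor (contMDiffAt_chart he hx) (smoothNear_comp_symm he hx hf) v, jetDeriv, sub_self]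

theorem jetCoord_jetSection (he : e ∈ IsManifold.maximalAtlas 𝓘(ℝ, Rd d) ∞ M)
    (hx : x ∈ e.source) {f : M → ℝ} (hf : ContMDiff 𝓘(ℝ, Rd d) 𝓘(ℝ, ℝ) ∞ f) :
    ∀ᶠ x' in 𝓝 x, jetCoord e (jetSection d f hf x') = taylor (f ∘ e.symm) (e x') := by
  filter_upwards [e.open_source.mem_nhds hx] with x' hx'
  exact jetCoord_jet he hx' _

theorem dFun_chart_symm (he : e ∈ IsManifold.maximalAtlas 𝓘(ℝ, Rd d) ∞ M) {y : Rd d}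
    (hy : y ∈ e.target) {f : M → ℝ}
    (hf : MDifferentiableAt 𝓘(ℝ, Rd d) 𝓘(ℝ, ℝ) f (e.symm y)) (w : Rd d) :
    dFun (Rd d) f (e.symm y) (mfderiv 𝓘(ℝ, Rd d) 𝓘(ℝ, Rd d) e.symm y w) =
      fderiv ℝ (f ∘ e.symm) y w := by
  have h3 : MDifferentiableAt 𝓘(ℝ, Rd d) 𝓘(ℝ, Rd d) e.symm y :=
    ((contMDiffOn_symm_of_mem_maximalAtlas he).contMDiffAt
      (e.open_target.mem_nhds hy)).mdifferentiableAt (by simp)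
  have := mfderiv_comp y hf h3
  rw [mfderiv_eq_fderiv] at this
  exact (congrArg (fun L : Rd d →L[ℝ] ℝ => L w) this).symm

theorem constantCoeff_jetCoord {e' : OpenPartialHomeomorph M (Rd d)}
    (he : e ∈ IsManifold.maximalAtlas 𝓘(ℝ, Rd d) ∞ M)
    (he' : e' ∈ IsManifold.maximalAtlas 𝓘(ℝ, Rd d) ∞ M) (hx : x ∈ e.source) (hx' : x ∈ e'.source)
    (q : Jet d x) : MvPowerSeries.constantCoeff (jetCoord e' q) =
      MvPowerSeries.constantCoeff (jetCoord e q) := by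
  rw [jetCoord_transition he he' hx hx', constantCoeff_comp]

/-- Horizontal sections are, locally, the jets of their values. -/
theorem jetCoord_eq_taylor_of_horizontal (he : e ∈ IsManifold.maximalAtlas 𝓘(ℝ, Rd d) ∞ M)
    (hs : ∀ x ∈ e.source, SeriesSmoothAt (Rd d) (fun x' => jetCoord e (s x')) x)
    (h0 : ∀ x ∈ e.source, ∀ v, covDeriv e s x v = 0) (hx : x ∈ e.source) :
    taylor (fun y => MvPowerSeries.constantCoeff (jetCoord e (s (e.symm y)))) (e x) =
      jetCoord e (s x) := by
  have h := taylor_eq_of_horizontal (G := fun y => jetCoord e (s (e.symm y))) e.open_target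
    (e.map_source hx) (fun y hy α => ?_) fun y hy α k => ?_
  · rw [h, e.left_inv hx]
  · have h1 := hs _ (e.map_target hy) α
    have h2 := (contMDiffOn_symm_of_mem_maximalAtlas he).contMDiffAt (e.open_target.mem_nhds hy)
    exact (ContMDiffAt.comp y h1 h2).contDiffAt
  · set v := mfderiv 𝓘(ℝ, Rd d) 𝓘(ℝ, Rd d) e.symm y (EuclideanSpace.single k 1 : Rd d)
    have h1 := h0 _ (e.map_target hy) v
    rw [covDeriv, jetDeriv, sub_eq_zero] at h1
    have h2 := congrArg (MvPowerSeries.coeff α) h1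
    rw [coeff_dSeries, dFun_chart_symm he hy
      ((hs _ (e.map_target hy) α).mdifferentiableAt (by simp))] at h2
    change fderiv ℝ _ y _ = _
    refine h2.trans ?_
    -- `v` is the k-th coordinate vector, so in the chart its velocity is the k-th basis vector and
    -- only the term ∂ₖ survives in the covariant derivative.
    have h3 : ∀ j, dFun (Rd d) (fun x' => e x' j) (e.symm y) v = if j = k then 1 else 0 := by
      intro j
      rw [dFun_chart_symm he hy ((contMDiffAt_coord (contMDiffAt_chart he
        (e.map_target hy)) j).mdifferentiableAt (by simp))]
      have h4 : (fun x' => e x' j) ∘ e.symm =ᶠ[𝓝 y]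
          (EuclideanSpace.proj (𝕜 := ℝ) j : Rd d →L[ℝ] ℝ) := by
        filter_upwards [e.open_target.mem_nhds hy] with z hz
        simp [e.right_inv hz]
      rw [h4.fderiv_eq, ContinuousLinearMap.fderiv]
      simp
    simp [h3]

variable [IsManifold 𝓘(ℝ, Rd d) ∞ M]

/-- The canonical connection of the jet bundle. -/
def canonConn (s : ∀ x : M, Jet d x) (x : M) (v : TangentSpace 𝓘(ℝ, Rd d) x) : Jet d x :=
  (jetEquiv (IsManifold.chart_mem_maximalAtlas x) (mem_chart_source (Rd d) x)).symm
    (covDeriv (chartAt (Rd d) x) s x v)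

theorem jetCoord_canonConn (he : e ∈ IsManifold.maximalAtlas 𝓘(ℝ, Rd d) ∞ M)
    (hx : x ∈ e.source) (hs : SeriesSmoothAt (Rd d) (fun x' => jetCoord e (s x')) x)
    (v : TangentSpace 𝓘(ℝ, Rd d) x) : jetCoord e (canonConn s x v) = covDeriv e s x v := by
  have he0 := IsManifold.chart_mem_maximalAtlas (I := 𝓘(ℝ, Rd d)) (n := ∞) x
  have hx0 := mem_chart_source (Rd d) x
  have hs' := jetSmoothAt_of_chart (p := fun x => ⟨x, s x⟩) he contMDiffAt_id hx hs
  rw [jetCoord_transition he0 he hx0 hx, canonConn, jetCoord_jetEquiv_symm,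
    covDeriv_transition he0 he hx0 hx (hs'.2 _ he0 hx0)]

/-- The derivative of a smooth function along a smooth vector field is smooth. -/
theorem contMDiffAt_dFun {f : M → ℝ} (hf : f ∈ smoothNear d x)
    {X : ∀ x : M, TangentSpace 𝓘(ℝ, Rd d) x} (hX : SmoothVF X) :
    ContMDiffAt 𝓘(ℝ, Rd d) 𝓘(ℝ, ℝ) ∞ (fun x' => dFun (Rd d) f x' (X x')) x := by
  -- Only smoothness of `f` near `x` is available, so its tangent map is taken within an open set
  -- `U`; there it coincides with the full derivative.
  obtain ⟨U, hfU, hU, hxU⟩ := eventually_nhds_iff.1 hf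
  have hf' : ContMDiffOn 𝓘(ℝ, Rd d) 𝓘(ℝ, ℝ) ∞ f U := fun y hy => (hfU y hy).contMDiffWithinAt
  have h1 := hf'.contMDiffOn_tangentMapWithin (m := ∞) (by simp) hU.uniqueMDiffOn
  have h2 : ContMDiffAt 𝓘(ℝ, Rd d) 𝓘(ℝ, ℝ).tangent ∞
      (fun x' => tangentMapWithin 𝓘(ℝ, Rd d) 𝓘(ℝ, ℝ) f U ⟨x', X x'⟩) x :=
    (h1.comp (hX.contMDiffOn (s := U)) fun y hy => hy).contMDiffAt (hU.mem_nhds hxU)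
  have h3 := (contMDiff_snd_tangentBundle_modelSpace ℝ 𝓘(ℝ, ℝ)).contMDiffAt.comp x h2
  refine h3.congr_of_eventuallyEq ?_
  filter_upwards [hU.mem_nhds hxU] with y hy
  change _ = mfderivWithin 𝓘(ℝ, Rd d) 𝓘(ℝ, ℝ) f U y (X y)
  rw [mfderivWithin_of_mem_nhds (hU.mem_nhds hy)]
  rfl

theorem jetSection_jetSection (f : M → ℝ) (hf : ContMDiff 𝓘(ℝ, Rd d) 𝓘(ℝ, ℝ) ∞ f) :
    JetSection (jetSection d f hf) := jetSection_of_chart fun x =>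
  have he := IsManifold.chart_mem_maximalAtlas (I := 𝓘(ℝ, Rd d)) (n := ∞) x
  have hx := mem_chart_source (Rd d) x
  ⟨_, he, hx, seriesSmoothAt_jetCoord_function he hx (Eventually.of_forall fun x' => hf x')
    (jetCoord_jetSection he hx hf)⟩

theorem JetSection.add (hs : JetSection s) (ht : JetSection t) :
    JetSection fun x => s x + t x := jetSection_of_chart fun x => by
  have he := IsManifold.chart_mem_maximalAtlas (I := 𝓘(ℝ, Rd d)) (n := ∞) x
  have hx := mem_chart_source (Rd d) x
  refine ⟨_, he, hx, ((hs.seriesSmoothAt he hx).add (ht.seriesSmoothAt he hx)).congr ?_⟩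
  filter_upwards [(chartAt (Rd d) x).open_source.mem_nhds hx] with x' hx'
  exact jetCoord_add he hx' _ _

theorem JetSection.smul {g : M → ℝ} (hg : ContMDiff 𝓘(ℝ, Rd d) 𝓘(ℝ, ℝ) ∞ g)
    (hs : JetSection s) : JetSection fun x => g x • s x := jetSection_of_chart fun x => by
  have he := IsManifold.chart_mem_maximalAtlas (I := 𝓘(ℝ, Rd d)) (n := ∞) x
  have hx := mem_chart_source (Rd d) x
  refine ⟨_, he, hx, (SeriesSmoothAt.smul (hg x) (hs.seriesSmoothAt he hx)).congr ?_⟩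
  filter_upwards [(chartAt (Rd d) x).open_source.mem_nhds hx] with x' hx'
  exact jetCoord_smul he hx' _ _

theorem isConnection_canonConn : IsConnection JetSection (canonConn (M := M) (d := d)) where
  linear s _ x :=
    { map_add := fun v w => by rw [canonConn, covDeriv_add_vec, map_add]; rfl
      map_smul := fun r v => by rw [canonConn, covDeriv_smul_vec, map_smul]; rfl }
  smooth s hs X hX := jetSection_of_chart fun x => by
    have he := IsManifold.chart_mem_maximalAtlas (I := 𝓘(ℝ, Rd d)) (n := ∞) x
    have hx := mem_chart_source (Rd d) x
    have ho := (chartAt (Rd d) x).open_source.mem_nhds hx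
    have hd : SeriesSmoothAt (Rd d)
        (fun x' => dSeries (Rd d) (fun x' => jetCoord (chartAt (Rd d) x) (s x')) x' (X x')) x := by
      intro α
      refine contMDiffAt_dFun (f := fun x' =>
        MvPowerSeries.coeff α (jetCoord (chartAt (Rd d) x) (s x'))) ?_ hX
      filter_upwards [ho] with x' hx' using hs.seriesSmoothAt he hx' α
    have ha : ∀ j, ContMDiffAt 𝓘(ℝ, Rd d) 𝓘(ℝ, ℝ) ∞
        (fun x' => dFun (Rd d) (fun z => chartAt (Rd d) x z j) x' (X x')) x := by
      intro j
      refine contMDiffAt_dFun (f := fun z => chartAt (Rd d) x z j) ?_ hX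
      filter_upwards [ho] with x' hx' using contMDiffAt_coord (contMDiffAt_chart he hx') j
    refine ⟨_, he, hx, (hd.sub (SeriesSmoothAt.sum (s := Finset.univ) fun j _ =>
      SeriesSmoothAt.smul (ha j) ((hs.seriesSmoothAt he hx).pderiv j))).congr ?_⟩
    filter_upwards [ho] with x' hx'
    exact jetCoord_canonConn he hx' (hs.seriesSmoothAt he hx') _
  add s t hs ht x v := by
    have he := IsManifold.chart_mem_maximalAtlas (I := 𝓘(ℝ, Rd d)) (n := ∞) x
    have hx := mem_chart_source (Rd d) x
    have ho := (chartAt (Rd d) x).open_source.mem_nhds hx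
    have h : (fun x' => jetCoord (chartAt (Rd d) x) (s x' + t x')) =ᶠ[𝓝 x] fun x' =>
        jetCoord (chartAt (Rd d) x) (s x') + jetCoord (chartAt (Rd d) x) (t x') := by
      filter_upwards [ho] with x' hx' using jetCoord_add he hx' _ _
    rw [canonConn, canonConn, canonConn, ← map_add]
    congr 1
    rw [covDeriv, dSeries_congr v h,
      dSeries_add v (hs.seriesSmoothAt he hx) (ht.seriesSmoothAt he hx), jetCoord_add he hx]
    simp only [covDeriv, jetDeriv, map_add, smul_add, Finset.sum_add_distrib]
    abel
  leibniz g s hg hs x v := by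
    have he := IsManifold.chart_mem_maximalAtlas (I := 𝓘(ℝ, Rd d)) (n := ∞) x
    have hx := mem_chart_source (Rd d) x
    have ho := (chartAt (Rd d) x).open_source.mem_nhds hx
    have h : (fun x' => jetCoord (chartAt (Rd d) x) (g x' • s x')) =ᶠ[𝓝 x] fun x' =>
        g x' • jetCoord (chartAt (Rd d) x) (s x') := by
      filter_upwards [ho] with x' hx' using jetCoord_smul he hx' _ _
    change _ = dFun (Rd d) g x v • s x + _
    refine jetCoord_inj he hx ?_
    rw [jetCoord_add he hx, jetCoord_smul he hx, jetCoord_smul he hx, canonConn, canonConn,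
      jetCoord_jetEquiv_symm, jetCoord_jetEquiv_symm, covDeriv, dSeries_congr v h,
      dSeries_smul v (hg x) (hs.seriesSmoothAt he hx), jetCoord_smul he hx]
    simp only [covDeriv, jetDeriv, Derivation.map_smul, smul_sub, Finset.smul_sum,
      smul_comm (g x)]
    abel

theorem isCanonicalConnection_canonConn :
    IsCanonicalConnection (canonConn (M := M) (d := d)) where
  isConnection := isConnection_canonConn
  horizontal_iff s hs := by
    constructor
    · intro h
      -- The constant term, being the value of the jet, is the only candidate for the function. Its
      -- independence of the chart makes it smooth, although the defining chart varies with the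
      -- point.
      set f : M → ℝ := fun x => MvPowerSeries.constantCoeff (jetCoord (chartAt (Rd d) x) (s x))
        with hfdef
      have hfe : ∀ x, ∀ x' ∈ (chartAt (Rd d) x).source,
          f x' = MvPowerSeries.constantCoeff (jetCoord (chartAt (Rd d) x) (s x')) := fun x x' hx' =>
        constantCoeff_jetCoord (IsManifold.chart_mem_maximalAtlas x)
          (IsManifold.chart_mem_maximalAtlas x') hx' (mem_chart_source _ _) _
      have hf : ContMDiff 𝓘(ℝ, Rd d) 𝓘(ℝ, ℝ) ∞ f := fun x => by
        have he := IsManifold.chart_mem_maximalAtlas (I := 𝓘(ℝ, Rd d)) (n := ∞) x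
        have hx := mem_chart_source (Rd d) x
        refine (hs.seriesSmoothAt he hx).constantCoeff.congr_of_eventuallyEq ?_
        filter_upwards [(chartAt (Rd d) x).open_source.mem_nhds hx] with x' hx' using hfe x x' hx'
      refine ⟨f, hf, funext fun x => ?_⟩
      have he := IsManifold.chart_mem_maximalAtlas (I := 𝓘(ℝ, Rd d)) (n := ∞) x
      have hx := mem_chart_source (Rd d) x
      refine jetCoord_inj he hx ?_
      rw [(jetCoord_jetSection he hx hf).self_of_nhds,
        ← jetCoord_eq_taylor_of_horizontal he (fun x' hx' => hs.seriesSmoothAt he hx')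
          (fun x' hx' v => ?_) hx]
      · refine taylor_congr ?_
        filter_upwards [(chartAt (Rd d) x).open_target.mem_nhds (mem_chart_target _ x)] with y hy
        exact (hfe x _ ((chartAt (Rd d) x).map_target hy)).symm
      · rw [← jetCoord_canonConn he hx' (hs.seriesSmoothAt he hx'), h]
        exact (jetEquiv he hx').map_zero
    · rintro ⟨f, hf, rfl⟩ x v
      have he := IsManifold.chart_mem_maximalAtlas (I := 𝓘(ℝ, Rd d)) (n := ∞) x
      have hx := mem_chart_source (Rd d) x
      rw [canonConn, covDeriv_function he hx (Eventually.of_forall fun x' => hf x')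
        (jetCoord_jetSection he hx hf), map_zero]

end CanonicalConnection

/-! ### Hadamard's lemma -/

section Hadamard

open MeasureTheory in
/-- Integrals over `[0, 1]` of functions depending smoothly on parameters are smooth. -/
theorem contDiff_integral_unitInterval {E : Type*} [NormedAddCommGroup E] [NormedSpace ℝ E]
    {f : E × ℝ → ℝ} (hf : ContDiff ℝ ∞ f) :
    ContDiff ℝ ∞ fun p => ∫ t in Set.Ioc (0 : ℝ) 1, f (p, t) := by
  -- The integral is the convolution at 0 of the indicator of (0, 1] with `g p`. The bump gives `g
  -- p` compact support without changing it on [-1, 1], the only part seen by the integral.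
  let χ : ContDiffBump (0 : ℝ) := ⟨1, 2, one_pos, one_lt_two⟩
  let g : E → ℝ → ℝ := fun p t => χ t * f (p, -t)
  have hg : ContDiff ℝ ∞ (Function.uncurry g) :=
    (χ.contDiff.comp contDiff_snd).mul (hf.comp (contDiff_fst.prodMk contDiff_snd.neg))
  have hloc : LocallyIntegrable (Set.indicator (Set.Ioc (0 : ℝ) 1) fun _ => (1 : ℝ)) :=
    ((integrable_indicator_iff measurableSet_Ioc).2
      (integrableOn_const (by simp))).locallyIntegrable
  have h := contDiffOn_convolution_right_with_param_comp (n := ⊤) (μ := volume)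
    (ContinuousLinearMap.mul ℝ ℝ) (s := Set.univ) (v := fun _ : E => (0 : ℝ))
    contDiffOn_const (g := g) isOpen_univ χ.hasCompactSupport.isCompact
    (fun p t _ ht => by
      change χ t * _ = 0
      rw [image_eq_zero_of_notMem_tsupport ht, zero_mul]) hloc hg.contDiffOn
  rw [contDiffOn_univ] at h
  convert h using 2 with p
  rw [convolution_def, ← integral_indicator measurableSet_Ioc]
  congr 1
  funext t
  by_cases ht : t ∈ Set.Ioc (0 : ℝ) 1
  · have h1 : χ (-t) = 1 := χ.one_of_mem_closedBall (by
      rw [mem_closedBall_zero_iff, Real.norm_eq_abs, abs_le]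
      constructor <;> simp [χ] <;> linarith [ht.1, ht.2])
    simp [ht, g, h1]
  · simp [ht]

/-- The fundamental theorem of calculus along the segment from p to y; the factors are the integrals
of the partial derivatives over that segment. -/
theorem exists_hadamard {d : ℕ} {h : Rd d → ℝ} (hh : ContDiff ℝ ∞ h) (p : Rd d) :
    ∃ k : Fin d → Rd d → ℝ, (∀ i, ContDiff ℝ ∞ (k i)) ∧
      ∀ y, h y = h p + ∑ i, (y i - p i) * k i y := by
  have hk : ∀ i, ContDiff ℝ ∞ (partialDeriv i h) := fun i =>
    (hh.fderiv_right (m := ∞) (by simp)).clm_apply contDiff_const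
  have hc : ∀ i, ContDiff ℝ ∞ fun q : Rd d × ℝ => partialDeriv i h (p + q.2 • (q.1 - p)) :=
    fun i => (hk i).comp (contDiff_const.add (contDiff_snd.smul (contDiff_fst.sub contDiff_const)))
  refine ⟨fun i y => ∫ t in Set.Ioc (0 : ℝ) 1, partialDeriv i h (p + t • (y - p)),
    fun i => contDiff_integral_unitInterval (hc i), fun y => ?_⟩
  have hci : ∀ i, Continuous fun t : ℝ => partialDeriv i h (p + t • (y - p)) := fun i =>
    (hc i).continuous.comp (Continuous.prodMk_right y)
  have hder : ∀ t ∈ Set.uIcc (0 : ℝ) 1, HasDerivAt (fun t : ℝ => h (p + t • (y - p)))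
      (∑ i, (y i - p i) * partialDeriv i h (p + t • (y - p))) t := by
    intro t _
    have h1 : HasDerivAt (fun t : ℝ => p + t • (y - p)) (y - p) t := by
      simpa using ((hasDerivAt_id t).smul_const (y - p)).const_add p
    have h2 := (hh.differentiable (by simp) (p + t • (y - p))).hasFDerivAt.comp_hasDerivAt t h1
    rw [fderiv_eq_sum_partialDeriv] at h2
    exact h2
  have hint := intervalIntegral.integral_eq_sub_of_hasDerivAt hder
    (Continuous.intervalIntegrable (continuous_finsetSum _ fun i _ =>
      continuous_const.mul (hci i)) _ _)
  rw [intervalIntegral.integral_finsetSum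
    (f := fun i t => (y i - p i) * partialDeriv i h (p + t • (y - p))) fun i _ =>
    (continuous_const.mul (hci i)).intervalIntegrable _ _] at hint
  simp only [intervalIntegral.integral_const_mul] at hint
  simp only [intervalIntegral.integral_of_le zero_le_one, one_smul, zero_smul, add_zero,
    add_sub_cancel] at hint
  rw [hint]
  ring

end Hadamard

/-! ### The Lie bracket of vector fields as a commutator of derivations. -/

section Bracket

variable {d : ℕ} {M : Type*} [TopologicalSpace M] [ChartedSpace (Rd d) M]
  [IsManifold 𝓘(ℝ, Rd d) ∞ M] {x : M}

omit [IsManifold 𝓘(ℝ, Rd d) ∞ M] in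
theorem dFun_eq_fderiv (f : M → ℝ) (hf : MDifferentiableAt 𝓘(ℝ, Rd d) 𝓘(ℝ, ℝ) f x)
    (v : TangentSpace 𝓘(ℝ, Rd d) x) :
    dFun (Rd d) f x v = fderiv ℝ (f ∘ (chartAt (Rd d) x).symm) (chartAt (Rd d) x x) v := by
  have := hf.mfderiv
  simp only [writtenInExtChartAt, mfld_simps, fderivWithin_univ] at this
  rw [dFun, this]
  rfl

/-- The action of a Lie bracket of vector fields on functions. -/
theorem dFun_mlieBracket {g : M → ℝ} (hg : g ∈ smoothNear d x)
    {X Y : ∀ x : M, TangentSpace 𝓘(ℝ, Rd d) x} (hX : SmoothVF X) (hY : SmoothVF Y) :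
    dFun (Rd d) g x (VectorField.mlieBracket 𝓘(ℝ, Rd d) X Y x) =
      dFun (Rd d) (fun x' => dFun (Rd d) g x' (Y x')) x (X x) -
        dFun (Rd d) (fun x' => dFun (Rd d) g x' (X x')) x (Y x) := by
  have : IsManifold 𝓘(ℝ, Rd d) 2 M := IsManifold.of_le (n := ∞)
    (WithTop.coe_le_coe.2 (le_top : (2 : ℕ∞) ≤ ⊤))
  set e := chartAt (Rd d) x with he'
  have he : e ∈ IsManifold.maximalAtlas 𝓘(ℝ, Rd d) ∞ M := IsManifold.chart_mem_maximalAtlas x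
  have hx : x ∈ e.source := mem_chart_source _ x
  -- The coordinate expression of a vector field in the preferred chart at `x`. At `e x` it equals
  -- the vector itself, since tangent vectors at `x` are identified with vectors by this very chart.
  let P : (∀ x : M, TangentSpace 𝓘(ℝ, Rd d) x) → Rd d → Rd d := fun Z =>
    VectorField.mpullback 𝓘(ℝ, Rd d) 𝓘(ℝ, Rd d) e.symm Z
  have hP : ∀ Z, SmoothVF Z → DifferentiableAt ℝ (P Z) (e x) := by
    intro Z hZ
    have := MDifferentiableWithinAt.differentiableWithinAt_mpullbackWithin_vectorField (s := Set.univ)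
      ((hZ x).mdifferentiableAt (by simp)).mdifferentiableWithinAt
    rw [← differentiableWithinAt_univ]
    simpa using this
  have hPd : ∀ Z : ∀ x : M, TangentSpace 𝓘(ℝ, Rd d) x, ∀ y ∈ e.target,
      mfderiv 𝓘(ℝ, Rd d) 𝓘(ℝ, Rd d) e.symm y (P Z y) = Z (e.symm y) := by
    intro Z y hy
    have h := isInvertible_mfderivWithin_extChartAt_symm (I := 𝓘(ℝ, Rd d)) (x := x) (y := y)
      (by simpa using hy)
    simp only [mfld_simps, mfderivWithin_univ] at h
    have h' : (show Rd d →L[ℝ] Rd d from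
        mfderiv 𝓘(ℝ, Rd d) 𝓘(ℝ, Rd d) e.symm y).IsInvertible := h
    exact h'.self_apply_inverse (show Rd d from Z (e.symm y))
  have hPx : ∀ Z : ∀ x : M, TangentSpace 𝓘(ℝ, Rd d) x, P Z (e x) = Z x := by
    intro Z
    have h := mfderivWithin_extChartAt_symm_inverse_apply (I := 𝓘(ℝ, Rd d)) (x := x)
    simp only [mfld_simps, mfderivWithin_univ] at h
    have h2 : ∀ z, z = x → (show Rd d from Z z) = Z x := by rintro _ rfl; rfl
    exact (h _).trans (h2 _ (e.left_inv hx))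
  have hbr : VectorField.mlieBracket 𝓘(ℝ, Rd d) X Y x =
      fderiv ℝ (P Y) (e x) (P X (e x)) - fderiv ℝ (P X) (e x) (P Y (e x)) := by
    have hid : (show Rd d →L[ℝ] Rd d from mfderiv 𝓘(ℝ, Rd d) 𝓘(ℝ, Rd d)
        (extChartAt 𝓘(ℝ, Rd d) x) x) = ContinuousLinearMap.id ℝ (Rd d) := mfderiv_extChartAt_self
    refine (VectorField.mlieBracketWithin_apply (I := 𝓘(ℝ, Rd d)) (V := X) (W := Y)
      (s := Set.univ) (x₀ := x)).trans ?_
    change (show Rd d →L[ℝ] Rd d from mfderiv 𝓘(ℝ, Rd d) 𝓘(ℝ, Rd d)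
        (extChartAt 𝓘(ℝ, Rd d) x) x).inverse (VectorField.lieBracketWithin ℝ _ _ _ _) = _
    rw [hid, ContinuousLinearMap.inverse_id]
    simp only [mfld_simps, Set.preimage_univ, Set.univ_inter, VectorField.mpullbackWithin_univ]
    exact congrFun (VectorField.lieBracketWithin_univ (𝕜 := ℝ) (V := P X) (W := P Y)) (e x)
  have hgs : SmoothNear (g ∘ e.symm) (e x) := smoothNear_comp_symm he hx hg
  have hgd : ∀ᶠ x' in 𝓝 x, MDifferentiableAt 𝓘(ℝ, Rd d) 𝓘(ℝ, ℝ) g x' := by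
    filter_upwards [hg] with x' hx' using hx'.mdifferentiableAt (by simp)
  -- The product rule splits the iterated derivative into a second derivative of `g` and a
  -- derivative of the coefficients of Z. By symmetry the former cancels in the commutator, and the
  -- latter gives the bracket.
  have hcomp : ∀ Z W : ∀ x : M, TangentSpace 𝓘(ℝ, Rd d) x, SmoothVF Z →
      dFun (Rd d) (fun x' => dFun (Rd d) g x' (Z x')) x (W x) =
        fderiv ℝ (fderiv ℝ (g ∘ e.symm)) (e x) (P W (e x)) (P Z (e x)) +
          fderiv ℝ (g ∘ e.symm) (e x) (fderiv ℝ (P Z) (e x) (P W (e x))) := by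
    intro Z W hZ
    have h1 : (fun x' => dFun (Rd d) g x' (Z x')) ∘ e.symm =ᶠ[𝓝 (e x)]
        fun y => fderiv ℝ (g ∘ e.symm) y (P Z y) := by
      have h2 : ∀ᶠ y in 𝓝 (e x), MDifferentiableAt 𝓘(ℝ, Rd d) 𝓘(ℝ, ℝ) g (e.symm y) :=
        (e.symm.continuousAt (e.map_source hx)).eventually (by rw [e.left_inv hx]; exact hgd)
      filter_upwards [h2, e.open_target.mem_nhds (e.map_source hx)] with y h3 hy
      rw [← dFun_chart_symm he hy h3, hPd Z y hy]
      rfl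
    have hd : DifferentiableAt ℝ (fderiv ℝ (g ∘ e.symm)) (e x) :=
      (hgs.self_of_nhds.fderiv_right (m := ∞) (by simp)).differentiableAt (by simp)
    rw [dFun_eq_fderiv _ ((contMDiffAt_dFun hg hZ).mdifferentiableAt (by simp)), h1.fderiv_eq,
      fderiv_clm_apply hd (hP Z hZ), hPx W]
    exact add_comm _ _
  rw [hcomp Y X hY, hcomp X Y hX, dFun_eq_fderiv _ hgd.self_of_nhds, hbr, map_sub]
  have hsymm : IsSymmSndFDerivAt ℝ (g ∘ e.symm) (e x) :=
    hgs.self_of_nhds.isSymmSndFDerivAt (by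
      simp only [minSmoothness_of_isRCLikeNormedField]
      exact WithTop.coe_le_coe.2 (le_top : (2 : ℕ∞) ≤ ⊤))
  rw [hsymm.eq (P X (e x)) (P Y (e x))]
  abel

end Bracket
end
end FormalGeometry

namespace FormalGeometry

noncomputable section

/-! ### Tensorial maps on sections of the jet bundle -/

section Tensorial

variable {d : ℕ} {M : Type*} [TopologicalSpace M] [ChartedSpace (Rd d) M]
  [IsManifold 𝓘(ℝ, Rd d) ∞ M] [T2Space M] {x : M}

/-- Multiplication by a bump function supported where `f` is smooth; the Hausdorff property makes
the extension by zero smooth. Hence every jet comes from a global function. -/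
theorem exists_contMDiff_eventuallyEq {f : M → ℝ} (hf : f ∈ smoothNear d x) :
    ∃ G : M → ℝ, ContMDiff 𝓘(ℝ, Rd d) 𝓘(ℝ, ℝ) ∞ G ∧ G =ᶠ[𝓝 x] f := by
  obtain ⟨χ, hχ⟩ := (SmoothBumpFunction.nhds_basis_support (I := 𝓘(ℝ, Rd d)) hf).ex_mem
  refine ⟨fun y => χ y * f y, contMDiff_of_tsupport fun y hy => ?_, ?_⟩
  · have : y ∈ tsupport χ := tsupport_mul_subset_left hy
    exact χ.contMDiffAt.mul (hχ this)
  · filter_upwards [χ.eventuallyEq_one] with y hy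
    rw [hy, Pi.one_apply, one_mul]

theorem exists_jetSection_eq (q : Jet d x) :
    ∃ (f : M → ℝ) (hf : ContMDiff 𝓘(ℝ, Rd d) 𝓘(ℝ, ℝ) ∞ f), jetSection d f hf x = q := by
  obtain ⟨f, rfl⟩ := Submodule.Quotient.mk_surjective _ q
  obtain ⟨G, hG, hGf⟩ := exists_contMDiff_eventuallyEq f.2
  exact ⟨G, hG, jet_congr hGf⟩

open Classical in
/-- The section with given coordinates in the preferred chart at `x`, cut off by a bump function. -/
def cutoffSection (χ : SmoothBumpFunction 𝓘(ℝ, Rd d) x) (G : Rd d → FPS d) (x' : M) : Jet d x' :=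
  if h : x' ∈ (chartAt (Rd d) x).source then
    χ x' • (jetEquiv (IsManifold.chart_mem_maximalAtlas x) h).symm (G (chartAt (Rd d) x x'))
  else 0

omit [T2Space M] in
theorem jetCoord_cutoffSection (χ : SmoothBumpFunction 𝓘(ℝ, Rd d) x) (G : Rd d → FPS d) {x' : M}
    (h : x' ∈ (chartAt (Rd d) x).source) :
    jetCoord (chartAt (Rd d) x) (cutoffSection χ G x') = χ x' • G (chartAt (Rd d) x x') := by
  rw [cutoffSection, dif_pos h, jetCoord_smul (IsManifold.chart_mem_maximalAtlas x) h,
    jetCoord_jetEquiv_symm]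

omit [IsManifold 𝓘(ℝ, Rd d) ∞ M] [T2Space M] in
theorem jetCoord_zero {e : OpenPartialHomeomorph M (Rd d)}
    (he : e ∈ IsManifold.maximalAtlas 𝓘(ℝ, Rd d) ∞ M) (hx : x ∈ e.source) :
    jetCoord e (0 : Jet d x) = 0 := (jetEquiv he hx).map_zero

omit [T2Space M] in
theorem cutoffSection_eq_zero (χ : SmoothBumpFunction 𝓘(ℝ, Rd d) x) (G : Rd d → FPS d) {x' : M}
    (h : χ x' = 0) : cutoffSection χ G x' = 0 := by
  rw [cutoffSection]
  split_ifs
  · rw [h, zero_smul]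
  · rfl

theorem jetSection_cutoffSection (χ : SmoothBumpFunction 𝓘(ℝ, Rd d) x) {G : Rd d → FPS d}
    (hG : ∀ α, ContDiff ℝ ∞ fun y => MvPowerSeries.coeff α (G y)) :
    JetSection (cutoffSection χ G) := jetSection_of_chart fun x' => by
  by_cases h : x' ∈ tsupport χ
  · have hx' := χ.tsupport_subset_chartAt_source h
    have he := IsManifold.chart_mem_maximalAtlas (I := 𝓘(ℝ, Rd d)) (n := ∞) x
    refine ⟨_, he, hx', SeriesSmoothAt.congr (u := fun z => χ z • G (chartAt (Rd d) x z))
      (SeriesSmoothAt.smul χ.contMDiffAt fun α => ?_) ?_⟩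
    · exact ContMDiffAt.comp (g := fun y => MvPowerSeries.coeff α (G y)) x' (hG α).contDiffAt.contMDiffAt (contMDiffAt_chart he hx')
    · filter_upwards [(chartAt (Rd d) x).open_source.mem_nhds hx'] with z hz
      exact jetCoord_cutoffSection χ G hz
  · have he := IsManifold.chart_mem_maximalAtlas (I := 𝓘(ℝ, Rd d)) (n := ∞) x'
    have hx' := mem_chart_source (Rd d) x'
    refine ⟨_, he, hx', (seriesSmoothAt_const 0).congr ?_⟩
    filter_upwards [(isClosed_tsupport χ).isOpen_compl.mem_nhds h,
      (chartAt (Rd d) x').open_source.mem_nhds hx'] with z hz hz'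
    rw [cutoffSection_eq_zero χ G (image_eq_zero_of_notMem_tsupport hz), jetCoord_zero he hz']

omit [T2Space M] in
theorem jetSection_zero : JetSection fun x : M => (0 : Jet d x) := jetSection_of_chart fun x => by
  have he := IsManifold.chart_mem_maximalAtlas (I := 𝓘(ℝ, Rd d)) (n := ∞) x
  have hx := mem_chart_source (Rd d) x
  refine ⟨_, he, hx, (seriesSmoothAt_const 0).congr ?_⟩
  filter_upwards [(chartAt (Rd d) x).open_source.mem_nhds hx] with z hz
  exact jetCoord_zero he hz

omit [T2Space M] in
theorem JetSection.sum {ι : Type*} (S : Finset ι) {s : ι → ∀ x : M, Jet d x}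
    (hs : ∀ i, JetSection (s i)) : JetSection fun x => ∑ i ∈ S, s i x := by
  classical
  induction S using Finset.induction_on with
  | empty => simpa using jetSection_zero
  | insert i S hi ih => simpa only [Finset.sum_insert hi] using (hs i).add ih

/-- A smooth section of the jet bundle that vanishes at `x` is, after multiplication by a function
which is `1` at `x`, a combination of smooth sections with coefficients vanishing at `x`. -/
theorem exists_eq_sum_of_eq_zero {s : ∀ x : M, Jet d x} (hs : JetSection s) (h0 : s x = 0) :
    ∃ (χ : M → ℝ) (g : Fin d → M → ℝ) (t : Fin d → ∀ x : M, Jet d x),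
      ContMDiff 𝓘(ℝ, Rd d) 𝓘(ℝ, ℝ) ∞ χ ∧ χ x = 1 ∧
      (∀ i, ContMDiff 𝓘(ℝ, Rd d) 𝓘(ℝ, ℝ) ∞ (g i) ∧ g i x = 0 ∧ JetSection (t i)) ∧
      ∀ x', χ x' • s x' = ∑ i, g i x' • t i x' := by
  set e := chartAt (Rd d) x with hedef
  have he : e ∈ IsManifold.maximalAtlas 𝓘(ℝ, Rd d) ∞ M := IsManifold.chart_mem_maximalAtlas x
  have hx : x ∈ e.source := mem_chart_source _ x
  obtain ⟨χ, -⟩ := (SmoothBumpFunction.nhds_basis_support (I := 𝓘(ℝ, Rd d)) (c := x) (s := Set.univ) Filter.univ_mem).ex_mem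
  -- The same bump seen on ℝ^d: Hadamard's lemma needs functions defined and smooth on the whole
  -- space, so the coefficients of `s` are multiplied by ψ and extended by zero.
  let ψ : Rd d → ℝ := χ.toContDiffBump
  have hψ : ContDiff ℝ ∞ ψ := χ.toContDiffBump.contDiff
  have hψχ : ∀ x' ∈ e.source, ψ (e x') = χ x' := fun x' hx' => by
    rw [χ.coe_def, Set.indicator_of_mem hx']
    rfl
  have hχ0 : ∀ x' ∉ e.source, χ x' = 0 := fun x' hx' => by
    rw [χ.coe_def, Set.indicator_of_notMem hx']
  have hball : tsupport ψ ⊆ e.target := by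
    have := χ.closedBall_subset
    simp only [mfld_simps, Set.inter_univ] at this
    exact (χ.toContDiffBump.tsupport_eq.subset).trans (by simpa using this)
  let H : (Fin d →₀ ℕ) → Rd d → ℝ :=
    fun α y => ψ y * MvPowerSeries.coeff α (jetCoord e (s (e.symm y)))
  have hH : ∀ α, ContDiff ℝ ∞ (H α) := by
    intro α
    rw [contDiff_iff_contDiffAt]
    intro y
    by_cases hy : y ∈ tsupport ψ
    · have hy' := hball hy
      have h1 := hs.seriesSmoothAt he (e.map_target hy') α
      have h2 := (contMDiffOn_symm_of_mem_maximalAtlas he).contMDiffAt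
        (e.open_target.mem_nhds hy')
      exact hψ.contDiffAt.mul (ContMDiffAt.comp y h1 h2).contDiffAt
    · refine (contDiffAt_const (c := (0 : ℝ))).congr_of_eventuallyEq ?_
      filter_upwards [(isClosed_tsupport ψ).isOpen_compl.mem_nhds hy] with z hz
      change ψ z * _ = 0
      rw [image_eq_zero_of_notMem_tsupport hz, zero_mul]
  have hH0 : ∀ α, H α (e x) = 0 := by
    intro α
    have : jetCoord e (s (e.symm (e x))) = 0 := by
      rw [e.left_inv hx, h0, jetCoord_zero he hx]
    change ψ _ * _ = 0
    rw [this, map_zero, mul_zero]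
  -- The Hadamard factors are chosen separately for each coefficient. No uniformity in α is needed,
  -- because smoothness of a family of series is coefficientwise.
  choose K hK hKH using fun α => exists_hadamard (hH α) (e x)
  let g : Fin d → M → ℝ := fun i x' => χ x' • (e x' i - e x i)
  have hg : ∀ i, ContMDiff 𝓘(ℝ, Rd d) 𝓘(ℝ, ℝ) ∞ (g i) := fun i =>
    χ.contMDiff_smul fun x' hx' =>
      ((contMDiffAt_coord (contMDiffAt_chart he hx') i).sub contMDiffAt_const).contMDiffWithinAt
  -- One factor χ comes from `H`, one makes `g i` global, and one makes the sections built from `K`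
  -- global, whence the cube.
  refine ⟨fun x' => χ x' * χ x' * χ x', g, fun i => cutoffSection χ fun y α => K α i y,
    (χ.contMDiff.mul χ.contMDiff).mul χ.contMDiff, by simp,
    fun i => ⟨hg i, by simp [g], jetSection_cutoffSection χ fun α => hK α i⟩, fun x' => ?_⟩
  by_cases hx' : x' ∈ e.source
  · apply jetCoord_inj he hx'
    have hsum : jetCoord e (∑ i, g i x' • cutoffSection χ (fun y α => K α i y) x') =
        ∑ i, g i x' • jetCoord e (cutoffSection χ (fun y α => K α i y) x') := by
      simp only [← jetEquiv_apply he hx', map_sum, map_smul]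
    rw [hsum, jetCoord_smul he hx']
    have hcut : ∀ i, jetCoord e (cutoffSection χ (fun y α => K α i y) x') =
        χ x' • (fun α => K α i (e x') : FPS d) := fun i => jetCoord_cutoffSection χ _ hx'
    simp only [hcut]
    ext α
    simp only [map_sum, map_smul, smul_eq_mul]
    have h1 : H α (e x') = χ x' * MvPowerSeries.coeff α (jetCoord e (s x')) := by
      change ψ _ * _ = _
      rw [hψχ x' hx', e.left_inv hx']
    rw [hKH α, hH0, zero_add] at h1
    rw [mul_assoc, ← h1, Finset.mul_sum]
    refine Finset.sum_congr rfl fun i _ => ?_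
    change _ = χ x' * (e x' i - e x i) * (χ x' * K α i (e x'))
    ring
  · simp [hχ0 x' hx', g]

/-- An operator on sections of the jet bundle which is linear over the smooth functions and kills
the jets of functions vanishes. -/
theorem eq_zero_of_tensorial {V : Type*} [AddCommGroup V] [Module ℝ V]
    (A : (∀ x : M, Jet d x) → V)
    (hadd : ∀ s t, JetSection s → JetSection t → A (fun x' => s x' + t x') = A s + A t)
    (hsmul : ∀ (g : M → ℝ) s, ContMDiff 𝓘(ℝ, Rd d) 𝓘(ℝ, ℝ) ∞ g → JetSection s →
      A (fun x' => g x' • s x') = g x • A s)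
    (hjet : ∀ f hf, A (jetSection d f hf) = 0) {s : ∀ x : M, Jet d x} (hs : JetSection s) :
    A s = 0 := by
  have hzero : A (fun _ => 0) = 0 := by
    have := hsmul (fun _ => 0) _ contMDiff_const jetSection_zero
    simpa using this
  have hsum : ∀ (S : Finset (Fin d)) (t : Fin d → ∀ x : M, Jet d x), (∀ i, JetSection (t i)) →
      A (fun x' => ∑ i ∈ S, t i x') = ∑ i ∈ S, A (t i) := by
    intro S t ht
    induction S using Finset.induction_on with
    | empty => simpa using hzero
    | insert i S hi ih =>
      simp only [Finset.sum_insert hi]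
      rw [hadd _ _ (ht i) (JetSection.sum S ht), ih]
  -- Linearity over functions evaluates coefficients at `x`: χ contributes 1, and every coefficient
  -- `g i` contributes 0.
  have hvan : ∀ s, JetSection s → s x = 0 → A s = 0 := by
    intro s hs h0
    obtain ⟨χ, g, t, hχ, hχ1, hgt, heq⟩ := exists_eq_sum_of_eq_zero hs h0
    have h1 := hsmul χ s hχ hs
    rw [hχ1, one_smul, funext heq, hsum _ (fun i x' => g i x' • t i x')
      fun i => (hgt i).2.2.smul (hgt i).1] at h1
    rw [← h1]
    exact Finset.sum_eq_zero fun i _ => by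
      rw [hsmul _ _ (hgt i).1 (hgt i).2.2, (hgt i).2.1, zero_smul]
  -- Subtracting the jet of a global function with the same value at `x` gives a section vanishing
  -- at `x`, and `A` kills both pieces.
  obtain ⟨f, hf, hfx⟩ := exists_jetSection_eq (s x)
  have hj := jetSection_jetSection f hf
  have hneg := hj.smul (contMDiff_const (c := (-1 : ℝ)))
  have h1 := hvan _ (hs.add hneg) (by simp [hfx])
  rw [hadd _ _ hs hneg, hsmul (fun _ => -1) _ contMDiff_const hj, hjet, smul_zero, add_zero] at h1
  exact h1

omit [T2Space M] in
theorem IsCanonicalConnection.apply_jetSection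
    {D : (∀ x : M, Jet d x) → ∀ x : M, TangentSpace 𝓘(ℝ, Rd d) x → Jet d x}
    (hD : IsCanonicalConnection D) (f : M → ℝ) (hf : ContMDiff 𝓘(ℝ, Rd d) 𝓘(ℝ, ℝ) ∞ f) (x : M)
    (v : TangentSpace 𝓘(ℝ, Rd d) x) : D (jetSection d f hf) x v = 0 :=
  (hD.horizontal_iff _ (jetSection_jetSection f hf)).2 ⟨f, hf, rfl⟩ x v

/-- The derivative terms of the two Leibniz rules cancel in the difference, which is therefore
tensorial, and both connections kill jets of global functions. -/
theorem IsCanonicalConnection.unique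
    {D D' : (∀ x : M, Jet d x) → ∀ x : M, TangentSpace 𝓘(ℝ, Rd d) x → Jet d x}
    (hD : IsCanonicalConnection D) (hD' : IsCanonicalConnection D') {s : ∀ x : M, Jet d x}
    (hs : JetSection s) : D s = D' s := by
  funext x v
  rw [← sub_eq_zero]
  refine eq_zero_of_tensorial (x := x) (fun s => D s x v - D' s x v) (fun s t hs ht => ?_)
    (fun g s hg hs => ?_) (fun f hf => ?_) hs
  · rw [hD.isConnection.add s t hs ht, hD'.isConnection.add s t hs ht]
    abel
  · rw [hD.isConnection.leibniz g s hg hs, hD'.isConnection.leibniz g s hg hs, smul_sub]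
    abel
  · rw [hD.apply_jetSection, hD'.apply_jetSection, sub_zero]

omit [T2Space M] in
theorem IsConnection.leibniz_dFun {V : M → Type*} [∀ x, AddCommGroup (V x)] [∀ x, Module ℝ (V x)]
    {Smooth : (∀ x, V x) → Prop}
    {D : (∀ x, V x) → ∀ x : M, TangentSpace 𝓘(ℝ, Rd d) x → V x}
    (hD : IsConnection Smooth D) {g : M → ℝ} {s : ∀ x, V x}
    (hg : ContMDiff 𝓘(ℝ, Rd d) 𝓘(ℝ, ℝ) ∞ g) (hs : Smooth s) (x : M)
    (v : TangentSpace 𝓘(ℝ, Rd d) x) :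
    D (fun x => g x • s x) x v = dFun (Rd d) g x v • s x + g x • D s x v :=
  hD.leibniz g s hg hs x v

/-- The canonical connection is flat. -/
theorem IsCanonicalConnection.isFlat
    {D : (∀ x : M, Jet d x) → ∀ x : M, TangentSpace 𝓘(ℝ, Rd d) x → Jet d x}
    (hD : IsCanonicalConnection D) : IsFlat JetSection D := by
  intro X Y hX hY s hs x
  have hc := hD.isConnection
  have hzero : ∀ v, D (fun _ => 0) x v = 0 := by
    intro v
    have := hc.leibniz_dFun (contMDiff_const (c := (0 : ℝ))) jetSection_zero x v
    simpa [dFun_const] using this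
  refine eq_zero_of_tensorial (x := x) (fun s => D (fun x => D s x (Y x)) x (X x) -
    D (fun x => D s x (X x)) x (Y x) - D s x (VectorField.mlieBracket 𝓘(ℝ, Rd d) X Y x))
    (fun s t hs ht => ?_) (fun g s hg hs => ?_) (fun f hf => ?_) hs
  · simp only [hc.add s t hs ht]
    rw [hc.add _ _ (hc.smooth s hs Y hY) (hc.smooth t ht Y hY),
      hc.add _ _ (hc.smooth s hs X hX) (hc.smooth t ht X hX)]
    abel
  · have hdg : ∀ Z, SmoothVF Z →
        ContMDiff 𝓘(ℝ, Rd d) 𝓘(ℝ, ℝ) ∞ fun x' => dFun (Rd d) g x' (Z x') :=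
      fun Z hZ x' => contMDiffAt_dFun (Eventually.of_forall fun y => hg y) hZ
    -- After antisymmetrization the mixed terms cancel, and the second derivatives of `g` combine to
    -- its derivative along the bracket, cancelling the Leibniz term of the last summand of the
    -- curvature.
    have key : ∀ Z W, SmoothVF Z → SmoothVF W →
        D (fun x => D (fun x => g x • s x) x (Z x)) x (W x) =
          (dFun (Rd d) (fun x' => dFun (Rd d) g x' (Z x')) x (W x) • s x +
            dFun (Rd d) g x (Z x) • D s x (W x)) +
          (dFun (Rd d) g x (W x) • D s x (Z x) + g x • D (fun x => D s x (Z x)) x (W x)) := by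
      intro Z W hZ hW
      simp only [hc.leibniz_dFun hg hs]
      rw [hc.add _ _ (hs.smul (hdg Z hZ)) ((hc.smooth s hs Z hZ).smul hg),
        hc.leibniz_dFun (hdg Z hZ) hs, hc.leibniz_dFun hg (hc.smooth s hs Z hZ)]
    rw [key Y X hY hX, key X Y hX hY, hc.leibniz_dFun hg hs,
      dFun_mlieBracket (Eventually.of_forall fun y => hg y) hX hY]
    simp only [smul_sub, sub_smul]
    abel
  · simp only [hD.apply_jetSection, hzero, sub_zero]

end Tensorial

/-! ### The isomorphism of bundles -/

section Pullback

variable {d : ℕ} {M : Type*} [TopologicalSpace M] [ChartedSpace (Rd d) M] {x : M}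
  {e : OpenPartialHomeomorph M (Rd d)}

theorem LocalParam.eventually_contMDiffAt (φ : LocalParam d M) :
    ∀ᶠ y in 𝓝 0, ContMDiffAt 𝓘(ℝ, Rd d) 𝓘(ℝ, Rd d) ∞ φ.toFun y := by
  obtain ⟨Ψ, h0, hΨ⟩ := φ.isLocalDiffeo
  filter_upwards [Ψ.open_source.mem_nhds h0] with y hy
  exact (Ψ.contMDiffOn_toFun.congr hΨ).contMDiffAt (Ψ.open_source.mem_nhds hy)

theorem LocalParam.smoothNear_chart_comp (φ : LocalParam d M)
    (he : e ∈ IsManifold.maximalAtlas 𝓘(ℝ, Rd d) ∞ M) (h0 : φ.toFun 0 ∈ e.source) :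
    SmoothNear (fun y => e (φ.toFun y)) 0 := by
  have hc : ContinuousAt φ.toFun 0 := φ.eventually_contMDiffAt.self_of_nhds.continuousAt
  filter_upwards [φ.eventually_contMDiffAt, hc.eventually (e.open_source.mem_nhds h0)] with y h1 h2
  exact (contMDiffAt_chart_comp he h1 h2).contDiffAt

theorem LocalParam.smoothNear_comp (φ : LocalParam d M) {f : M → ℝ}
    (hf : f ∈ smoothNear d (φ.toFun 0)) : SmoothNear (f ∘ φ.toFun) 0 := by
  have hc : ContinuousAt φ.toFun 0 := φ.eventually_contMDiffAt.self_of_nhds.continuousAt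
  filter_upwards [φ.eventually_contMDiffAt, hc.eventually hf] with y h1 h2
  exact (ContMDiffAt.comp y h2 h1).contDiffAt

theorem Mcoor.coord_mk_eq (φ : LocalParam d M)
    (he : e ∈ IsManifold.maximalAtlas 𝓘(ℝ, Rd d) ∞ M) (h0 : φ.toFun 0 ∈ e.source) :
    (Mcoor.mk φ).coord e = taylorMap (fun y => e (φ.toFun y)) 0 := by
  funext j
  ext α
  rw [Mcoor.coord_mk he φ h0, (φ.smoothNear_chart_comp he h0).coeff_taylorMap]
  rfl

theorem Mcoor.constantCoeff_coord (c : Mcoor d M)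
    (he : e ∈ IsManifold.maximalAtlas 𝓘(ℝ, Rd d) ∞ M) (h : c.base ∈ e.source) (j : Fin d) :
    MvPowerSeries.constantCoeff (c.coord e j) = e c.base j := by
  induction c using Quotient.ind with
  | _ φ =>
    change MvPowerSeries.constantCoeff ((Mcoor.mk φ).coord e j) = e (φ.toFun 0) j
    rw [Mcoor.coord_mk_eq φ he h, taylorMap, constantCoeff_taylor]

/-- The pull-back of jets of functions by jets of local parametrizations, in a chart. -/
theorem comp_coord_jetCoord (φ : LocalParam d M) (h : φ.toFun 0 = x)
    (he : e ∈ IsManifold.maximalAtlas 𝓘(ℝ, Rd d) ∞ M) (hx : x ∈ e.source) (f : smoothNear d x) :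
    comp ((Mcoor.mk φ).coord e) (jetCoord e (jet d x f)) = taylor ((f : M → ℝ) ∘ φ.toFun) 0 := by
  subst h
  rw [Mcoor.coord_mk_eq φ he hx, jetCoord_jet he hx,
    ← SmoothNear.taylor_comp (f := (f : M → ℝ) ∘ e.symm) (smoothNear_comp_symm he hx f.2)
      (φ.smoothNear_chart_comp he hx)]
  refine taylor_congr ?_
  have hc : ContinuousAt φ.toFun 0 := φ.eventually_contMDiffAt.self_of_nhds.continuousAt
  filter_upwards [hc.eventually (e.open_source.mem_nhds hx)] with y hy
  simp [e.left_inv hy]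

variable [IsManifold 𝓘(ℝ, Rd d) ∞ M]

/-- The pull-back of the jet of a function by the jet of a local parametrization. -/
def pullJet (c : Mcoor d M) (q : Jet d x) : FPS d :=
  comp (c.coord (chartAt (Rd d) x)) (jetCoord (chartAt (Rd d) x) q)

theorem pullJet_mk (φ : LocalParam d M) (h : φ.toFun 0 = x) (f : smoothNear d x) :
    pullJet (Mcoor.mk φ) (jet d x f) = taylor ((f : M → ℝ) ∘ φ.toFun) 0 :=
  comp_coord_jetCoord φ h (IsManifold.chart_mem_maximalAtlas x) (mem_chart_source _ x) f

/-- In every chart the composition is the expansion of f ∘ φ, in which no chart appears. This gives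
the freedom to use one fixed chart for all points near a given one. -/
theorem pullJet_eq (c : Mcoor d M) (h : c.base = x)
    (he : e ∈ IsManifold.maximalAtlas 𝓘(ℝ, Rd d) ∞ M) (hx : x ∈ e.source) (q : Jet d x) :
    pullJet c q = comp (c.coord e) (jetCoord e q) := by
  obtain ⟨f, rfl⟩ := Submodule.Quotient.mk_surjective _ q
  induction c using Quotient.ind with
  | _ φ => exact (pullJet_mk φ h f).trans (comp_coord_jetCoord φ h he hx f).symm

theorem pullJet_compLin (c : Mcoor d M) (h : c.base = x) (g : Rd d ≃L[ℝ] Rd d) (q : Jet d x) :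
    pullJet (c.compLin g) q = pull g (pullJet c q) := by
  obtain ⟨f, rfl⟩ := Submodule.Quotient.mk_surjective _ q
  induction c using Quotient.ind with
  | _ φ =>
    have h1 := pullJet_mk φ h f
    have h2 := pullJet_mk (φ.compLin g) ((congrArg φ.toFun (map_zero g)).trans h) f
    subst h
    exact h2.trans ((SmoothNear.taylor_comp_clm g (φ.smoothNear_comp f.2)).trans
      (congrArg (pull g) h1.symm))

theorem Mcoor.constantCoeff_det_ne_zero (c : Mcoor d M) (h : c.base = x) :
    MvPowerSeries.constantCoeff (jacobianMatrix (c.coord (chartAt (Rd d) x))).det ≠ 0 := by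
  subst h
  exact (MvPowerSeries.isUnit_iff_constantCoeff.1 c.isUnit_det_jacobian).ne_zero

/-- A function realizing the series by Borel's theorem is transported to M by a local inverse of the
parametrization. -/
theorem pullJet_surjective (c : Mcoor d M) (h : c.base = x) (f : FPS d) :
    ∃ q : Jet d x, pullJet c q = f := by
  obtain ⟨b, hb, hbf⟩ := exists_contDiff_taylor_eq f
  induction c using Quotient.ind with
  | _ φ =>
    have h' : φ.toFun 0 = x := h
    subst h'
    obtain ⟨Ψ, h0, hΨ⟩ := φ.isLocalDiffeo
    have hmem : φ.toFun 0 ∈ Ψ.target := by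
      rw [hΨ h0]
      exact Ψ.map_source h0
    have hs : b ∘ Ψ.symm ∈ smoothNear d (φ.toFun 0) := by
      filter_upwards [Ψ.open_target.mem_nhds hmem] with y hy
      exact ContMDiffAt.comp y hb.contDiffAt.contMDiffAt
        (Ψ.contMDiffOn_invFun.contMDiffAt (Ψ.open_target.mem_nhds hy))
    refine ⟨jet d _ ⟨_, hs⟩, (pullJet_mk φ rfl _).trans ?_⟩
    rw [← hbf]
    refine taylor_congr ?_
    filter_upwards [Ψ.open_source.mem_nhds h0] with y hy
    change b (Ψ.symm (φ.toFun y)) = b y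
    rw [hΨ hy]
    exact congrArg b (Ψ.left_inv hy)

/-- Pull-back by the jet of a local parametrization identifies jets at its base point with
formal power series. -/
def pullJetEquiv (c : Mcoor d M) (h : c.base = x) : Jet d x ≃ₗ[ℝ] FPS d :=
  LinearEquiv.ofBijective
    ((comp (c.coord (chartAt (Rd d) x))).toLinearMap ∘ₗ
      (jetEquiv (IsManifold.chart_mem_maximalAtlas x) (mem_chart_source (Rd d) x)).toLinearMap)
    ⟨(comp_injective (c.constantCoeff_det_ne_zero h)).comp (LinearEquiv.injective _),
      pullJet_surjective c h⟩

/-- `tildeFiberEquiv` as a linear equivalence. -/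
def tildeFiberLinearEquiv {a : Maff d M} (c : Mcoor d M) (h : Maff.mk c = a) :
    FPS d ≃ₗ[ℝ] TildeFiber a :=
  { tildeFiberEquiv c h with
    map_add' := fun f f' => (tildeFiber_mk_add c h f f').symm
    map_smul' := fun r f => (tildeFiber_mk_smul c h r f).symm }

omit [IsManifold 𝓘(ℝ, Rd d) ∞ M] in
theorem Maff.base_of_mk_eq {a : Maff d M} {c : Mcoor d M} (h : Maff.mk c = a) (ha : a.base = x) :
    c.base = x := by
  rw [← ha, ← h]
  rfl

/-- The isomorphism from the fibre of the jet bundle to the fibre of `Ẽ₀`. -/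
def jetIso {a : Maff d M} (ha : a.base = x) : Jet d x ≃ₗ[ℝ] TildeFiber a :=
  (pullJetEquiv (Quotient.out a) (Maff.base_of_mk_eq (Quotient.out_eq a) ha)).trans
    (tildeFiberLinearEquiv (Quotient.out a) (Quotient.out_eq a))

/-- Replacing c by c ∘ g replaces the expansion by its pull-back by g, which is the relation
defining `Tilde`; the chosen representative of `a` is thus immaterial. -/
theorem jetIso_apply {a : Maff d M} (ha : a.base = x) (c : Mcoor d M) (h : Maff.mk c = a)
    (q : Jet d x) : jetIso ha q = tildeFiberEquiv c h (pullJet c q) := by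
  obtain ⟨g, hg⟩ : (Mcoor.affSetoid d M).r c (Quotient.out a) :=
    Quotient.exact (h.trans (Quotient.out_eq a).symm)
  refine Subtype.ext (Quotient.sound (s := tildeSetoid d M) ⟨g, ?_⟩).symm
  change (Quotient.out a, pullJet (Quotient.out a) q) = _
  rw [← pullJet_compLin c (Maff.base_of_mk_eq h ha), ← hg]

/-- The action of GL(d, ℝ) is free, so a representative c determines the series. Arbitrary lifts can
therefore be recognized as pull-backs of jets. -/
theorem jetIso_eq_mk {a : Maff d M} (ha : a.base = x) {c : Mcoor d M} {f : FPS d} {q : Jet d x}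
    (h : (jetIso ha q).1 = Tilde.mk c f) : c.base = x ∧ f = pullJet c q := by
  have hc : Maff.mk c = a := by
    rw [← (jetIso ha q).2, h]
    rfl
  refine ⟨Maff.base_of_mk_eq hc ha, (tildeFiberEquiv c hc).injective (Subtype.ext ?_)⟩
  rw [← jetIso_apply ha c hc q, h]
  rfl

end Pullback

/-! ### Smoothness of the bundle isomorphism and of its inverse. -/

section Smoothness

variable {d : ℕ} {M : Type*} [TopologicalSpace M] [ChartedSpace (Rd d) M]
  {F : Type*} [NormedAddCommGroup F] [NormedSpace ℝ F]
  {N : Type*} [TopologicalSpace N] [ChartedSpace F N] {n : N}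

theorem CoorSmoothAt.comp_contMDiffAt {c : M → Mcoor d M} {b : N → M}
    (hc : CoorSmoothAt (Rd d) c (b n)) (hb : ContMDiffAt 𝓘(ℝ, F) 𝓘(ℝ, Rd d) ∞ b n) :
    CoorSmoothAt F (fun n' => c (b n')) n :=
  ⟨ContMDiffAt.comp (g := fun x => (c x).base) n hc.1 hb, fun e he h j α =>
    ContMDiffAt.comp (g := fun x => MvPowerSeries.coeff α ((c x).coord e j)) n (hc.2 e he h j α)
      hb⟩

variable [IsManifold 𝓘(ℝ, Rd d) ∞ M] {p : N → Σ x : M, Jet d x} {c : N → Mcoor d M}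

theorem eventually_pullJet_eq {e : OpenPartialHomeomorph M (Rd d)}
    (he : e ∈ IsManifold.maximalAtlas 𝓘(ℝ, Rd d) ∞ M)
    (hb : ContMDiffAt 𝓘(ℝ, F) 𝓘(ℝ, Rd d) ∞ (fun n' => (p n').1) n) (hn : (p n).1 ∈ e.source)
    (hcp : ∀ᶠ n' in 𝓝 n, (c n').base = (p n').1) :
    (fun n' => pullJet (c n') (p n').2) =ᶠ[𝓝 n]
      fun n' => comp ((c n').coord e) (jetCoord e (p n').2) := by
  filter_upwards [hcp, hb.continuousAt.eventually (e.open_source.mem_nhds hn)] with n' h1 h2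
  exact pullJet_eq _ h1 he h2 _

theorem seriesSmoothAt_pullJet (hc : CoorSmoothAt F c n) (hp : JetSmoothAt F p n)
    (hcp : ∀ᶠ n' in 𝓝 n, (c n').base = (p n').1) :
    SeriesSmoothAt F (fun n' => pullJet (c n') (p n').2) n := by
  have he := IsManifold.chart_mem_maximalAtlas (I := 𝓘(ℝ, Rd d)) (n := ∞) (p n).1
  have hn := mem_chart_source (Rd d) (p n).1
  exact (SeriesSmoothAt.comp (hc.2 _ he (hcp.self_of_nhds ▸ hn)) (hp.2 _ he hn)).congr
    (eventually_pullJet_eq he hp.1 hn hcp)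

theorem jetSmoothAt_of_pullJet (hc : CoorSmoothAt F c n)
    (hb : ContMDiffAt 𝓘(ℝ, F) 𝓘(ℝ, Rd d) ∞ (fun n' => (p n').1) n)
    (hcp : ∀ᶠ n' in 𝓝 n, (c n').base = (p n').1)
    (h : SeriesSmoothAt F (fun n' => pullJet (c n') (p n').2) n) : JetSmoothAt F p n := by
  have he := IsManifold.chart_mem_maximalAtlas (I := 𝓘(ℝ, Rd d)) (n := ∞) (p n).1
  have hn := mem_chart_source (Rd d) (p n).1
  exact jetSmoothAt_of_chart he hb hn
    (SeriesSmoothAt.of_comp (C := fun n' => (c n').coord (chartAt (Rd d) (p n).1))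
      (hc.2 _ he (hcp.self_of_nhds ▸ hn))
      ((c n).constantCoeff_det_ne_zero hcp.self_of_nhds)
      (h.congr (eventually_pullJet_eq he hb hn hcp).symm))

variable {σ : M → Maff d M}

theorem IsLiftAt.eventually_jetIso (hσ : ∀ x, (σ x).base = x) {u : N → FPS d}
    (h : IsLiftAt F (fun n' => (jetIso (hσ (p n').1) (p n').2).1) c u n) :
    ∀ᶠ n' in 𝓝 n, (c n').base = (p n').1 ∧ u n' = pullJet (c n') (p n').2 := by
  filter_upwards [h] with n' hn'
  exact jetIso_eq_mk _ hn'.2.2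

/-- A local lift of σ, composed with the base map of `p`, gives a lift to M^coor. Smoothness of `p`
is assumed near `n` because a lift has to be smooth on a neighbourhood. -/
theorem pullSmoothAt_jetIso (hσ : IsAffSection σ) (hp : ∀ᶠ n' in 𝓝 n, JetSmoothAt F p n') :
    PullSmoothAt F σ (fun n' => ⟨(p n').1, jetIso (hσ.base_eq (p n').1) (p n').2⟩) n := by
  have hb := hp.self_of_nhds.1
  obtain ⟨c, hc⟩ := hσ.smooth (p n).1
  refine ⟨hb, fun n' => c (p n').1, fun n' => pullJet (c (p n').1) (p n').2, ?_⟩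
  have hc' := hb.continuousAt.eventually hc
  filter_upwards [hp, hc'.eventually_nhds] with n' h1 h2
  have h3 := h2.self_of_nhds
  have h4 : CoorSmoothAt F (fun n' => c (p n').1) n' := CoorSmoothAt.comp_contMDiffAt (b := fun n' => (p n').1) h3.1 h1.1
  refine ⟨h4, seriesSmoothAt_pullJet h4 h1 ?_, ?_⟩
  · filter_upwards [h2] with m hm
    exact Maff.base_of_mk_eq hm.2.symm (hσ.base_eq _)
  · exact congrArg Subtype.val (jetIso_apply (hσ.base_eq _) _ h3.2.symm _)

/-- Whatever lift (c, u) witnesses smoothness, u is the pull-back of the jets by c, and the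
invertible Jacobian of c allows the jets to be recovered smoothly from u. -/
theorem jetSmoothAt_of_jetIso (hσ : ∀ x, (σ x).base = x)
    (hp : PullSmoothAt F σ (fun n' => ⟨(p n').1, jetIso (hσ (p n').1) (p n').2⟩) n) :
    JetSmoothAt F p n := by
  obtain ⟨hb, c, u, h⟩ := hp
  have h1 := IsLiftAt.eventually_jetIso hσ h
  exact jetSmoothAt_of_pullJet h.self_of_nhds.1 hb (h1.mono fun _ h => h.1)
    (h.self_of_nhds.2.1.congr (h1.mono fun _ h => h.2.symm))

theorem jetSection_iff (hσ : IsAffSection σ) (s : ∀ x : M, Jet d x) :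
    JetSection s ↔ PullSection σ fun x => jetIso (hσ.base_eq x) (s x) :=
  ⟨fun h _ => pullSmoothAt_jetIso (p := fun x => ⟨x, s x⟩) hσ (Eventually.of_forall h),
    fun h x => jetSmoothAt_of_jetIso (p := fun x => ⟨x, s x⟩) hσ.base_eq (h x)⟩

theorem trivialConn_congr {u w : N → FPS d} (h : u =ᶠ[𝓝 n] w) (v : TangentSpace 𝓘(ℝ, F) n) :
    trivialConn F c u n v = trivialConn F c w n v := by
  rw [trivialConn, trivialConn, dSeries_congr v h, h.self_of_nhds]

end Smoothness

/-! ### The Maurer-Cartan connection corresponds to the canonical connection. -/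

section Intertwining

variable {d : ℕ} {M : Type*} [TopologicalSpace M] [ChartedSpace (Rd d) M]
  [IsManifold 𝓘(ℝ, Rd d) ∞ M] {σ : M → Maff d M}

/-- The connection induced by the Maurer–Cartan form, computed with any lift, is the canonical
connection of the jet bundle. -/
theorem tildeFiberEquiv_trivialConn (hσ : ∀ x, (σ x).base = x) {s : ∀ x : M, Jet d x}
    {c : M → Mcoor d M} {u : M → FPS d} {x : M}
    (h : IsLiftAt (Rd d) (fun x' => (jetIso (hσ x') (s x')).1) c u x)
    (v : TangentSpace 𝓘(ℝ, Rd d) x) :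
    tildeFiberEquiv (c x) (IsLiftAt.proj_eq _ h) (trivialConn (Rd d) c u x v) =
      jetIso (hσ x) (canonConn s x v) := by
  have he := IsManifold.chart_mem_maximalAtlas (I := 𝓘(ℝ, Rd d)) (n := ∞) x
  have hx := mem_chart_source (Rd d) x
  have hev := IsLiftAt.eventually_jetIso (p := fun x => ⟨x, s x⟩) hσ h
  have hb : ∀ᶠ x' in 𝓝 x, (c x').base = x' := hev.mono fun _ h => h.1
  have hc := h.self_of_nhds.1
  have hus : SeriesSmoothAt (Rd d) (fun x' => pullJet (c x') (s x')) x :=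
    h.self_of_nhds.2.1.congr (hev.mono fun _ h => h.2.symm)
  have hs : JetSmoothAt (Rd d) (fun x => ⟨x, s x⟩) x :=
    jetSmoothAt_of_pullJet hc contMDiffAt_id hb hus
  -- In the fixed chart at `x` the lift is a composition of series, the form required by
  -- `trivialConn_comp`. The constant terms of the coordinates of c are those of the base point
  -- `x'`, so the velocity there is the one in `covDeriv`.
  have hu : u =ᶠ[𝓝 x] fun x' =>
      comp ((c x').coord (chartAt (Rd d) x)) (jetCoord (chartAt (Rd d) x) (s x')) :=
    (show u =ᶠ[𝓝 x] _ from hev.mono fun _ h => h.2).trans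
      (eventually_pullJet_eq (p := fun x => ⟨x, s x⟩) he contMDiffAt_id hx hb)
  have hbx : (c x).base = x := hb.self_of_nhds
  have key := trivialConn_comp v hc (hs.2 _ he hx)
  rw [hbx] at key
  rw [jetIso_apply (hσ x) (c x) (IsLiftAt.proj_eq _ h), pullJet_eq (c x) hbx he hx,
    jetCoord_canonConn he hx (hs.2 _ he hx), trivialConn_congr hu, key, covDeriv]
  congr 4
  funext j
  refine dFun_congr ?_ v
  filter_upwards [hb, (chartAt (Rd d) x).open_source.mem_nhds hx] with x' h1 h2
  rw [(c x').constantCoeff_coord he (h1.symm ▸ h2), h1]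

/-- The pulled back connection can be computed with any lift. -/
theorem tildeConn_eq (hσ : ∀ x, (σ x).base = x) (s : ∀ x, TildeFiber (σ x)) (c : M → Mcoor d M)
    (u : M → FPS d) (x : M) (h : IsLiftAt (Rd d) (fun x' => (s x').1) c u x)
    (v : TangentSpace 𝓘(ℝ, Rd d) x) :
    tildeConn (Rd d) σ s x v =
      tildeFiberEquiv (c x) (IsLiftAt.proj_eq _ h) (trivialConn (Rd d) c u x v) := by
  -- Written as the image of a jet section, the result for the given lift and for the chosen lift is
  -- the same canonical derivative; no gauge transformation between lifts has to be considered.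
  obtain ⟨t, rfl⟩ : ∃ t : ∀ x : M, Jet d x, s = fun x => jetIso (hσ x) (t x) :=
    ⟨fun x => (jetIso (hσ x)).symm (s x), by simp⟩
  have h' : ∃ (c : M → Mcoor d M) (u : M → FPS d),
      IsLiftAt (Rd d) (fun x' => (jetIso (hσ x') (t x')).1) c u x := ⟨c, u, h⟩
  rw [tildeConn, dif_pos h', tildeFiberEquiv_trivialConn hσ h,
    tildeFiberEquiv_trivialConn hσ h'.choose_spec.choose_spec]

theorem tildeConn_jetIso (hσ : IsAffSection σ) {s : ∀ x : M, Jet d x} (hs : JetSection s) (x : M)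
    (v : TangentSpace 𝓘(ℝ, Rd d) x) :
    tildeConn (Rd d) σ (fun x' => jetIso (hσ.base_eq x') (s x')) x v =
      jetIso (hσ.base_eq x) (canonConn s x v) := by
  obtain ⟨-, c, u, h⟩ := (jetSection_iff hσ s).1 hs x
  rw [tildeConn_eq hσ.base_eq _ c u x h, tildeFiberEquiv_trivialConn hσ.base_eq h]

end Intertwining

/-! ### Transport of connections and flatness along a fibrewise linear isomorphism. -/

section Transport

variable {d : ℕ} {M : Type*} [TopologicalSpace M] [ChartedSpace (Rd d) M]
  [IsManifold 𝓘(ℝ, Rd d) ∞ M]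
  {V W : M → Type*} [∀ x, AddCommGroup (V x)] [∀ x, Module ℝ (V x)]
  [∀ x, AddCommGroup (W x)] [∀ x, Module ℝ (W x)]
  {SV : (∀ x, V x) → Prop} {SW : (∀ x, W x) → Prop}
  {D : (∀ x, V x) → ∀ x : M, TangentSpace 𝓘(ℝ, Rd d) x → V x}
  {D' : (∀ x, W x) → ∀ x : M, TangentSpace 𝓘(ℝ, Rd d) x → W x}
  (Ψ : ∀ x, V x ≃ₗ[ℝ] W x) (hS : ∀ s, SV s ↔ SW fun x => Ψ x (s x))
  (hD' : ∀ s, SV s → ∀ x v, D' (fun x => Ψ x (s x)) x v = Ψ x (D s x v))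

include hS hD'

/-- `D'` is known only on images of smooth sections, so closure of these under sums and
multiplication by functions is needed before the additivity and Leibniz rules can be carried over.
-/
theorem IsConnection.transport (hadd : ∀ s t, SV s → SV t → SV fun x => s x + t x)
    (hsmul : ∀ (g : M → ℝ) s, ContMDiff 𝓘(ℝ, Rd d) 𝓘(ℝ, ℝ) ∞ g → SV s → SV fun x => g x • s x)
    (hD : IsConnection SV D) : IsConnection SW D' := by
  have hsurj : ∀ s, SW s → ∃ t, SV t ∧ s = fun x => Ψ x (t x) := fun s hs =>
    ⟨fun x => (Ψ x).symm (s x), (hS _).2 (by simpa using hs), by simp⟩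
  refine ⟨?_, ?_, ?_, ?_⟩
  · intro s hs x
    obtain ⟨t, ht, rfl⟩ := hsurj s hs
    rw [funext (hD' t ht x)]
    exact ((Ψ x).toLinearMap ∘ₗ (hD.linear t ht x).mk' _).isLinear
  · intro s hs X hX
    obtain ⟨t, ht, rfl⟩ := hsurj s hs
    simp only [hD' t ht]
    exact (hS _).1 (hD.smooth t ht X hX)
  · intro s s' hs hs' x v
    obtain ⟨t, ht, rfl⟩ := hsurj s hs
    obtain ⟨t', ht', rfl⟩ := hsurj s' hs'
    rw [hD' t ht, hD' t' ht', ← map_add, ← hD.add t t' ht ht', ← hD' _ (hadd t t' ht ht')]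
    simp only [map_add]
  · intro g s hg hs x v
    obtain ⟨t, ht, rfl⟩ := hsurj s hs
    rw [hD' t ht]
    have := congrArg (Ψ x) (hD.leibniz g t hg ht x v)
    rw [← hD' _ (hsmul g t hg ht), map_add, map_smul, map_smul] at this
    simpa only [map_smul] using this

theorem IsFlat.transport (hc : IsConnection SV D) (hD : IsFlat SV D) : IsFlat SW D' := by
  intro X Y hX hY s hs x
  obtain ⟨t, ht, rfl⟩ : ∃ t, SV t ∧ s = fun x => Ψ x (t x) :=
    ⟨fun x => (Ψ x).symm (s x), (hS _).2 (by simpa using hs), by simp⟩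
  simp only [hD' t ht]
  rw [hD' _ (hc.smooth t ht Y hY), hD' _ (hc.smooth t ht X hX), ← map_sub, ← map_sub,
    hD X Y hX hY t ht x, map_zero]

end Transport

/-! ### The pulled back connection and its flatness. -/

section PulledBackConnection

variable {d : ℕ} {M : Type*} [TopologicalSpace M] [ChartedSpace (Rd d) M]
  [IsManifold 𝓘(ℝ, Rd d) ∞ M] {σ : M → Maff d M}

theorem isConnection_tildeConn (hσ : IsAffSection σ) :
    IsConnection (PullSection σ) (tildeConn (Rd d) σ) := by
  refine IsConnection.transport (V := fun x : M => Jet d x) (SV := JetSection) (D := canonConn)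
    (fun x => jetIso (hσ.base_eq x)) (jetSection_iff hσ) ?_ ?_ ?_ ?_
  · exact fun s hs => tildeConn_jetIso hσ hs
  · exact fun s t hs ht => hs.add ht
  · exact fun g s hg hs => hs.smul hg
  · exact isConnection_canonConn

theorem isFlat_tildeConn [T2Space M] (hσ : IsAffSection σ) :
    IsFlat (PullSection σ) (tildeConn (Rd d) σ) := by
  refine IsFlat.transport (V := fun x : M => Jet d x) (SV := JetSection) (D := canonConn)
    (fun x => jetIso (hσ.base_eq x)) (jetSection_iff hσ) ?_ ?_ ?_
  · exact fun s hs => tildeConn_jetIso hσ hs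
  · exact isConnection_canonConn
  · exact isCanonicalConnection_canonConn.isFlat

end PulledBackConnection

end

end FormalGeometry

theorem mainTheorem5 (d : ℕ) (M : Type*) [TopologicalSpace M] [T2Space M]
    [ChartedSpace (Rd d) M]
    [IsManifold 𝓘(ℝ, Rd d) ∞ M]
    (σ : M → Maff d M) (hσ : IsAffSection σ) :
    -- `(E₀, D₀)`: the canonical connection exists, is unique and flat
    (∃ D₀, IsCanonicalConnection (M := M) (d := d) D₀) ∧
    (∀ D₀ D₀', IsCanonicalConnection (M := M) (d := d) D₀ →
      IsCanonicalConnection (M := M) (d := d) D₀' →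
      ∀ s, JetSection s → D₀ s = D₀' s) ∧
    (∀ D₀, IsCanonicalConnection (M := M) (d := d) D₀ →
      IsFlat JetSection D₀) ∧
    -- `D̃₀` descends to `Ẽ₀`: the pulled back connection can be computed with any local lift
    (∀ s : ∀ x, TildeFiber (σ x), ∀ c u x,
      ∀ h : IsLiftAt (Rd d) (fun x' => (s x').1) c u x,
      ∀ v, tildeConn (Rd d) σ s x v =
        tildeFiberEquiv (c x) (IsLiftAt.proj_eq _ h)
          (trivialConn (Rd d) c u x v)) ∧
    -- the pull-back of `(Ẽ₀, D̃₀)` by `σ` is a bundle with flat connection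
    IsConnection (PullSection σ)
      (tildeConn (Rd d) σ) ∧
    IsFlat (PullSection σ)
      (tildeConn (Rd d) σ) ∧
    -- the isomorphism
    ∃ Φ : ∀ x : M, Jet d x ≃ₗ[ℝ] TildeFiber (σ x),
      -- the jet of `f` at `x` is sent to the class of `(φₓ, Taylor expansion of f ∘ φₓ)`, for
      -- every representative `φₓ` of `σ x`
      (∀ (x : M) (φ : LocalParam d M),
        Maff.mk (Mcoor.mk φ) = σ x →
        ∀ f : smoothNear d x,
          (Φ x (jet d x f)).1 =
            Tilde.mk (Mcoor.mk φ)
              (taylor ((f : M → ℝ) ∘ φ.toFun) 0)) ∧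
      -- it is smooth with smooth inverse
      (∀ (k : ℕ) (p : Rd k → Σ x : M, Jet d x),
        (∀ n, JetSmoothAt (Rd k) p n) ↔
          ∀ n, PullSmoothAt (Rd k) σ
            (fun n' => ⟨(p n').1, Φ (p n').1 (p n').2⟩) n) ∧
      (∀ s : ∀ x : M, Jet d x, JetSection s ↔
        PullSection σ fun x => Φ x (s x)) ∧
      -- it intertwines the connections
      ∀ D₀, IsCanonicalConnection D₀ → ∀ s, JetSection s →
        ∀ x v, Φ x (D₀ s x v) =
          tildeConn (Rd d) σ (fun x' => Φ x' (s x')) x v := by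
  have hcan := isCanonicalConnection_canonConn (d := d) (M := M)
  refine ⟨⟨_, hcan⟩, fun D₀ D₀' h h' s hs => h.unique h' hs, fun D₀ h => h.isFlat,
    tildeConn_eq hσ.base_eq, isConnection_tildeConn hσ, isFlat_tildeConn hσ,
    fun x => jetIso (hσ.base_eq x), ?_, ?_, jetSection_iff hσ, ?_⟩
  · intro x φ hφ f
    rw [jetIso_apply (hσ.base_eq x) (Mcoor.mk φ) hφ,
      pullJet_mk φ (Maff.base_of_mk_eq hφ (hσ.base_eq x))]
    rfl
  -- Smoothness of `p` at every point supplies the neighbourhood hypothesis in the forward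
  -- direction; the converse holds pointwise.
  · exact fun k p => ⟨fun h _ => pullSmoothAt_jetIso hσ (Eventually.of_forall h),
      fun h n => jetSmoothAt_of_jetIso hσ.base_eq (h n)⟩
  · intro D₀ hD₀ s hs x v
    rw [tildeConn_jetIso hσ hs, hD₀.unique hcan hs]
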